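/- Let $T>0$. For $q\in L^2([0,T])=L^2([0,T],\mathbb C)$ and $\lambda\in\mathbb C$ let $F(\cdot,\lambda):[0,T]\to\mathbb C^{2\times 2}$ be the (absolutely continuous) solution of $$\tfrac{d}{dt}F=F\,\alpha^q_\lambda,\quad F(0,\lambda)=\mathbf 1,\qquad \alpha^q_\lambda=\tfrac12\begin{pmatrix} i\lambda & q\\ -\bar q & -i\lambda\end{pmatrix},$$ and let $M(\lambda)=F(T,\lambda)=\begin{pmatrix} a(\lambda)&b(\lambda)\\ c(\lambda)&d(\lambda)\end{pmatrix}$. Put $\lambda_{k,0}=\tfrac{2\pi k}{T}$. A sequence $(\lambda_k)_{k\in\mathbb Z}$ is called an enumeration for $q$ if it enumerates the zeros of the entire function $a-d$ with multiplicities and $\lambda_k-\lambda_{k,0}\in\ell^2(k)$; the corresponding perturbed Fourier coefficients are $z_k=2(-1)^k\,b(\lambda_k)$. Write $\widehat q(k)=\int_0^T q(t)\,e^{2\pi i kt/T}\,dt$ and, for $N\in\mathbb N$, $$L^2([0,T])_{q,N}=\{q_1\in L^2([0,T]) \mid \widehat{q_1}(k)=\widehat q(k)\ \text{for all } |k|\le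 N\}.$$ **Proposition.** For every $q\in L^2([0,T])$ there exists $N\in\mathbb N$ such that the following holds. (a) There is a choice of an enumeration $(\lambda_k(q_1))_{k\in\mathbb Z}$ for every $q_1\in L^2([0,T])$ such that for all $q_1$ in a neighbourhood of $q$ and all $|k|>N$, $\lambda_k(q_1)$ lies in the open disk with centre $\lambda_{k,0}$ and radius $\pi/T$ and is the only zero of $a-d$ (for the potential $q_1$) in that disk. (b) For every such choice, with corresponding perturbed Fourier coefficients $z_k(q_1)$, one has $(z_k(q_1))_{|k|>N}\in\ell^2(|k|>N)$ for every $q_1 \in L^2([0,T])$, and the map $$\Phi_N: L^2([0,T])_{q,N}\to \ell^2(|k|>N),\quad q_1\mapsto (z_k(q_1))_{|k|>N}$$ is a ($C^\infty$, with respect to the real Banach space structures) local diffeomorphism near $q$. -/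

import Mathlib

open MeasureTheory Filter Topology
open scoped Manifold ContDiff Matrix

/-- The space `L²([0,T])` of complex-valued square-integrable potentials. -/
abbrev Potential (T : ℝ) : Type := Lp ℂ 2 (volume.restrict (Set.Icc (0 : ℝ) T))

/-- The coefficient matrix `α^q = ½ (lam ε + q ε₊ + conj q ε₋)` at the point `t`, where
`ε = diag(i, -i)`, `ε₊ = (0 1; 0 0)` and `ε₋ = (0 0; -1 0)`. -/
noncomputable def alphaMatrix (T : ℝ) (q : Potential T) (lam : ℂ) (t : ℝ) :
    Matrix (Fin 2) (Fin 2) ℂ :=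
  (1 / 2 : ℂ) • (lam • !![Complex.I, 0; 0, -Complex.I] + q t • !![0, 1; 0, 0]
    + (starRingEnd ℂ) (q t) • !![0, 0; -1, 0])

/-- `F` solves `dF/dt = F α^q`, `F(0) = 1` on `[0,T]`. As `q` is only square-integrable, the
differential equation is meant in the sense of absolutely continuous functions, that is, as the
integral equation `F(t) = 1 + ∫₀ᵗ F(s) α^q(s) ds` for continuous `F` (entry by entry). -/
def IsExtendedFrame (T : ℝ) (q : Potential T) (lam : ℂ) (F : ℝ → Matrix (Fin 2) (Fin 2) ℂ) :
    Prop :=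
  ContinuousOn F (Set.Icc 0 T) ∧
    ∀ t ∈ Set.Icc (0 : ℝ) T, ∀ i j,
      F t i j = (1 : Matrix (Fin 2) (Fin 2) ℂ) i j
        + ∫ s in (0 : ℝ)..t, (F s * alphaMatrix T q lam s) i j

/-- The extended frame `F(·, lam)` of `q`: the solution (unique on `[0,T]`) of the initial value
problem. -/
noncomputable def extendedFrame (T : ℝ) (q : Potential T) (lam : ℂ) :
    ℝ → Matrix (Fin 2) (Fin 2) ℂ :=
  Classical.epsilon (IsExtendedFrame T q lam)

/-- The monodromy `M(lam) = F(T, lam)`, with entries `(a b; c d)`. -/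
noncomputable def monodromy (T : ℝ) (q : Potential T) (lam : ℂ) : Matrix (Fin 2) (Fin 2) ℂ :=
  extendedFrame T q lam T

/-- The function `a - d`, the difference of the diagonal entries of the monodromy. -/
noncomputable def diagDiff (T : ℝ) (q : Potential T) (lam : ℂ) : ℂ :=
  monodromy T q lam 0 0 - monodromy T q lam 1 1

/-- `lam_{k,0} = 2πk/T`, the zeros of `a - d` for the vacuum `q = 0`. -/
noncomputable def vacuumZero (T : ℝ) (k : ℤ) : ℂ := 2 * Real.pi / T * k

/-- The sequence `lam` enumerates the zeros of `a - d` with multiplicities, and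
`lam_k - lam_{k,0}` is square-summable. -/
def IsZeroEnumeration (T : ℝ) (q : Potential T) (lam : ℤ → ℂ) : Prop :=
  (∀ w : ℂ, analyticOrderAt (diagDiff T q) w = {k : ℤ | lam k = w}.encard) ∧
    Memℓp (fun k : ℤ => lam k - vacuumZero T k) 2

/-- A choice, for every potential, of an enumeration of the zeros of `a - d`. The enumeration of
the zeros is determined by the potential only up to the labels of finitely many of them; the second
field says that for all potentials close to `q` the labels of absolute value `> N` are the
natural ones: `lam_k` is the only zero in the disk with centre `lam_{k,0}` and radius `π/T`. -/
structure IsZeroLabelling (T : ℝ) (q : Potential T) (N : ℕ) (lam : Potential T → ℤ → ℂ) :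
    Prop where
  enumeration : ∀ q₁, IsZeroEnumeration T q₁ (lam q₁)
  label : ∀ᶠ q₁ in 𝓝 q, ∀ k : ℤ, (N : ℤ) < |k| →
    lam q₁ k ∈ Metric.ball (vacuumZero T k) (Real.pi / T) ∧
      ∀ w ∈ Metric.ball (vacuumZero T k) (Real.pi / T), diagDiff T q₁ w = 0 → w = lam q₁ k

/-- The perturbed Fourier coefficients `z_k = 2 (-1)^k b(lam_k)`. -/
noncomputable def perturbedFourierCoeff (T : ℝ) (q : Potential T) (lam : ℤ → ℂ) (k : ℤ) : ℂ :=
  2 * (-1) ^ k * monodromy T q (lam k) 0 1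

/-- The Fourier coefficients `∫₀ᵀ q(t) exp(2πikt/T) dt`. -/
noncomputable def potentialFourierCoeff (T : ℝ) (q : Potential T) (k : ℤ) : ℂ :=
  ∫ t in Set.Icc (0 : ℝ) T, q t * Complex.exp (2 * Real.pi * Complex.I / T * k * t)

theorem integrable_potential_mul_exp (T : ℝ) (q : Potential T) (k : ℤ) :
    Integrable (fun t : ℝ => q t * Complex.exp (2 * Real.pi * Complex.I / T * k * t))
      (volume.restrict (Set.Icc (0 : ℝ) T)) := by
  have hq : Integrable (fun t => q t) (volume.restrict (Set.Icc (0 : ℝ) T)) :=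
    (Lp.memLp q).integrable (by norm_num)
  refine hq.mul_bdd (c := 1) ?_ ?_
  · exact (by fun_prop : Continuous fun t : ℝ =>
      Complex.exp (2 * Real.pi * Complex.I / T * k * t)).aestronglyMeasurable
  · refine Eventually.of_forall fun t => ?_
    have : (2 * Real.pi * Complex.I / T * k * t : ℂ)
        = ((2 * Real.pi / T * k * t : ℝ) : ℂ) * Complex.I := by
      push_cast; ring
    rw [this, Complex.norm_exp_ofReal_mul_I]

theorem potentialFourierCoeff_add (T : ℝ) (p q : Potential T) (k : ℤ) :
    potentialFourierCoeff T (p + q) k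
      = potentialFourierCoeff T p k + potentialFourierCoeff T q k := by
  unfold potentialFourierCoeff
  rw [← integral_add (integrable_potential_mul_exp T p k) (integrable_potential_mul_exp T q k)]
  refine integral_congr_ae ?_
  filter_upwards [Lp.coeFn_add p q] with t ht
  rw [ht, Pi.add_apply, add_mul]

theorem potentialFourierCoeff_smul (T : ℝ) (c : ℝ) (q : Potential T) (k : ℤ) :
    potentialFourierCoeff T (c • q) k = c • potentialFourierCoeff T q k := by
  unfold potentialFourierCoeff
  rw [← integral_smul]
  refine integral_congr_ae ?_
  filter_upwards [Lp.coeFn_smul c q] with t ht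
  rw [ht, Pi.smul_apply, smul_mul_assoc]

/-- The affine subspace `L²([0,T])_{q,N}` of potentials with the same Fourier coefficients as `q`
for `|k| ≤ N`. -/
def sameFourierCoeffs (T : ℝ) (q : Potential T) (N : ℕ) : Set (Potential T) :=
  {q₁ | ∀ k : ℤ, |k| ≤ (N : ℤ) → potentialFourierCoeff T q₁ k = potentialFourierCoeff T q k}

/-- The direction `L²([0,T])_{0,N}` of the affine subspaces `L²([0,T])_{q,N}`, as a real
normed space. -/
noncomputable def vanishingFourierCoeffs (T : ℝ) (N : ℕ) : Submodule ℝ (Potential T) where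
  carrier := {h | ∀ k : ℤ, |k| ≤ (N : ℤ) → potentialFourierCoeff T h k = 0}
  add_mem' := fun hf hg k hk => by
    rw [potentialFourierCoeff_add, hf k hk, hg k hk, add_zero]
  zero_mem' := fun k _ => by
    simpa using potentialFourierCoeff_smul T 0 0 k
  smul_mem' := fun c f hf k hk => by
    rw [potentialFourierCoeff_smul, hf k hk, smul_zero]

/-- `L²([0,T])_{q,N} = q + L²([0,T])_{0,N}`. -/
theorem mem_sameFourierCoeffs_iff (T : ℝ) (q : Potential T) (N : ℕ) (q₁ : Potential T) :
    q₁ ∈ sameFourierCoeffs T q N ↔ ∃ h : vanishingFourierCoeffs T N, q₁ = q + h := by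
  constructor
  · intro hq
    refine ⟨⟨q₁ - q, fun k hk => ?_⟩, by simp⟩
    have h1 := potentialFourierCoeff_add T (q₁ - q) q k
    rw [sub_add_cancel, hq k hk] at h1
    exact (right_eq_add.mp h1)
  · rintro ⟨h, rfl⟩ k hk
    rw [potentialFourierCoeff_add, h.2 k hk, add_zero]

/-- The space `ℓ²(|k| > N)` of complex sequences. -/
abbrev EllTwoTail (N : ℕ) : Type := lp (fun _ : {k : ℤ // (N : ℤ) < |k|} => ℂ) 2

/-!
The rows of the extended frame solve systems `u' = ν u + p v`, `v' = r u - ν v` with initial value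
`(1, 0)`, whose coefficients `p`, `r` are multiples of `q` and of its complex conjugate and where
`ν = ± i lam / 2`. At `lam = lam_{k,0} + μ_k`, a gauge transformation by `exp (∓ i lam_{k,0} t / 2)`
turns the system into one with the small parameter `± i μ_k / 2` in place of `ν` and with `p`, `r`
twisted by `exp (∓ 2 π i k t / T)`. The Volterra operators of these systems are bounded uniformly
in `k` and uniformly quasinilpotent, so that the systems for all `k` together are one linear
equation in a space of square-summable sequences, with an invertible operator that depends affinely
on the coefficients. The primitives of the twisted coefficients are square-summable in `k` by
Bessel's inequality, and after an integration by parts they control all terms of the second and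
higher orders. Consequently (`exists_sequenceMaps`)

* `A (q, μ) = ((-1)^k (a - d) (lam_{k,0} + μ_k))_k` and
  `Z (q, μ) = (2 (-1)^k b (lam_{k,0} + μ_k))_k` are smooth maps from `L² × ℓ²` to `ℓ²`;
* at every point, the `k`-th components of their derivatives differ from `i T δμ_k` and from the
  Fourier coefficient of `δq`, respectively, by functionals whose norms are square-summable in `k`.

For `N` large, the derivatives on the components `|k| > N` are therefore small perturbations of
multiplication by `i T` and of the Fourier transform, which is an isomorphism from
`L²([0,T])_{0,N}` onto `ℓ²(|k| > N)` by Parseval's identity. The implicit function theorem applied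
to `A = 0` gives the zeros with labels `|k| > N` as a smooth function of the potential, and the
inverse function theorem applies to `Z` at these zeros (`exists_implicit_zeros`).

That enumerations exist (`exists_isZeroLabelling`) follows from Rouché's theorem, by comparison of
`a - d` with `2 i sin (lam T / 2)`. Its version for entire functions and circles is deduced from
the argument principle (`exists_card_eq_of_norm_sub_lt`). The estimate it needs,
`|a - d - 2 i sin (lam T / 2)| ≤ ε exp (|Im lam| T / 2)` for large `lam`, locally uniformly in
the potential, holds as the first Picard iterate is small by the Riemann–Lebesgue lemma and
controls the others in an exponentially weighted norm
(`exists_eventually_norm_diagDiff_sub_le`). Finally, `lam_k - lam_{k,0}` is square-summable,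
because the Schwarz lemma bounds it by a multiple of the `k`-th component of `A (q, 0)`.
-/

namespace PerturbedFourier

/-! ### Primitives of products of square-integrable functions -/

section Primitives

variable {T : ℝ}

theorem intervalIntegrable_of_integrable {E : Type*} [NormedAddCommGroup E] {f : ℝ → E}
    (hf : Integrable f (volume.restrict (Set.Icc (0 : ℝ) T))) {a b : ℝ}
    (ha : a ∈ Set.Icc (0 : ℝ) T) (hb : b ∈ Set.Icc (0 : ℝ) T) :
    IntervalIntegrable f volume a b := by
  have h : IntegrableOn f (Set.Icc 0 T) := hf
  refine (h.mono_set ?_).intervalIntegrable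
  exact Set.uIcc_subset_Icc ha hb

theorem integrable_mul_of_memLp {f g : ℝ → ℂ}
    (hf : MemLp f 2 (volume.restrict (Set.Icc (0 : ℝ) T)))
    (hg : MemLp g 2 (volume.restrict (Set.Icc (0 : ℝ) T))) :
    Integrable (fun s => f s * g s) (volume.restrict (Set.Icc (0 : ℝ) T)) :=
  hf.integrable_mul hg

theorem continuousOn_primitive {f : ℝ → ℂ}
    (hf : Integrable f (volume.restrict (Set.Icc (0 : ℝ) T))) :
    ContinuousOn (fun t => ∫ s in (0 : ℝ)..t, f s) (Set.Icc 0 T) := by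
  rcases le_or_gt 0 T with h | h
  · have := intervalIntegral.continuousOn_primitive_interval (μ := volume) (f := f)
      (a := 0) (b := T) (by rw [Set.uIcc_of_le h]; exact hf)
    rwa [Set.uIcc_of_le h] at this
  · rw [Set.Icc_eq_empty (not_le.mpr h)]
    exact continuousOn_empty _

theorem memLp_of_continuousOn {f : ℝ → ℂ} (hf : ContinuousOn f (Set.Icc 0 T)) :
    MemLp f 2 (volume.restrict (Set.Icc (0 : ℝ) T)) := by
  obtain ⟨C, hC⟩ := isCompact_Icc.exists_bound_of_continuousOn hf
  refine MemLp.of_bound (hf.aestronglyMeasurable measurableSet_Icc) C ?_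
  exact (ae_restrict_iff' measurableSet_Icc).mpr (Eventually.of_forall hC)

theorem integrable_sq_norm {f : ℝ → ℂ} (hf : MemLp f 2 (volume.restrict (Set.Icc (0 : ℝ) T))) :
    Integrable (fun s => ‖f s‖ ^ 2) (volume.restrict (Set.Icc (0 : ℝ) T)) :=
  (memLp_two_iff_integrable_sq_norm hf.1).mp hf

theorem setIntegral_Icc_eq_intervalIntegral (hT : 0 ≤ T) {E : Type*} [NormedAddCommGroup E]
    [NormedSpace ℝ E] (f : ℝ → E) :
    ∫ s in Set.Icc (0 : ℝ) T, f s = ∫ s in (0 : ℝ)..T, f s := by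
  rw [intervalIntegral.integral_of_le hT, integral_Icc_eq_integral_Ioc]

theorem ae_restrict_Ioc {P : ℝ → Prop} (hP : ∀ᵐ s ∂(volume.restrict (Set.Icc (0 : ℝ) T)), P s)
    {t : ℝ} (ht : t ∈ Set.Icc (0 : ℝ) T) :
    ∀ᵐ s ∂(volume.restrict (Set.uIoc 0 t)), P s := by
  refine ae_mono (Measure.restrict_mono ?_ le_rfl) hP
  rw [Set.uIoc_of_le ht.1]
  exact fun s hs => ⟨hs.1.le, hs.2.trans ht.2⟩

theorem primitive_congr {f g : ℝ → ℂ}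
    (h : ∀ᵐ s ∂(volume.restrict (Set.Icc (0 : ℝ) T)), f s = g s)
    {t : ℝ} (ht : t ∈ Set.Icc (0 : ℝ) T) :
    ∫ s in (0 : ℝ)..t, f s = ∫ s in (0 : ℝ)..t, g s :=
  intervalIntegral.integral_congr_ae_restrict (ae_restrict_Ioc h ht)

/-- The Cauchy–Schwarz inequality on `[0, t]`. -/
theorem norm_primitive_mul_sq_le {f g : ℝ → ℂ}
    (hf : MemLp f 2 (volume.restrict (Set.Icc (0 : ℝ) T)))
    (hg : MemLp g 2 (volume.restrict (Set.Icc (0 : ℝ) T))) {t : ℝ}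
    (ht : t ∈ Set.Icc (0 : ℝ) T) :
    ‖∫ s in (0 : ℝ)..t, f s * g s‖ ^ 2
      ≤ (∫ s in (0 : ℝ)..t, ‖f s‖ ^ 2) * ∫ s in (0 : ℝ)..t, ‖g s‖ ^ 2 := by
  have hsub : volume.restrict (Set.Ioc 0 t) ≤ volume.restrict (Set.Icc (0 : ℝ) T) :=
    Measure.restrict_mono
      (Set.Ioc_subset_Icc_self.trans (Set.Icc_subset_Icc le_rfl ht.2)) le_rfl
  have hf' := hf.mono_measure hsub
  have hg' := hg.mono_measure hsub
  rw [intervalIntegral.integral_of_le ht.1, intervalIntegral.integral_of_le ht.1,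
    intervalIntegral.integral_of_le ht.1]
  have h1 : ‖∫ s in Set.Ioc 0 t, f s * g s‖ ≤ ∫ s in Set.Ioc 0 t, ‖f s‖ * ‖g s‖ := by
    refine (norm_integral_le_integral_norm _).trans_eq ?_
    simp only [norm_mul]
  have h2 := integral_mul_norm_le_Lp_mul_Lq (p := 2) (q := 2) Real.HolderConjugate.two_two
    (by simpa using hf') (by simpa using hg')
  simp only [Real.rpow_two] at h2
  rw [← Real.sqrt_eq_rpow, ← Real.sqrt_eq_rpow] at h2
  have h3 := h1.trans h2
  calc _ ≤ (√(∫ a in Set.Ioc 0 t, ‖f a‖ ^ 2) * √(∫ a in Set.Ioc 0 t, ‖g a‖ ^ 2)) ^ 2 := by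
        gcongr
    _ = _ := by
        rw [mul_pow, Real.sq_sqrt (integral_nonneg fun _ => by positivity),
          Real.sq_sqrt (integral_nonneg fun _ => by positivity)]

theorem primitive_mono {f : ℝ → ℝ} (hf : Integrable f (volume.restrict (Set.Icc (0 : ℝ) T)))
    (h0 : ∀ s, 0 ≤ f s) {t t' : ℝ} (ht : t ∈ Set.Icc (0 : ℝ) T) (ht' : t' ∈ Set.Icc (0 : ℝ) T)
    (htt' : t ≤ t') : ∫ s in (0 : ℝ)..t, f s ≤ ∫ s in (0 : ℝ)..t', f s := by
  refine intervalIntegral.integral_mono_interval le_rfl ht.1 htt'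
    (Eventually.of_forall h0) (intervalIntegrable_of_integrable hf ⟨le_rfl, ht.1.trans ht.2⟩ ht')

/-- Fubini's theorem on the two triangles of the square `[0, t]²`: the product rule for two
primitives of integrable functions. -/
theorem primitive_mul_primitive {f g : ℝ → ℂ} {t : ℝ} (ht : 0 ≤ t)
    (hf : IntervalIntegrable f volume 0 t) (hg : IntervalIntegrable g volume 0 t) :
    (∫ s in (0 : ℝ)..t, f s) * (∫ s in (0 : ℝ)..t, g s)
      = (∫ s in (0 : ℝ)..t, f s * ∫ x in (0 : ℝ)..s, g x)
        + ∫ s in (0 : ℝ)..t, g s * ∫ x in (0 : ℝ)..s, f x := by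
  set ν : Measure ℝ := volume.restrict (Set.Ioc 0 t) with hν
  have hf' : Integrable f ν := (intervalIntegrable_iff_integrableOn_Ioc_of_le ht).mp hf
  have hg' : Integrable g ν := (intervalIntegrable_iff_integrableOn_Ioc_of_le ht).mp hg
  have hfg : Integrable (fun z : ℝ × ℝ => f z.1 * g z.2) (ν.prod ν) := hf'.mul_prod hg'
  -- the part of the square below the diagonal, for either order of the factors
  have key : ∀ u w : ℝ → ℂ, (∫ s in (0 : ℝ)..t, u s * ∫ x in (0 : ℝ)..s, w x)
      = ∫ s, (∫ x, {z : ℝ × ℝ | z.2 ≤ z.1}.indicator (fun z => u z.1 * w z.2) (s, x) ∂ν) ∂ν := by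
    intro u w
    rw [intervalIntegral.integral_of_le ht]
    refine setIntegral_congr_fun measurableSet_Ioc fun s hs => ?_
    rw [intervalIntegral.integral_of_le hs.1.le, ← integral_const_mul]
    have : ∀ x, {z : ℝ × ℝ | z.2 ≤ z.1}.indicator (fun z => u z.1 * w z.2) (s, x)
        = (Set.Iic s).indicator (fun x => u s * w x) x := by
      intro x
      simp [Set.indicator_apply]
    simp only [this]
    rw [integral_indicator measurableSet_Iic, hν, Measure.restrict_restrict measurableSet_Iic]
    congr 2
    ext x
    simp only [Set.mem_Ioc, Set.mem_inter_iff, Set.mem_Iic]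
    exact ⟨fun h => ⟨h.2, h.1, h.2.trans hs.2⟩, fun h => ⟨h.2.1, h.1⟩⟩
  have hms : MeasurableSet {z : ℝ × ℝ | z.2 ≤ z.1} := measurableSet_le measurable_snd measurable_fst
  rw [key f g, key g f]
  have e1 : (∫ s in (0 : ℝ)..t, f s) * (∫ s in (0 : ℝ)..t, g s)
      = ∫ z, f z.1 * g z.2 ∂(ν.prod ν) := by
    rw [integral_prod_mul, intervalIntegral.integral_of_le ht, intervalIntegral.integral_of_le ht]
  have hI1 : Integrable ({z : ℝ × ℝ | z.2 ≤ z.1}.indicator (fun z => f z.1 * g z.2))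
      (ν.prod ν) := hfg.indicator hms
  rw [e1, ← integral_add_compl hms hfg, ← integral_indicator hms, integral_prod _ hI1,
    ← integral_indicator hms.compl, integral_prod_symm _ (hfg.indicator hms.compl)]
  congr 1
  refine integral_congr_ae (Eventually.of_forall fun s => ?_)
  refine integral_congr_ae ?_
  -- the two descriptions of the second triangle differ by the null set `{s}`
  have hne : ∀ᵐ x ∂ν, x ≠ s := by
    refine ae_restrict_of_ae ?_
    exact Measure.ae_ne volume s
  filter_upwards [hne] with x hx
  by_cases h : x ≤ s
  · have h' : ¬ s ≤ x := fun h'' => hx (le_antisymm h h'')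
    simp [h, h', mul_comm]
  · have h' : s ≤ x := (not_le.mp h).le
    simp [h, h']

end Primitives

/-! ### Volterra operators on `L²([0,T])` -/

section Volterra

variable (T : ℝ)

theorem norm_potential_sq (hT : 0 ≤ T) (x : Potential T) :
    ‖x‖ ^ 2 = ∫ s in (0 : ℝ)..T, ‖x s‖ ^ 2 := by
  have h : (‖x‖ ^ 2 : ℂ) = ∫ s in Set.Icc (0 : ℝ) T, ((‖x s‖ ^ 2 : ℝ) : ℂ) := by
    have h1 := inner_self_eq_norm_sq_to_K (𝕜 := ℂ) x
    rw [L2.inner_def] at h1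
    rw [show ((‖x‖ : ℂ)) = ((‖x‖ : ℝ) : ℂ) from rfl] at *
    simp only [Complex.coe_algebraMap] at h1
    rw [← h1]
    refine integral_congr_ae (Eventually.of_forall fun s => ?_)
    simp only
    rw [inner_self_eq_norm_sq_to_K]
    simp
  rw [integral_complex_ofReal, setIntegral_Icc_eq_intervalIntegral hT] at h
  exact_mod_cast h

theorem primitive_sq_le (hT : 0 ≤ T) (x : Potential T) {t : ℝ} (ht : t ∈ Set.Icc (0 : ℝ) T) :
    ∫ s in (0 : ℝ)..t, ‖x s‖ ^ 2 ≤ ‖x‖ ^ 2 := by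
  rw [norm_potential_sq T hT]
  exact primitive_mono (integrable_sq_norm (Lp.memLp x)) (fun _ => by positivity) ht
    ⟨hT, le_rfl⟩ ht.2

theorem norm_primitive_mul_le (p x : Potential T) {t : ℝ}
    (ht : t ∈ Set.Icc (0 : ℝ) T) : ‖∫ s in (0 : ℝ)..t, p s * x s‖ ≤ ‖p‖ * ‖x‖ := by
  have hT : 0 ≤ T := ht.1.trans ht.2
  have h := norm_primitive_mul_sq_le (Lp.memLp p) (Lp.memLp x) ht
  refine le_of_sq_le_sq ?_ (by positivity)
  rw [mul_pow]
  refine h.trans ?_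
  gcongr
  · exact intervalIntegral.integral_nonneg ht.1 fun _ _ => by positivity
  · exact primitive_sq_le T hT p ht
  · exact primitive_sq_le T hT x ht

theorem memLp_volterra (p x : Potential T) :
    MemLp (fun t => ∫ s in (0 : ℝ)..t, p s * x s) 2 (volume.restrict (Set.Icc (0 : ℝ) T)) :=
  memLp_of_continuousOn (continuousOn_primitive
    (integrable_mul_of_memLp (Lp.memLp p) (Lp.memLp x)))

/-- An `L²` bound from a uniform bound. -/
theorem norm_toLp_le {f : ℝ → ℂ} (hf : MemLp f 2 (volume.restrict (Set.Icc (0 : ℝ) T))) {C : ℝ}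
    (hC : 0 ≤ C) (h : ∀ t ∈ Set.Icc (0 : ℝ) T, ‖f t‖ ≤ C) : ‖hf.toLp f‖ ≤ √T * C := by
  rcases le_or_gt 0 T with hT | hT
  · have h1 : ‖hf.toLp f‖ ^ 2 ≤ T * C ^ 2 := by
      rw [norm_potential_sq T hT]
      have h2 : ∫ s in (0 : ℝ)..T, ‖hf.toLp f s‖ ^ 2 ≤ ∫ s in (0 : ℝ)..T, C ^ 2 := by
        refine intervalIntegral.integral_mono_ae_restrict hT
          (intervalIntegrable_of_integrable (integrable_sq_norm (Lp.memLp _)) ⟨le_rfl, hT⟩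
            ⟨hT, le_rfl⟩) (by simp) ?_
        filter_upwards [hf.coeFn_toLp, ae_restrict_mem measurableSet_Icc] with s hs hs'
        rw [hs]
        have := h s hs'
        gcongr
      simpa using h2
    refine le_of_sq_le_sq ?_ (by positivity)
    rwa [mul_pow, Real.sq_sqrt hT]
  · have h0 : ‖hf.toLp f‖ = 0 := by
      have : volume.restrict (Set.Icc (0 : ℝ) T) = 0 := by
        rw [Set.Icc_eq_empty (not_le.mpr hT), Measure.restrict_empty]
      rw [Lp.norm_toLp, this, eLpNorm_measure_zero, ENNReal.toReal_zero]
    rw [h0]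
    positivity

/-- The bilinear Volterra operator `(p, x) ↦ (t ↦ ∫₀ᵗ p x)` on `L²([0,T])`. -/
noncomputable def vol : Potential T →L[ℂ] Potential T →L[ℂ] Potential T :=
  LinearMap.mkContinuous₂
    (LinearMap.mk₂ ℂ (fun p x => (memLp_volterra T p x).toLp _)
      (fun p p' x => by
        rw [← MemLp.toLp_add]
        refine MemLp.toLp_congr _ _ ?_
        filter_upwards [ae_restrict_mem measurableSet_Icc] with t ht
        simp only [Pi.add_apply]
        have h0 : (0 : ℝ) ∈ Set.Icc 0 T := ⟨le_rfl, ht.1.trans ht.2⟩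
        rw [← intervalIntegral.integral_add
          (intervalIntegrable_of_integrable (integrable_mul_of_memLp (Lp.memLp p) (Lp.memLp x))
            h0 ht)
          (intervalIntegrable_of_integrable (integrable_mul_of_memLp (Lp.memLp p') (Lp.memLp x))
            h0 ht)]
        refine primitive_congr ?_ ht
        filter_upwards [Lp.coeFn_add p p'] with s hs
        rw [hs, Pi.add_apply, add_mul])
      (fun c p x => by
        rw [← MemLp.toLp_const_smul]
        refine MemLp.toLp_congr _ _ ?_
        filter_upwards [ae_restrict_mem measurableSet_Icc] with t ht
        simp only [Pi.smul_apply]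
        rw [← intervalIntegral.integral_smul]
        refine primitive_congr ?_ ht
        filter_upwards [Lp.coeFn_smul c p] with s hs
        rw [hs, Pi.smul_apply, smul_mul_assoc])
      (fun p x x' => by
        rw [← MemLp.toLp_add]
        refine MemLp.toLp_congr _ _ ?_
        filter_upwards [ae_restrict_mem measurableSet_Icc] with t ht
        simp only [Pi.add_apply]
        have h0 : (0 : ℝ) ∈ Set.Icc 0 T := ⟨le_rfl, ht.1.trans ht.2⟩
        rw [← intervalIntegral.integral_add
          (intervalIntegrable_of_integrable (integrable_mul_of_memLp (Lp.memLp p) (Lp.memLp x))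
            h0 ht)
          (intervalIntegrable_of_integrable (integrable_mul_of_memLp (Lp.memLp p) (Lp.memLp x'))
            h0 ht)]
        refine primitive_congr ?_ ht
        filter_upwards [Lp.coeFn_add x x'] with s hs
        rw [hs, Pi.add_apply, mul_add])
      (fun c p x => by
        rw [← MemLp.toLp_const_smul]
        refine MemLp.toLp_congr _ _ ?_
        filter_upwards [ae_restrict_mem measurableSet_Icc] with t ht
        simp only [Pi.smul_apply]
        rw [← intervalIntegral.integral_smul]
        refine primitive_congr ?_ ht
        filter_upwards [Lp.coeFn_smul c x] with s hs
        rw [hs, Pi.smul_apply, mul_smul_comm]))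
    (√T) (fun p x => by
      have := norm_toLp_le T (memLp_volterra T p x) (C := ‖p‖ * ‖x‖) (by positivity)
        fun t ht => norm_primitive_mul_le T p x ht
      simpa [mul_assoc] using this)

theorem vol_ae (p x : Potential T) :
    ∀ᵐ t ∂(volume.restrict (Set.Icc (0 : ℝ) T)),
      vol T p x t = ∫ s in (0 : ℝ)..t, p s * x s :=
  (memLp_volterra T p x).coeFn_toLp

theorem norm_vol_le (p x : Potential T) : ‖vol T p x‖ ≤ √T * ‖p‖ * ‖x‖ := by
  have := norm_toLp_le T (memLp_volterra T p x) (C := ‖p‖ * ‖x‖) (by positivity)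
        fun t ht => norm_primitive_mul_le T p x ht
  rw [mul_assoc]
  exact this

/-- The bilinear pairing `(p, x) ↦ ∫₀ᵀ p x` on `L²([0,T])`. -/
noncomputable def pair (hT : 0 ≤ T) : Potential T →L[ℂ] Potential T →L[ℂ] ℂ :=
  LinearMap.mkContinuous₂
    (LinearMap.mk₂ ℂ (fun p x => ∫ s in (0 : ℝ)..T, p s * x s)
      (fun p p' x => by
        have h0 : (0 : ℝ) ∈ Set.Icc 0 T := ⟨le_rfl, hT⟩
        have h1 : T ∈ Set.Icc 0 T := ⟨hT, le_rfl⟩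
        rw [← intervalIntegral.integral_add
          (intervalIntegrable_of_integrable (integrable_mul_of_memLp (Lp.memLp p) (Lp.memLp x))
            h0 h1)
          (intervalIntegrable_of_integrable (integrable_mul_of_memLp (Lp.memLp p') (Lp.memLp x))
            h0 h1)]
        refine primitive_congr ?_ h1
        filter_upwards [Lp.coeFn_add p p'] with s hs
        rw [hs, Pi.add_apply, add_mul])
      (fun c p x => by
        rw [← intervalIntegral.integral_smul]
        refine primitive_congr ?_ ⟨hT, le_rfl⟩
        filter_upwards [Lp.coeFn_smul c p] with s hs
        rw [hs, Pi.smul_apply, smul_mul_assoc])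
      (fun p x x' => by
        have h0 : (0 : ℝ) ∈ Set.Icc 0 T := ⟨le_rfl, hT⟩
        have h1 : T ∈ Set.Icc 0 T := ⟨hT, le_rfl⟩
        rw [← intervalIntegral.integral_add
          (intervalIntegrable_of_integrable (integrable_mul_of_memLp (Lp.memLp p) (Lp.memLp x))
            h0 h1)
          (intervalIntegrable_of_integrable (integrable_mul_of_memLp (Lp.memLp p) (Lp.memLp x'))
            h0 h1)]
        refine primitive_congr ?_ h1
        filter_upwards [Lp.coeFn_add x x'] with s hs
        rw [hs, Pi.add_apply, mul_add])
      (fun c p x => by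
        rw [← intervalIntegral.integral_smul]
        refine primitive_congr ?_ ⟨hT, le_rfl⟩
        filter_upwards [Lp.coeFn_smul c x] with s hs
        rw [hs, Pi.smul_apply, mul_smul_comm]))
    1 (fun p x => by
      simpa using norm_primitive_mul_le T p x ⟨hT, le_rfl⟩)

theorem pair_apply (hT : 0 ≤ T) (p x : Potential T) :
    pair T hT p x = ∫ s in (0 : ℝ)..T, p s * x s := rfl

theorem norm_pair_le (hT : 0 ≤ T) (p x : Potential T) : ‖pair T hT p x‖ ≤ ‖p‖ * ‖x‖ :=
  norm_primitive_mul_le T p x ⟨hT, le_rfl⟩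

/-- The constant function `1` as an element of `L²([0,T])`. -/
noncomputable def one : Potential T :=
  MemLp.toLp (fun _ : ℝ => (1 : ℂ)) (memLp_const 1)

theorem one_ae : ∀ᵐ t ∂(volume.restrict (Set.Icc (0 : ℝ) T)), one T t = 1 :=
  MemLp.coeFn_toLp (memLp_const 1)

end Volterra


/-! ### The first-order system as a Volterra equation -/

section System

variable (T : ℝ)

theorem vol_one_ae (p : Potential T) :
    ∀ᵐ t ∂(volume.restrict (Set.Icc (0 : ℝ) T)), vol T p (one T) t = ∫ s in (0 : ℝ)..t, p s := by
  filter_upwards [vol_ae T p (one T), ae_restrict_mem measurableSet_Icc] with t ht ht'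
  rw [ht]
  refine primitive_congr ?_ ht'
  filter_upwards [one_ae T] with s hs
  rw [hs, mul_one]

theorem norm_primitive_le (r : Potential T) {t : ℝ} (ht : t ∈ Set.Icc (0 : ℝ) T) :
    ‖∫ s in (0 : ℝ)..t, r s‖ ≤ ‖r‖ * ‖one T‖ := by
  have h := norm_primitive_mul_le T r (one T) ht
  have h2 : ∫ s in (0 : ℝ)..t, r s * one T s = ∫ s in (0 : ℝ)..t, r s := by
    refine primitive_congr ?_ ht
    filter_upwards [one_ae T] with s hs
    rw [hs, mul_one]
  rwa [h2] at h

theorem integrable_potential (p : Potential T) :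
    Integrable (fun t => p t) (volume.restrict (Set.Icc (0 : ℝ) T)) :=
  (Lp.memLp p).integrable (by norm_num)

theorem primitive_mul_vol_one (p r : Potential T) {t : ℝ} (ht : t ∈ Set.Icc (0 : ℝ) T) :
    (∫ s in (0 : ℝ)..t, p s * vol T r (one T) s) + (∫ s in (0 : ℝ)..t, r s * vol T p (one T) s)
      = (∫ s in (0 : ℝ)..t, p s) * ∫ s in (0 : ℝ)..t, r s := by
  have h0 : (0 : ℝ) ∈ Set.Icc 0 T := ⟨le_rfl, ht.1.trans ht.2⟩
  rw [primitive_mul_primitive ht.1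
    (intervalIntegrable_of_integrable (integrable_potential T p) h0 ht)
    (intervalIntegrable_of_integrable (integrable_potential T r) h0 ht)]
  congr 1
  · refine primitive_congr ?_ ht
    filter_upwards [vol_one_ae T r] with s hs
    rw [hs]
  · refine primitive_congr ?_ ht
    filter_upwards [vol_one_ae T p] with s hs
    rw [hs]

/-- Integrating by parts moves the smallness of `∫₀ᵗ p` onto the iterated integral of `p` and
`r`. -/
theorem norm_vol_vol_one_le (p r : Potential T) :
    ‖vol T p (vol T r (one T))‖ ≤ (‖one T‖ + √T) * ‖r‖ * ‖vol T p (one T)‖ := by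
  have h1 : ‖vol T p (vol T r (one T)) + vol T r (vol T p (one T))‖
      ≤ (‖r‖ * ‖one T‖) * ‖vol T p (one T)‖ := by
    refine Lp.norm_le_mul_norm_of_ae_le_mul ?_
    filter_upwards [Lp.coeFn_add (vol T p (vol T r (one T))) (vol T r (vol T p (one T))),
      vol_ae T p (vol T r (one T)), vol_ae T r (vol T p (one T)), vol_one_ae T p,
      ae_restrict_mem measurableSet_Icc] with t h h1 h2 h3 ht
    rw [h, Pi.add_apply, h1, h2, primitive_mul_vol_one T p r ht, h3, norm_mul, mul_comm]
    gcongr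
    exact norm_primitive_le T r ht
  have h2 := norm_vol_le T r (vol T p (one T))
  calc ‖vol T p (vol T r (one T))‖
      = ‖(vol T p (vol T r (one T)) + vol T r (vol T p (one T)))
          - vol T r (vol T p (one T))‖ := by rw [add_sub_cancel_right]
    _ ≤ _ := norm_sub_le _ _
    _ ≤ (‖r‖ * ‖one T‖) * ‖vol T p (one T)‖ + √T * ‖r‖ * ‖vol T p (one T)‖ := add_le_add h1 h2
    _ = _ := by ring

theorem pair_one_apply (hT : 0 ≤ T) (p : Potential T) :
    pair T hT p (one T) = ∫ s in (0 : ℝ)..T, p s := by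
  rw [pair_apply]
  refine primitive_congr ?_ ⟨hT, le_rfl⟩
  filter_upwards [one_ae T] with s hs
  rw [hs, mul_one]

theorem norm_pair_vol_one_le (hT : 0 ≤ T) (p r : Potential T) :
    ‖pair T hT p (vol T r (one T))‖
      ≤ (‖one T‖ + 1) * ‖r‖ * (‖pair T hT p (one T)‖ + ‖vol T p (one T)‖) := by
  have h := primitive_mul_vol_one T p r (t := T) ⟨hT, le_rfl⟩
  rw [← pair_apply T hT, ← pair_apply T hT, ← pair_one_apply T hT, ← pair_one_apply T hT] at h
  rw [eq_sub_of_add_eq h]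
  have h1 := norm_pair_le T hT r (vol T p (one T))
  have h2 := norm_pair_le T hT r (one T)
  refine (norm_sub_le _ _).trans ?_
  rw [norm_mul]
  have h3 : ‖pair T hT p (one T)‖ * ‖pair T hT r (one T)‖
      ≤ ‖pair T hT p (one T)‖ * (‖r‖ * ‖one T‖) := by gcongr
  have := norm_nonneg r
  have := norm_nonneg (one T)
  have := norm_nonneg (pair T hT p (one T))
  have := norm_nonneg (vol T p (one T))
  nlinarith [mul_nonneg ‹0 ≤ ‖r‖› ‹0 ≤ ‖pair T hT p (one T)‖›,
    mul_nonneg (mul_nonneg ‹0 ≤ ‖r‖› ‹0 ≤ ‖one T‖›) ‹0 ≤ ‖vol T p (one T)‖›]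

/-- The coefficients `(p, r, ν)` of the system `u' = ν u + p v`, `v' = r u - ν v`. -/
abbrev Coeff : Type := Potential T × Potential T × ℂ

/-- The right-hand side `(u, v) ↦ (ν u + p v, r u - ν v)` of the system, composed with a bilinear
map `β` that stands for an integration. -/
noncomputable def block {Z : Type*} [NormedAddCommGroup Z] [NormedSpace ℂ Z]
    (β : Potential T →L[ℂ] Potential T →L[ℂ] Z) :
    Coeff T →L[ℂ] (Potential T × Potential T) →L[ℂ] Z × Z :=
  LinearMap.mkContinuous₂
    (LinearMap.mk₂ ℂ (fun θ w => (θ.2.2 • β (one T) w.1 + β θ.1 w.2,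
        β θ.2.1 w.1 - θ.2.2 • β (one T) w.2))
      (fun θ θ' w => by
        ext <;> simp [add_smul] <;> abel)
      (fun c θ w => by
        ext <;> simp [mul_smul, smul_sub])
      (fun θ w w' => by
        ext <;> simp [smul_add] <;> abel)
      (fun c θ w => by
        ext <;> simp [smul_sub, smul_comm c]))
    (‖β‖ * (‖one T‖ + 1)) (fun θ w => by
      have h1 : ‖θ.1‖ ≤ ‖θ‖ := norm_fst_le θ
      have h2 : ‖θ.2.1‖ ≤ ‖θ‖ := (norm_fst_le θ.2).trans (norm_snd_le θ)
      have h3 : ‖θ.2.2‖ ≤ ‖θ‖ := (norm_snd_le θ.2).trans (norm_snd_le θ)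
      have h4 : ‖w.1‖ ≤ ‖w‖ := norm_fst_le w
      have h5 : ‖w.2‖ ≤ ‖w‖ := norm_snd_le w
      have hb : ∀ p x : Potential T, ‖β p x‖ ≤ ‖β‖ * ‖p‖ * ‖x‖ := β.le_opNorm₂
      have e1 : ‖β‖ * (‖one T‖ + 1) * ‖θ‖ * ‖w‖
          = ‖θ‖ * (‖β‖ * ‖one T‖ * ‖w‖) + ‖β‖ * ‖θ‖ * ‖w‖ := by ring_nf
      simp only [LinearMap.mk₂_apply]
      refine norm_prod_le_iff.mpr ⟨?_, ?_⟩
      · refine (norm_add_le _ _).trans ?_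
        rw [e1, norm_smul]
        refine add_le_add ?_ ((hb _ _).trans (by gcongr))
        exact mul_le_mul h3 ((hb _ _).trans (by gcongr)) (norm_nonneg _) (norm_nonneg _)
      · refine (norm_sub_le _ _).trans ?_
        rw [e1, norm_smul, add_comm]
        refine add_le_add ?_ ((hb _ _).trans (by gcongr))
        exact mul_le_mul h3 ((hb _ _).trans (by gcongr)) (norm_nonneg _) (norm_nonneg _))

@[simp] theorem block_apply {Z : Type*} [NormedAddCommGroup Z] [NormedSpace ℂ Z]
    (β : Potential T →L[ℂ] Potential T →L[ℂ] Z) (θ : Coeff T) (w : Potential T × Potential T) :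
    block T β θ w = (θ.2.2 • β (one T) w.1 + β θ.1 w.2,
        β θ.2.1 w.1 - θ.2.2 • β (one T) w.2) := rfl

/-- The Volterra operator of the system on `L²([0,T])²`. -/
noncomputable abbrev volBlock : Coeff T →L[ℂ]
    (Potential T × Potential T) →L[ℂ] Potential T × Potential T := block T (vol T)

/-- The mass of a pair of functions on `[0, t]`. -/
noncomputable def mass (w : Potential T × Potential T) (t : ℝ) : ℝ :=
  (∫ s in (0 : ℝ)..t, ‖w.1 s‖ ^ 2) + ∫ s in (0 : ℝ)..t, ‖w.2 s‖ ^ 2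

theorem mass_le (hT : 0 ≤ T) (w : Potential T × Potential T) {t : ℝ}
    (ht : t ∈ Set.Icc (0 : ℝ) T) : mass T w t ≤ 2 * ‖w‖ ^ 2 := by
  have h4 : ‖w.1‖ ≤ ‖w‖ := norm_fst_le w
  have h5 : ‖w.2‖ ≤ ‖w‖ := norm_snd_le w
  have h1 := primitive_sq_le T hT w.1 ht
  have h2 := primitive_sq_le T hT w.2 ht
  have h6 : ‖w.1‖ ^ 2 ≤ ‖w‖ ^ 2 := by gcongr
  have h7 : ‖w.2‖ ^ 2 ≤ ‖w‖ ^ 2 := by gcongr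
  unfold mass
  linarith

theorem le_mass (hT : 0 ≤ T) (w : Potential T × Potential T) : ‖w‖ ^ 2 ≤ mass T w T := by
  have h1 : 0 ≤ ‖w.1‖ ^ 2 := by positivity
  have h2 : 0 ≤ ‖w.2‖ ^ 2 := by positivity
  unfold mass
  rw [← norm_potential_sq T hT, ← norm_potential_sq T hT]
  rcases max_choice ‖w.1‖ ‖w.2‖ with h | h
  · rw [Prod.norm_def, h]; linarith
  · rw [Prod.norm_def, h]; linarith

theorem norm_sq_primitive_mul_le (hT : 0 ≤ T) (p x : Potential T) {t : ℝ}
    (ht : t ∈ Set.Icc (0 : ℝ) T) : ‖∫ s in (0 : ℝ)..t, p s * x s‖ ^ 2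
      ≤ ‖p‖ ^ 2 * ∫ s in (0 : ℝ)..t, ‖x s‖ ^ 2 := by
  refine (norm_primitive_mul_sq_le (Lp.memLp p) (Lp.memLp x) ht).trans ?_
  gcongr
  · exact intervalIntegral.integral_nonneg ht.1 fun _ _ => by positivity
  · exact primitive_sq_le T hT p ht

theorem norm_add_sq_le_two_mul {Z : Type*} [NormedAddCommGroup Z] (a b : Z) :
    ‖a + b‖ ^ 2 ≤ 2 * (‖a‖ ^ 2 + ‖b‖ ^ 2) := by
  have h := norm_add_le a b
  have h1 : ‖a + b‖ ^ 2 ≤ (‖a‖ + ‖b‖) ^ 2 := by gcongr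
  nlinarith [sq_nonneg (‖a‖ - ‖b‖)]

/-- Pointwise Cauchy–Schwarz bound for the Volterra operator of the system. -/
theorem norm_sq_volBlock_le (hT : 0 ≤ T) (θ : Coeff T) (w : Potential T × Potential T) :
    ∀ᵐ t ∂(volume.restrict (Set.Icc (0 : ℝ) T)),
      ‖(volBlock T θ w).1 t‖ ^ 2 ≤ 2 * (‖one T‖ ^ 2 + 1) * ‖θ‖ ^ 2 * mass T w t ∧
      ‖(volBlock T θ w).2 t‖ ^ 2 ≤ 2 * (‖one T‖ ^ 2 + 1) * ‖θ‖ ^ 2 * mass T w t := by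
  have h1 : ‖θ.1‖ ^ 2 ≤ ‖θ‖ ^ 2 := by gcongr; exact norm_fst_le θ
  have h2 : ‖θ.2.1‖ ^ 2 ≤ ‖θ‖ ^ 2 := by
    gcongr; exact (norm_fst_le θ.2).trans (norm_snd_le θ)
  have h3 : ‖θ.2.2‖ ^ 2 ≤ ‖θ‖ ^ 2 := by
    gcongr; exact (norm_snd_le θ.2).trans (norm_snd_le θ)
  have key : ∀ (c : ℂ) (p x y : Potential T), ‖c‖ ^ 2 ≤ ‖θ‖ ^ 2 → ‖p‖ ^ 2 ≤ ‖θ‖ ^ 2 →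
      ∀ t ∈ Set.Icc (0 : ℝ) T,
      2 * (‖c * ∫ s in (0 : ℝ)..t, one T s * x s‖ ^ 2 + ‖∫ s in (0 : ℝ)..t, p s * y s‖ ^ 2)
        ≤ 2 * (‖one T‖ ^ 2 + 1) * ‖θ‖ ^ 2
          * ((∫ s in (0 : ℝ)..t, ‖x s‖ ^ 2) + ∫ s in (0 : ℝ)..t, ‖y s‖ ^ 2) := by
    intro c p x y hc hp t ht
    have hx : 0 ≤ ∫ s in (0 : ℝ)..t, ‖x s‖ ^ 2 :=
      intervalIntegral.integral_nonneg ht.1 fun _ _ => by positivity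
    have hy : 0 ≤ ∫ s in (0 : ℝ)..t, ‖y s‖ ^ 2 :=
      intervalIntegral.integral_nonneg ht.1 fun _ _ => by positivity
    have e1 : ‖c * ∫ s in (0 : ℝ)..t, one T s * x s‖ ^ 2
        ≤ ‖θ‖ ^ 2 * (‖one T‖ ^ 2 * ∫ s in (0 : ℝ)..t, ‖x s‖ ^ 2) := by
      rw [norm_mul, mul_pow]
      gcongr
      exact norm_sq_primitive_mul_le T hT _ _ ht
    have e2 : ‖∫ s in (0 : ℝ)..t, p s * y s‖ ^ 2 ≤ ‖θ‖ ^ 2 * ∫ s in (0 : ℝ)..t, ‖y s‖ ^ 2 := by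
      refine (norm_sq_primitive_mul_le T hT _ _ ht).trans ?_
      gcongr
    have e3 : 0 ≤ ‖θ‖ ^ 2 * (∫ s in (0 : ℝ)..t, ‖x s‖ ^ 2) := by positivity
    have e4 : 0 ≤ ‖θ‖ ^ 2 * (‖one T‖ ^ 2 * ∫ s in (0 : ℝ)..t, ‖y s‖ ^ 2) := by positivity
    nlinarith
  filter_upwards [ae_restrict_mem measurableSet_Icc, vol_ae T (one T) w.1, vol_ae T θ.1 w.2,
    vol_ae T θ.2.1 w.1, vol_ae T (one T) w.2,
    Lp.coeFn_add (θ.2.2 • vol T (one T) w.1) (vol T θ.1 w.2),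
    Lp.coeFn_smul θ.2.2 (vol T (one T) w.1),
    Lp.coeFn_sub (vol T θ.2.1 w.1) (θ.2.2 • vol T (one T) w.2),
    Lp.coeFn_smul θ.2.2 (vol T (one T) w.2)] with t ht a1 a2 a3 a4 a5 a6 a7 a8
  rw [block_apply]
  simp only
  constructor
  · rw [a5, Pi.add_apply, a6, Pi.smul_apply, a1, a2, smul_eq_mul]
    exact (norm_add_sq_le_two_mul _ _).trans (key _ _ _ _ h3 h1 t ht)
  · rw [a7, Pi.sub_apply, a8, Pi.smul_apply, a3, a4, smul_eq_mul, sub_eq_add_neg, add_comm]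
    refine (norm_add_sq_le_two_mul _ _).trans ?_
    rw [norm_neg, mass, add_comm (∫ s in (0 : ℝ)..t, ‖w.1 s‖ ^ 2)]
    exact key _ _ _ _ h3 h2 t ht

theorem mass_volBlock_pow_le (hT : 0 ≤ T) (θ : Coeff T) (w : Potential T × Potential T) (n : ℕ) :
    ∀ t ∈ Set.Icc (0 : ℝ) T, mass T ((volBlock T θ ^ n) w) t
      ≤ (4 * (‖one T‖ ^ 2 + 1) * ‖θ‖ ^ 2 * t) ^ n / n.factorial * (2 * ‖w‖ ^ 2) := by
  induction n with
  | zero => intro t ht; simpa using mass_le T hT w ht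
  | succ n ih =>
    intro t ht
    have h0 : (0 : ℝ) ∈ Set.Icc 0 T := ⟨le_rfl, hT⟩
    set C := 4 * (‖one T‖ ^ 2 + 1) * ‖θ‖ ^ 2 with hC
    have hC0 : 0 ≤ C := by positivity
    rw [pow_succ', mul_apply_eq_comp]
    set w' := (volBlock T θ ^ n) w with hw'
    have hb : ∀ᵐ s ∂(volume.restrict (Set.Icc (0 : ℝ) T)),
        ‖(volBlock T θ w').1 s‖ ^ 2 + ‖(volBlock T θ w').2 s‖ ^ 2
          ≤ C * ((C * s) ^ n / n.factorial * (2 * ‖w‖ ^ 2)) := by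
      filter_upwards [norm_sq_volBlock_le T hT θ w', ae_restrict_mem measurableSet_Icc]
        with s hs hs'
      have := ih s hs'
      calc _ ≤ C * mass T w' s := by rw [hC]; linarith [hs.1, hs.2]
        _ ≤ _ := by gcongr
    have i1 := intervalIntegrable_of_integrable
      (integrable_sq_norm (Lp.memLp (volBlock T θ w').1)) h0 ht
    have i2 := intervalIntegrable_of_integrable
      (integrable_sq_norm (Lp.memLp (volBlock T θ w').2)) h0 ht
    rw [mass, ← intervalIntegral.integral_add i1 i2]
    have hcont : Continuous fun s : ℝ => C * ((C * s) ^ n / n.factorial * (2 * ‖w‖ ^ 2)) := by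
      fun_prop
    refine (intervalIntegral.integral_mono_ae_restrict ht.1 (i1.add i2)
      (hcont.intervalIntegrable _ _) ?_).trans_eq ?_
    · refine ae_mono (Measure.restrict_mono ?_ le_rfl) hb
      exact Set.Icc_subset_Icc le_rfl ht.2
    · have : (fun s : ℝ => C * ((C * s) ^ n / n.factorial * (2 * ‖w‖ ^ 2)))
          = fun s : ℝ => (C ^ (n + 1) / n.factorial * (2 * ‖w‖ ^ 2)) * s ^ n := by
        ext s; rw [mul_pow]; ring
      rw [this, intervalIntegral.integral_const_mul, integral_pow, Nat.factorial_succ,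
        zero_pow (Nat.succ_ne_zero n), sub_zero]
      push_cast
      have := Nat.cast_add_one_ne_zero (R := ℝ) n
      have : ((n.factorial : ℝ)) ≠ 0 := by positivity
      clear_value C
      rw [mul_pow]
      field_simp

/-- On bounded sets of coefficients a power of the Volterra operator is a contraction. -/
theorem exists_norm_volBlock_pow_le (hT : 0 ≤ T) (R : ℝ) :
    ∃ n : ℕ, ∀ θ : Coeff T, ‖θ‖ ≤ R → ‖volBlock T θ ^ n‖ ≤ 1 / 2 := by
  set M := 4 * (‖one T‖ ^ 2 + 1) * R ^ 2 * T with hM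
  have hlim := FloorSemiring.tendsto_pow_div_factorial_atTop M
  obtain ⟨n, hn⟩ := ((tendsto_order.mp hlim).2 (1 / 8) (by norm_num)).exists
  refine ⟨n, fun θ hθ => ?_⟩
  refine ContinuousLinearMap.opNorm_le_bound _ (by norm_num) fun w => ?_
  have h1 := (le_mass T hT _).trans (mass_volBlock_pow_le T hT θ w n T ⟨hT, le_rfl⟩)
  have h2 : (4 * (‖one T‖ ^ 2 + 1) * ‖θ‖ ^ 2 * T) ^ n / n.factorial ≤ 1 / 8 := by
    refine le_trans ?_ hn.le
    rw [hM]
    gcongr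
  refine le_of_sq_le_sq ?_ (by positivity)
  calc _ ≤ _ := h1
    _ ≤ 1 / 8 * (2 * ‖w‖ ^ 2) := by gcongr
    _ = _ := by ring

theorem isUnit_one_sub_of_norm_pow_lt {A : Type*} [NormedRing A] [CompleteSpace A] {a : A}
    {n : ℕ} (h : ‖a ^ n‖ < 1) : IsUnit (1 - a) := by
  have h1 : IsUnit (1 - a ^ n) := isUnit_one_sub_of_norm_lt_one h
  rw [← mul_neg_geom_sum] at h1
  have hc : Commute (1 - a) (∑ i ∈ Finset.range n, a ^ i) := by
    rw [Commute, SemiconjBy, mul_neg_geom_sum, geom_sum_mul_neg]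
  exact (hc.isUnit_mul_iff.mp h1).1

theorem isUnit_one_sub_volBlock (hT : 0 ≤ T) (θ : Coeff T) : IsUnit (1 - volBlock T θ) := by
  obtain ⟨n, hn⟩ := exists_norm_volBlock_pow_le T hT ‖θ‖
  exact isUnit_one_sub_of_norm_pow_lt (lt_of_le_of_lt (hn θ le_rfl) (by norm_num))

theorem norm_volBlock_le (θ : Coeff T) : ‖volBlock T θ‖ ≤ ‖volBlock T‖ * ‖θ‖ :=
  (volBlock T).le_opNorm θ

/-- A priori bound for the inhomogeneous Volterra equation. -/
theorem exists_norm_le_of_eq_volBlock_add (hT : 0 ≤ T) (R : ℝ) :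
    ∃ C : ℝ, 0 ≤ C ∧ ∀ θ : Coeff T, ‖θ‖ ≤ R → ∀ w g : Potential T × Potential T,
      w = volBlock T θ w + g → ‖w‖ ≤ C * ‖g‖ := by
  obtain ⟨n, hn⟩ := exists_norm_volBlock_pow_le T hT R
  refine ⟨2 * ∑ i ∈ Finset.range n, (‖volBlock T‖ * |R| ) ^ i, by positivity,
    fun θ hθ w g hw => ?_⟩
  have h1 : ∀ m : ℕ, w = (volBlock T θ ^ m) w
      + ∑ i ∈ Finset.range m, (volBlock T θ ^ i) g := by
    intro m
    induction m with
    | zero => simp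
    | succ m ih =>
      conv_lhs => rw [ih]
      conv_lhs => rw [hw]
      rw [map_add, ← mul_apply_eq_comp, ← pow_succ, Finset.sum_range_succ]
      abel
  have h2 : ‖(volBlock T θ ^ n) w‖ ≤ 1 / 2 * ‖w‖ :=
    (ContinuousLinearMap.le_opNorm _ _).trans (by gcongr; exact hn θ hθ)
  have h3 : ‖∑ i ∈ Finset.range n, (volBlock T θ ^ i) g‖
      ≤ (∑ i ∈ Finset.range n, (‖volBlock T‖ * |R|) ^ i) * ‖g‖ := by
    rw [Finset.sum_mul]
    refine norm_sum_le_of_le _ fun i _ => ?_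
    have hk : ‖volBlock T θ‖ ≤ ‖volBlock T‖ * |R| := by
      refine (norm_volBlock_le T θ).trans ?_
      gcongr
      exact hθ.trans (le_abs_self R)
    have hpow : ∀ i : ℕ, ‖(volBlock T θ ^ i) g‖ ≤ (‖volBlock T‖ * |R|) ^ i * ‖g‖ := by
      intro i
      induction i with
      | zero => simp
      | succ i ih =>
        rw [pow_succ', mul_apply_eq_comp, pow_succ', mul_assoc]
        exact (ContinuousLinearMap.le_opNorm _ _).trans (by gcongr)
    exact hpow i
  have h4 : ‖w‖ ≤ ‖(volBlock T θ ^ n) w‖ + ‖∑ i ∈ Finset.range n, (volBlock T θ ^ i) g‖ := by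
    conv_lhs => rw [h1 n]
    exact norm_add_le _ _
  linarith

end System


/-! ### The solution of the system and its first variation -/

section Solution

variable (T : ℝ)

/-- The pair of constant functions `(1, 0)`, the initial value of the system. -/
noncomputable def initial : Potential T × Potential T := (one T, 0)

/-- The endpoint functional of the system, with integrals over `[0, T]`. -/
noncomputable abbrev endBlock (hT : 0 ≤ T) : Coeff T →L[ℂ]
    (Potential T × Potential T) →L[ℂ] ℂ × ℂ := block T (pair T hT)

/-- The solution `(u, v)` of `u' = ν u + p v`, `v' = r u - ν v` with initial value `(1, 0)`, minus
its initial value. -/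
noncomputable def deviation (θ : Coeff T) : Potential T × Potential T :=
  Ring.inverse (1 - volBlock T θ) (volBlock T θ (initial T))

theorem deviation_eq (hT : 0 ≤ T) (θ : Coeff T) :
    deviation T θ = volBlock T θ (deviation T θ) + volBlock T θ (initial T) := by
  have h := Ring.mul_inverse_cancel _ (isUnit_one_sub_volBlock T hT θ)
  have h1 := congrArg (fun A => A (volBlock T θ (initial T))) h
  simp only [mul_apply_eq_comp, one_apply_eq_self] at h1
  change (1 - volBlock T θ) (deviation T θ) = _ at h1
  rw [sub_apply, one_apply_eq_self] at h1
  rw [← h1]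
  abel

theorem eq_deviation (hT : 0 ≤ T) (θ : Coeff T) {w : Potential T × Potential T}
    (hw : w = volBlock T θ w + volBlock T θ (initial T)) : w = deviation T θ := by
  obtain ⟨C, -, hC⟩ := exists_norm_le_of_eq_volBlock_add T hT ‖θ‖
  have h := hC θ le_rfl (w - deviation T θ) 0 (by
    conv_lhs => rw [hw, deviation_eq T hT θ]
    rw [map_sub]
    abel)
  rw [norm_zero, mul_zero] at h
  exact sub_eq_zero.mp (norm_le_zero_iff.mp h)

/-- The value at `T` of the solution, minus its initial value. -/
noncomputable def endDeviation (hT : 0 ≤ T) (θ : Coeff T) : ℂ × ℂ :=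
  endBlock T hT θ (initial T + deviation T θ)

/-- A seminorm that measures how small the primitives of the coefficients are. For coefficients
twisted by `exp (± i ω_k t)` it is square-summable in `k`, and it controls all terms of higher
order. -/
noncomputable def size (hT : 0 ≤ T) (θ : Coeff T) : ℝ :=
  ‖θ.2.2‖ + (‖vol T θ.1 (one T)‖ + ‖pair T hT θ.1 (one T)‖)
    + (‖vol T θ.2.1 (one T)‖ + ‖pair T hT θ.2.1 (one T)‖)

theorem size_nonneg (hT : 0 ≤ T) (θ : Coeff T) : 0 ≤ size T hT θ := by
  unfold size; positivity

variable {T} in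
theorem Coeff.norm_le (θ : Coeff T) : ‖θ.1‖ ≤ ‖θ‖ ∧ ‖θ.2.1‖ ≤ ‖θ‖ ∧ ‖θ.2.2‖ ≤ ‖θ‖ :=
  ⟨norm_fst_le θ, (norm_fst_le θ.2).trans (norm_snd_le θ),
    (norm_snd_le θ.2).trans (norm_snd_le θ)⟩

theorem exists_norm_block_initial_le (hT : 0 ≤ T) : ∃ C : ℝ, 0 ≤ C ∧ ∀ θ : Coeff T,
    ‖volBlock T θ (initial T)‖ ≤ C * size T hT θ ∧
    ‖endBlock T hT θ (initial T)‖ ≤ C * size T hT θ := by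
  refine ⟨‖vol T (one T) (one T)‖ + ‖pair T hT (one T) (one T)‖ + 1, by positivity,
    fun θ => ?_⟩
  have e : ∀ a b c d f g h : ℝ, 0 ≤ a → 0 ≤ b → 0 ≤ c → 0 ≤ d → 0 ≤ f → 0 ≤ g → 0 ≤ h →
      c * a ≤ (a + b + 1) * (c + (d + f) + (g + h)) ∧ c * b ≤ (a + b + 1) * (c + (d + f) + (g + h))
      ∧ g ≤ (a + b + 1) * (c + (d + f) + (g + h)) ∧ h ≤ (a + b + 1) * (c + (d + f) + (g + h)) := by
    intro a b c d f g h ha hb hc hd hf hg hh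
    have h1 : c ≤ c + (d + f) + (g + h) := by linarith
    have h2 : g ≤ c + (d + f) + (g + h) := by linarith
    have h3 : h ≤ c + (d + f) + (g + h) := by linarith
    set s := c + (d + f) + (g + h)
    have hs : 0 ≤ s := hc.trans h1
    have := mul_nonneg ha hs
    have := mul_nonneg hb hs
    have := mul_le_mul_of_nonneg_right h1 ha
    have := mul_le_mul_of_nonneg_right h1 hb
    refine ⟨?_, ?_, ?_, ?_⟩ <;> nlinarith
  obtain ⟨i1, i2, i3, i4⟩ := e ‖vol T (one T) (one T)‖ ‖pair T hT (one T) (one T)‖ ‖θ.2.2‖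
    ‖vol T θ.1 (one T)‖ ‖pair T hT θ.1 (one T)‖ ‖vol T θ.2.1 (one T)‖
    ‖pair T hT θ.2.1 (one T)‖ (norm_nonneg _) (norm_nonneg _) (norm_nonneg _) (norm_nonneg _)
    (norm_nonneg _) (norm_nonneg _) (norm_nonneg _)
  constructor
  · rw [block_apply]
    refine norm_prod_le_iff.mpr ⟨?_, ?_⟩ <;> simp only [initial, map_zero, add_zero, smul_zero,
      sub_zero]
    · rw [norm_smul]; exact i1
    · exact i3
  · rw [block_apply]
    refine norm_prod_le_iff.mpr ⟨?_, ?_⟩ <;> simp only [initial, map_zero, add_zero, smul_zero,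
      sub_zero]
    · rw [norm_smul]; exact i2
    · exact i4

/-- The iterated integrals of second order are controlled by the size of the outer coefficients,
after integration by parts. -/
theorem exists_norm_block_block_initial_le (hT : 0 ≤ T) : ∃ C : ℝ, 0 ≤ C ∧ ∀ θ δ : Coeff T,
    ‖volBlock T θ (volBlock T δ (initial T))‖ ≤ C * size T hT θ * ‖δ‖ ∧
    ‖endBlock T hT θ (volBlock T δ (initial T))‖ ≤ C * size T hT θ * ‖δ‖ := by
  set c := ‖one T‖ with hc
  have hc0 : 0 ≤ c := norm_nonneg _
  set b := ‖vol T‖ with hbdef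
  have hb0 : 0 ≤ b := norm_nonneg (vol T)
  set d := ‖pair T hT‖ with hddef
  have hd0 : 0 ≤ d := norm_nonneg (pair T hT)
  have hs0 : 0 ≤ √T := Real.sqrt_nonneg T
  have hb : ∀ p x : Potential T, ‖vol T p x‖ ≤ b * ‖p‖ * ‖x‖ := (vol T).le_opNorm₂
  have hd : ∀ p x : Potential T, ‖pair T hT p x‖ ≤ d * ‖p‖ * ‖x‖ := (pair T hT).le_opNorm₂
  refine ⟨(b * c + d * c) * (b * c * c + b * c) + (c + √T + 1) * (1 + c), by positivity,
    fun θ δ => ?_⟩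
  obtain ⟨d1, d2, d3⟩ := δ.norm_le
  set s := size T hT θ with hs
  have s1 : ‖θ.2.2‖ ≤ s := by
    rw [hs, size]; linarith [norm_nonneg (vol T θ.1 (one T)),
      norm_nonneg (pair T hT θ.1 (one T)), norm_nonneg (vol T θ.2.1 (one T)),
      norm_nonneg (pair T hT θ.2.1 (one T))]
  have s2 : ‖pair T hT θ.1 (one T)‖ + ‖vol T θ.1 (one T)‖ ≤ s := by
    rw [hs, size]; linarith [norm_nonneg θ.2.2, norm_nonneg (vol T θ.2.1 (one T)),
      norm_nonneg (pair T hT θ.2.1 (one T))]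
  have s3 : ‖pair T hT θ.2.1 (one T)‖ + ‖vol T θ.2.1 (one T)‖ ≤ s := by
    rw [hs, size]; linarith [norm_nonneg θ.2.2, norm_nonneg (vol T θ.1 (one T)),
      norm_nonneg (pair T hT θ.1 (one T))]
  have s0 : 0 ≤ s := (norm_nonneg _).trans s1
  have s2' : ‖vol T θ.1 (one T)‖ ≤ s :=
    le_trans (by linarith [norm_nonneg (pair T hT θ.1 (one T))]) s2
  have s3' : ‖vol T θ.2.1 (one T)‖ ≤ s :=
    le_trans (by linarith [norm_nonneg (pair T hT θ.2.1 (one T))]) s3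
  have v1 : ‖vol T (one T) (one T)‖ ≤ b * c * c := hb _ _
  have v2 : ‖vol T δ.2.1 (one T)‖ ≤ b * c * ‖δ‖ := (hb _ _).trans (by
    calc b * ‖δ.2.1‖ * c ≤ b * ‖δ‖ * c := by gcongr
      _ = _ := by ring)
  -- the terms with a factor `ν`
  have n1 : ∀ x : Potential T, ‖x‖ ≤ (b * c * c + b * c) * ‖δ‖ →
      ‖θ.2.2 • vol T (one T) x‖ ≤ (b * c + d * c) * (b * c * c + b * c) * s * ‖δ‖ ∧
      ‖θ.2.2 • pair T hT (one T) x‖ ≤ (b * c + d * c) * (b * c * c + b * c) * s * ‖δ‖ := by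
    intro x hx
    have e : ∀ a, 0 ≤ a → a ≤ b * c + d * c →
        s * (a * ‖x‖) ≤ (b * c + d * c) * (b * c * c + b * c) * s * ‖δ‖ := by
      intro a ha ha'
      calc s * (a * ‖x‖) ≤ s * ((b * c + d * c) * ((b * c * c + b * c) * ‖δ‖)) := by gcongr
        _ = _ := by ring
    constructor
    · rw [norm_smul]
      refine (mul_le_mul s1 (hb _ _) (norm_nonneg _) s0).trans (e _ (by positivity) ?_)
      linarith [mul_nonneg hd0 hc0]
    · rw [norm_smul]
      refine (mul_le_mul s1 (hd _ _) (norm_nonneg _) s0).trans (e _ (by positivity) ?_)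
      linarith [mul_nonneg hb0 hc0]
  have x1 : ‖δ.2.2 • vol T (one T) (one T)‖ ≤ (b * c * c + b * c) * ‖δ‖ := by
    rw [norm_smul]
    have : ‖δ.2.2‖ * ‖vol T (one T) (one T)‖ ≤ ‖δ‖ * (b * c * c) := by gcongr
    have := mul_nonneg (mul_nonneg hb0 hc0) (norm_nonneg δ)
    nlinarith
  have x2 : ‖vol T δ.2.1 (one T)‖ ≤ (b * c * c + b * c) * ‖δ‖ := by
    have := mul_nonneg (mul_nonneg (mul_nonneg hb0 hc0) hc0) (norm_nonneg δ)
    nlinarith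
  -- the terms without
  have p1 : ∀ (p r : Potential T) (z : ℂ), ‖pair T hT p (one T)‖ + ‖vol T p (one T)‖ ≤ s →
      ‖r‖ ≤ (1 + c) → ‖z‖ ≤ ‖δ‖ →
      ‖z • vol T p (vol T r (one T))‖ ≤ (c + √T + 1) * (1 + c) * s * ‖δ‖ ∧
      ‖z • pair T hT p (vol T r (one T))‖ ≤ (c + √T + 1) * (1 + c) * s * ‖δ‖ := by
    intro p r z hp hr hz
    have hp' : ‖vol T p (one T)‖ ≤ s :=
      le_trans (by linarith [norm_nonneg (pair T hT p (one T))]) hp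
    constructor
    · rw [norm_smul]
      calc _ ≤ ‖δ‖ * ((c + √T + 1) * (1 + c) * s) := by
            gcongr
            refine (norm_vol_vol_one_le T p r).trans ?_
            have : c + √T ≤ c + √T + 1 := by linarith
            exact mul_le_mul (mul_le_mul this hr (norm_nonneg _) (by positivity)) hp'
              (norm_nonneg _) (by positivity)
        _ = _ := by ring
    · rw [norm_smul]
      calc _ ≤ ‖δ‖ * ((c + √T + 1) * (1 + c) * s) := by
            gcongr
            refine (norm_pair_vol_one_le T hT p r).trans ?_
            have : c + 1 ≤ c + √T + 1 := by linarith
            exact mul_le_mul (mul_le_mul this hr (norm_nonneg _) (by positivity)) hp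
              (by positivity) (by positivity)
        _ = _ := by ring
  have p2 : ∀ (p : Potential T), ‖pair T hT p (one T)‖ + ‖vol T p (one T)‖ ≤ s →
      ‖vol T p (vol T δ.2.1 (one T))‖ ≤ (c + √T + 1) * (1 + c) * s * ‖δ‖ ∧
      ‖pair T hT p (vol T δ.2.1 (one T))‖ ≤ (c + √T + 1) * (1 + c) * s * ‖δ‖ := by
    intro p hp
    have hp' : ‖vol T p (one T)‖ ≤ s :=
      le_trans (by linarith [norm_nonneg (pair T hT p (one T))]) hp
    have hle : c + √T ≤ (c + √T + 1) * (1 + c) := by nlinarith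
    have hle' : c + 1 ≤ (c + √T + 1) * (1 + c) := by nlinarith
    constructor
    · refine (norm_vol_vol_one_le T p _).trans ?_
      calc (c + √T) * ‖δ.2.1‖ * ‖vol T p (one T)‖ ≤ ((c + √T + 1) * (1 + c)) * ‖δ‖ * s := by gcongr
        _ = _ := by ring
    · refine (norm_pair_vol_one_le T hT p _).trans ?_
      calc (c + 1) * ‖δ.2.1‖ * (‖pair T hT p (one T)‖ + ‖vol T p (one T)‖)
          ≤ ((c + √T + 1) * (1 + c)) * ‖δ‖ * s := by gcongr
        _ = _ := by ring
  have fin : ∀ {Z : Type} [NormedAddCommGroup Z] (x y : Z),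
      ‖x‖ ≤ (b * c + d * c) * (b * c * c + b * c) * s * ‖δ‖ →
      ‖y‖ ≤ (c + √T + 1) * (1 + c) * s * ‖δ‖ →
      ‖x‖ + ‖y‖ ≤ ((b * c + d * c) * (b * c * c + b * c) + (c + √T + 1) * (1 + c)) * s * ‖δ‖ := by
    intro Z _ x y hx hy
    linarith
  have hδ : volBlock T δ (initial T) = (δ.2.2 • vol T (one T) (one T), vol T δ.2.1 (one T)) := by
    simp [block_apply, initial]
  rw [hδ, block_apply, block_apply]
  have hone : ‖one T‖ ≤ 1 + c := by linarith
  constructor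
  · refine norm_prod_le_iff.mpr ⟨?_, ?_⟩
    · exact (norm_add_le _ _).trans (fin _ _ (n1 _ x1).1 (p2 _ s2).1)
    · refine (norm_sub_le _ _).trans ?_
      rw [add_comm]
      refine fin _ _ (n1 _ x2).1 ?_
      simp only [map_smul]
      exact (p1 _ _ _ s3 hone d3).1
  · refine norm_prod_le_iff.mpr ⟨?_, ?_⟩
    · exact (norm_add_le _ _).trans (fin _ _ (n1 _ x1).2 (p2 _ s2).2)
    · refine (norm_sub_le _ _).trans ?_
      rw [add_comm]
      refine fin _ _ (n1 _ x2).2 ?_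
      simp only [map_smul]
      exact (p1 _ _ _ s3 hone d3).2

theorem exists_norm_deviation_le (hT : 0 ≤ T) (R : ℝ) : ∃ C : ℝ, 0 ≤ C ∧ ∀ θ : Coeff T,
    ‖θ‖ ≤ R → ‖deviation T θ‖ ≤ C * size T hT θ := by
  obtain ⟨C₁, h1, hC₁⟩ := exists_norm_le_of_eq_volBlock_add T hT R
  obtain ⟨C₂, h2, hC₂⟩ := exists_norm_block_initial_le T hT
  refine ⟨C₁ * C₂, by positivity, fun θ hθ => ?_⟩
  refine (hC₁ θ hθ _ _ (deviation_eq T hT θ)).trans ?_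
  rw [mul_assoc]
  gcongr
  exact (hC₂ θ).1

/-- The first variation of the endpoint differs from the one at the zero potential by a term that
is controlled by the size of the coefficients. -/
theorem exists_norm_variation_le (hT : 0 ≤ T) (R : ℝ) : ∃ C : ℝ, 0 ≤ C ∧ ∀ θ δ : Coeff T,
    ‖θ‖ ≤ R → ∀ dw : Potential T × Potential T,
      dw = volBlock T θ dw + volBlock T δ (initial T + deviation T θ) →
      ‖endBlock T hT δ (initial T + deviation T θ) + endBlock T hT θ dw
        - endBlock T hT δ (initial T)‖ ≤ C * size T hT θ * ‖δ‖ := by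
  obtain ⟨C₁, h1, hC₁⟩ := exists_norm_le_of_eq_volBlock_add T hT R
  obtain ⟨C₂, h2, hC₂⟩ := exists_norm_deviation_le T hT R
  obtain ⟨C₃, h3, hC₃⟩ := exists_norm_block_block_initial_le T hT
  set b := ‖volBlock T‖ with hb
  have hb0 : 0 ≤ b := norm_nonneg (volBlock T)
  set d := ‖endBlock T hT‖ with hd
  have hd0 : 0 ≤ d := norm_nonneg (endBlock T hT)
  refine ⟨d * C₂ + d * |R| * (C₁ * (C₃ + b * C₂)) + C₃, by positivity,
    fun θ δ hθ dw hdw => ?_⟩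
  set s := size T hT θ with hs
  have s0 : 0 ≤ s := size_nonneg T hT θ
  set w := deviation T θ with hw
  have hwn : ‖w‖ ≤ C₂ * s := hC₂ θ hθ
  obtain ⟨ρ, hρ⟩ : ∃ ρ, dw = ρ + volBlock T δ (initial T) :=
    ⟨dw - volBlock T δ (initial T), by simp⟩
  have hρe : ρ = volBlock T θ ρ
      + (volBlock T θ (volBlock T δ (initial T)) + volBlock T δ w) := by
    have h : ρ = dw - volBlock T δ (initial T) := by rw [hρ]; simp
    conv_lhs => rw [h, hdw, hρ]
    rw [map_add, map_add]
    abel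
  have hρn : ‖ρ‖ ≤ C₁ * (C₃ + b * C₂) * s * ‖δ‖ := by
    refine (hC₁ θ hθ _ _ hρe).trans ?_
    have e1 := (hC₃ θ δ).1
    have e2 : ‖volBlock T δ w‖ ≤ b * ‖δ‖ * (C₂ * s) :=
      ((volBlock T).le_opNorm₂ _ _).trans (by gcongr)
    calc _ ≤ C₁ * (C₃ * s * ‖δ‖ + b * ‖δ‖ * (C₂ * s)) := by
          gcongr
          exact (norm_add_le _ _).trans (add_le_add e1 e2)
      _ = _ := by ring
  have e : endBlock T hT δ (initial T + w) + endBlock T hT θ dw - endBlock T hT δ (initial T)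
      = endBlock T hT δ w + endBlock T hT θ ρ
        + endBlock T hT θ (volBlock T δ (initial T)) := by
    rw [hρ, map_add, map_add]
    abel
  rw [e]
  have t1 : ‖endBlock T hT δ w‖ ≤ d * ‖δ‖ * (C₂ * s) :=
    ((endBlock T hT).le_opNorm₂ _ _).trans (by gcongr)
  have t2 : ‖endBlock T hT θ ρ‖ ≤ d * |R| * (C₁ * (C₃ + b * C₂) * s * ‖δ‖) :=
    ((endBlock T hT).le_opNorm₂ _ _).trans (by gcongr; exact hθ.trans (le_abs_self R))
  have t3 := (hC₃ θ δ).2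
  calc _ ≤ _ := (norm_add_le _ _).trans (add_le_add_left (norm_add_le _ _) _)
    _ ≤ d * ‖δ‖ * (C₂ * s) + d * |R| * (C₁ * (C₃ + b * C₂) * s * ‖δ‖) + C₃ * s * ‖δ‖ := by
        gcongr
    _ = _ := by ring

end Solution


/-! ### Extended frames and the monodromy -/

section Frame

variable (T : ℝ)

/-- The functions `u`, `v` solve `u' = ν u + p v`, `v' = r u - ν v` on `[0, T]` with initial value
`(1, 0)`, in integrated form. -/
structure IsRow (θ : Coeff T) (u v : ℝ → ℂ) : Prop where
  continuousOn_fst : ContinuousOn u (Set.Icc 0 T)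
  continuousOn_snd : ContinuousOn v (Set.Icc 0 T)
  fst_eq : ∀ t ∈ Set.Icc (0 : ℝ) T, u t = 1 + ∫ s in (0 : ℝ)..t, (θ.2.2 * u s + θ.1 s * v s)
  snd_eq : ∀ t ∈ Set.Icc (0 : ℝ) T, v t = ∫ s in (0 : ℝ)..t, (θ.2.1 s * u s - θ.2.2 * v s)

variable {T}

theorem primitive_block_fst (θ : Coeff T) {u v : ℝ → ℂ} {x y : Potential T}
    (hx : ∀ᵐ s ∂(volume.restrict (Set.Icc (0 : ℝ) T)), x s = u s)
    (hy : ∀ᵐ s ∂(volume.restrict (Set.Icc (0 : ℝ) T)), y s = v s)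
    {t : ℝ} (ht : t ∈ Set.Icc (0 : ℝ) T) :
    ∫ s in (0 : ℝ)..t, (θ.2.2 * u s + θ.1 s * v s)
      = θ.2.2 * (∫ s in (0 : ℝ)..t, one T s * x s) + ∫ s in (0 : ℝ)..t, θ.1 s * y s := by
  have h0 : (0 : ℝ) ∈ Set.Icc 0 T := ⟨le_rfl, ht.1.trans ht.2⟩
  rw [← intervalIntegral.integral_const_mul, ← intervalIntegral.integral_add
    ((intervalIntegrable_of_integrable (integrable_mul_of_memLp (Lp.memLp _) (Lp.memLp _))
      h0 ht).const_mul _)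
    (intervalIntegrable_of_integrable (integrable_mul_of_memLp (Lp.memLp _) (Lp.memLp _)) h0 ht)]
  refine primitive_congr ?_ ht
  filter_upwards [hx, hy, one_ae T] with s h1 h2 h3
  rw [h1, h2, h3, one_mul]

theorem primitive_block_snd (θ : Coeff T) {u v : ℝ → ℂ} {x y : Potential T}
    (hx : ∀ᵐ s ∂(volume.restrict (Set.Icc (0 : ℝ) T)), x s = u s)
    (hy : ∀ᵐ s ∂(volume.restrict (Set.Icc (0 : ℝ) T)), y s = v s)
    {t : ℝ} (ht : t ∈ Set.Icc (0 : ℝ) T) :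
    ∫ s in (0 : ℝ)..t, (θ.2.1 s * u s - θ.2.2 * v s)
      = (∫ s in (0 : ℝ)..t, θ.2.1 s * x s) - θ.2.2 * ∫ s in (0 : ℝ)..t, one T s * y s := by
  have h0 : (0 : ℝ) ∈ Set.Icc 0 T := ⟨le_rfl, ht.1.trans ht.2⟩
  rw [← intervalIntegral.integral_const_mul, ← intervalIntegral.integral_sub
    (intervalIntegrable_of_integrable (integrable_mul_of_memLp (Lp.memLp _) (Lp.memLp _)) h0 ht)
    ((intervalIntegrable_of_integrable (integrable_mul_of_memLp (Lp.memLp _) (Lp.memLp _))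
      h0 ht).const_mul _)]
  refine primitive_congr ?_ ht
  filter_upwards [hx, hy, one_ae T] with s h1 h2 h3
  rw [h1, h2, h3, one_mul]

theorem volBlock_fst_ae (θ : Coeff T) (w : Potential T × Potential T) :
    ∀ᵐ t ∂(volume.restrict (Set.Icc (0 : ℝ) T)), (volBlock T θ w).1 t
      = ∫ s in (0 : ℝ)..t, (θ.2.2 * w.1 s + θ.1 s * w.2 s) := by
  filter_upwards [vol_ae T (one T) w.1, vol_ae T θ.1 w.2, ae_restrict_mem measurableSet_Icc,
    Lp.coeFn_add (θ.2.2 • vol T (one T) w.1) (vol T θ.1 w.2),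
    Lp.coeFn_smul θ.2.2 (vol T (one T) w.1)] with t h1 h2 ht h3 h4
  rw [block_apply]
  rw [h3, Pi.add_apply, h4, Pi.smul_apply, h1, h2, smul_eq_mul,
    primitive_block_fst θ (x := w.1) (y := w.2) (by simp) (by simp) ht]

theorem volBlock_snd_ae (θ : Coeff T) (w : Potential T × Potential T) :
    ∀ᵐ t ∂(volume.restrict (Set.Icc (0 : ℝ) T)), (volBlock T θ w).2 t
      = ∫ s in (0 : ℝ)..t, (θ.2.1 s * w.1 s - θ.2.2 * w.2 s) := by
  filter_upwards [vol_ae T (one T) w.2, vol_ae T θ.2.1 w.1, ae_restrict_mem measurableSet_Icc,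
    Lp.coeFn_sub (vol T θ.2.1 w.1) (θ.2.2 • vol T (one T) w.2),
    Lp.coeFn_smul θ.2.2 (vol T (one T) w.2)] with t h1 h2 ht h3 h4
  rw [block_apply]
  rw [h3, Pi.sub_apply, h4, Pi.smul_apply, h1, h2, smul_eq_mul,
    primitive_block_snd θ (x := w.1) (y := w.2) (by simp) (by simp) ht]

theorem IsRow.end_eq (hT : 0 ≤ T) {θ : Coeff T} {u v : ℝ → ℂ} (h : IsRow T θ u v) :
    u T = 1 + (endDeviation T hT θ).1 ∧ v T = (endDeviation T hT θ).2 := by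
  have hu := memLp_of_continuousOn h.continuousOn_fst
  have hv := memLp_of_continuousOn h.continuousOn_snd
  set x : Potential T := hu.toLp u
  set y : Potential T := hv.toLp v
  have hx : ∀ᵐ s ∂(volume.restrict (Set.Icc (0 : ℝ) T)), x s = u s := hu.coeFn_toLp
  have hy : ∀ᵐ s ∂(volume.restrict (Set.Icc (0 : ℝ) T)), y s = v s := hv.coeFn_toLp
  have key : (x, y) - initial T = volBlock T θ (x, y) := by
    refine Prod.ext ?_ ?_
    · refine Lp.ext ?_
      filter_upwards [hx, one_ae T, volBlock_fst_ae θ (x, y), ae_restrict_mem measurableSet_Icc,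
        Lp.coeFn_sub x (one T)] with t h1 h2 h3 ht h4
      change (x - one T : Potential T) t = _
      rw [h4, Pi.sub_apply, h1, h2, h3, h.fst_eq t ht,
        primitive_block_fst θ hx hy ht,
        primitive_block_fst θ (x := x) (y := y) (by simp) (by simp) ht]
      ring
    · refine Lp.ext ?_
      filter_upwards [hy, volBlock_snd_ae θ (x, y), ae_restrict_mem measurableSet_Icc,
        Lp.coeFn_sub y 0, Lp.coeFn_zero ℂ 2 (volume.restrict (Set.Icc (0 : ℝ) T))]
        with t h1 h3 ht h4 h5
      change (y - 0 : Potential T) t = _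
      rw [h4, Pi.sub_apply, h1, h3, h5, h.snd_eq t ht,
        primitive_block_snd θ hx hy ht,
        primitive_block_snd θ (x := x) (y := y) (by simp) (by simp) ht]
      simp
  have hw := eq_deviation T hT θ (w := (x, y) - initial T) (by
    rw [← map_add, sub_add_cancel, key])
  have hTT : T ∈ Set.Icc (0 : ℝ) T := ⟨hT, le_rfl⟩
  rw [endDeviation, ← hw, add_sub_cancel, block_apply, h.fst_eq T hTT, h.snd_eq T hTT,
    primitive_block_fst θ hx hy hTT, primitive_block_snd θ hx hy hTT]
  exact ⟨rfl, rfl⟩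

theorem exists_isRow (hT : 0 ≤ T) (θ : Coeff T) : ∃ u v, IsRow T θ u v := by
  set w := initial T + deviation T θ with hw
  have hweq : w = initial T + volBlock T θ w := by
    conv_lhs => rw [hw, deviation_eq T hT θ]
    rw [hw, map_add]
    abel
  have i1 : Integrable (fun s => θ.2.2 * w.1 s + θ.1 s * w.2 s)
      (volume.restrict (Set.Icc (0 : ℝ) T)) :=
    ((integrable_potential T w.1).const_mul _).add
      (integrable_mul_of_memLp (Lp.memLp _) (Lp.memLp _))
  have i2 : Integrable (fun s => θ.2.1 s * w.1 s - θ.2.2 * w.2 s)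
      (volume.restrict (Set.Icc (0 : ℝ) T)) :=
    (integrable_mul_of_memLp (Lp.memLp _) (Lp.memLp _)).sub
      ((integrable_potential T w.2).const_mul _)
  have hx : ∀ᵐ t ∂(volume.restrict (Set.Icc (0 : ℝ) T)),
      w.1 t = 1 + ∫ s in (0 : ℝ)..t, (θ.2.2 * w.1 s + θ.1 s * w.2 s) := by
    have : w.1 = one T + (volBlock T θ w).1 := congrArg Prod.fst hweq
    filter_upwards [Lp.coeFn_add (one T) (volBlock T θ w).1, one_ae T, volBlock_fst_ae θ w]
      with t h1 h2 h3
    conv_lhs => rw [this]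
    rw [h1, Pi.add_apply, h2, h3]
  have hy : ∀ᵐ t ∂(volume.restrict (Set.Icc (0 : ℝ) T)),
      w.2 t = ∫ s in (0 : ℝ)..t, (θ.2.1 s * w.1 s - θ.2.2 * w.2 s) := by
    have : w.2 = (volBlock T θ w).2 := (congrArg Prod.snd hweq).trans (zero_add _)
    filter_upwards [volBlock_snd_ae θ w] with t h3
    conv_lhs => rw [this]
    rw [h3]
  refine ⟨fun t => 1 + ∫ s in (0 : ℝ)..t, (θ.2.2 * w.1 s + θ.1 s * w.2 s),
    fun t => ∫ s in (0 : ℝ)..t, (θ.2.1 s * w.1 s - θ.2.2 * w.2 s),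
    continuousOn_const.add (continuousOn_primitive i1), continuousOn_primitive i2, ?_, ?_⟩
  · intro t ht
    congr 1
    refine primitive_congr ?_ ht
    filter_upwards [hx, hy] with s h1 h2
    rw [← h1, ← h2]
  · intro t ht
    refine primitive_congr ?_ ht
    filter_upwards [hx, hy] with s h1 h2
    rw [← h1, ← h2]

variable (T)

/-- Complex conjugation of potentials. -/
noncomputable def conjL : Potential T →L[ℝ] Potential T :=
  (Complex.conjCLE : ℂ →L[ℝ] ℂ).compLpL 2 _

theorem conjL_ae (q : Potential T) : ∀ᵐ t ∂(volume.restrict (Set.Icc (0 : ℝ) T)),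
    conjL T q t = (starRingEnd ℂ) (q t) := by
  filter_upwards [(Complex.conjCLE : ℂ →L[ℝ] ℂ).coeFn_compLpL (p := 2) q] with t ht
  rw [conjL, ht]
  rfl

/-- The coefficients of the system solved by the first row `(a, b)` of the extended frame. -/
noncomputable def firstRow (q : Potential T) (lam : ℂ) : Coeff T :=
  (-(1 / 2 : ℂ) • conjL T q, (1 / 2 : ℂ) • q, Complex.I * lam / 2)

/-- The coefficients of the system solved by the second row of the extended frame, read backwards,
that is, by `(d, c)`. -/
noncomputable def secondRow (q : Potential T) (lam : ℂ) : Coeff T :=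
  ((1 / 2 : ℂ) • q, -(1 / 2 : ℂ) • conjL T q, -(Complex.I * lam / 2))

variable {T}

theorem mul_alphaMatrix (q : Potential T) (lam : ℂ) (F : Matrix (Fin 2) (Fin 2) ℂ) (s : ℝ)
    (i : Fin 2) :
    (F * alphaMatrix T q lam s) i 0
      = Complex.I * lam / 2 * F i 0 + -(1 / 2) * (starRingEnd ℂ) (q s) * F i 1 ∧
    (F * alphaMatrix T q lam s) i 1
      = (1 / 2) * q s * F i 0 - Complex.I * lam / 2 * F i 1 := by
  rw [Matrix.mul_apply, Matrix.mul_apply, Fin.sum_univ_two, Fin.sum_univ_two]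
  constructor
  · simp [alphaMatrix]
    ring
  · simp [alphaMatrix]
    ring

theorem smul_ae (c : ℂ) (q : Potential T) : ∀ᵐ t ∂(volume.restrict (Set.Icc (0 : ℝ) T)),
    (c • q : Potential T) t = c * q t := by
  filter_upwards [Lp.coeFn_smul c q] with t ht
  rw [ht, Pi.smul_apply, smul_eq_mul]

theorem smul_conjL_ae (c : ℂ) (q : Potential T) : ∀ᵐ t ∂(volume.restrict (Set.Icc (0 : ℝ) T)),
    (c • conjL T q : Potential T) t = c * (starRingEnd ℂ) (q t) := by
  filter_upwards [smul_ae c (conjL T q), conjL_ae T q] with t ht ht'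
  rw [ht, ht']

theorem isExtendedFrame_iff (q : Potential T) (lam : ℂ) (F : ℝ → Matrix (Fin 2) (Fin 2) ℂ) :
    IsExtendedFrame T q lam F ↔
      IsRow T (firstRow T q lam) (fun t => F t 0 0) (fun t => F t 0 1) ∧
      IsRow T (secondRow T q lam) (fun t => F t 1 1) (fun t => F t 1 0) := by
  have e00 : ∀ t ∈ Set.Icc (0 : ℝ) T, ∫ s in (0 : ℝ)..t, (F s * alphaMatrix T q lam s) 0 0
      = ∫ s in (0 : ℝ)..t, ((firstRow T q lam).2.2 * F s 0 0
        + (firstRow T q lam).1 s * F s 0 1) := fun t ht => by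
    refine primitive_congr ?_ ht
    filter_upwards [smul_conjL_ae (-(1 / 2)) q] with s hs
    rw [(mul_alphaMatrix q lam (F s) s 0).1, firstRow, hs]
  have e01 : ∀ t ∈ Set.Icc (0 : ℝ) T, ∫ s in (0 : ℝ)..t, (F s * alphaMatrix T q lam s) 0 1
      = ∫ s in (0 : ℝ)..t, ((firstRow T q lam).2.1 s * F s 0 0
        - (firstRow T q lam).2.2 * F s 0 1) := fun t ht => by
    refine primitive_congr ?_ ht
    filter_upwards [smul_ae (1 / 2) q] with s hs
    rw [(mul_alphaMatrix q lam (F s) s 0).2, firstRow, hs]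
  have e10 : ∀ t ∈ Set.Icc (0 : ℝ) T, ∫ s in (0 : ℝ)..t, (F s * alphaMatrix T q lam s) 1 0
      = ∫ s in (0 : ℝ)..t, ((secondRow T q lam).2.1 s * F s 1 1
        - (secondRow T q lam).2.2 * F s 1 0) := fun t ht => by
    refine primitive_congr ?_ ht
    filter_upwards [smul_conjL_ae (-(1 / 2)) q] with s hs
    rw [(mul_alphaMatrix q lam (F s) s 1).1, secondRow, hs]
    ring
  have e11 : ∀ t ∈ Set.Icc (0 : ℝ) T, ∫ s in (0 : ℝ)..t, (F s * alphaMatrix T q lam s) 1 1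
      = ∫ s in (0 : ℝ)..t, ((secondRow T q lam).2.2 * F s 1 1
        + (secondRow T q lam).1 s * F s 1 0) := fun t ht => by
    refine primitive_congr ?_ ht
    filter_upwards [smul_ae (1 / 2) q] with s hs
    rw [(mul_alphaMatrix q lam (F s) s 1).2, secondRow, hs]
    ring
  have hcont : ContinuousOn F (Set.Icc 0 T) ↔
      ∀ i j, ContinuousOn (fun t => F t i j) (Set.Icc 0 T) :=
    ⟨fun h i j => (continuous_apply_apply i j).comp_continuousOn h,
      fun h => continuousOn_pi.mpr fun i => continuousOn_pi.mpr (h i)⟩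
  rw [IsExtendedFrame, hcont]
  constructor
  · rintro ⟨hc, h⟩
    refine ⟨⟨hc 0 0, hc 0 1, fun t ht => ?_, fun t ht => ?_⟩,
      ⟨hc 1 1, hc 1 0, fun t ht => ?_, fun t ht => ?_⟩⟩
    · rw [h t ht 0 0, e00 t ht]; simp
    · rw [h t ht 0 1, e01 t ht]; simp
    · rw [h t ht 1 1, e11 t ht]; simp
    · rw [h t ht 1 0, e10 t ht]; simp
  · rintro ⟨h1, h2⟩
    refine ⟨fun i j => ?_, fun t ht i j => ?_⟩
    · fin_cases i <;> fin_cases j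
      exacts [h1.continuousOn_fst, h1.continuousOn_snd, h2.continuousOn_snd, h2.continuousOn_fst]
    · fin_cases i <;> fin_cases j
      · simpa [e00 t ht] using h1.fst_eq t ht
      · simpa [e01 t ht] using h1.snd_eq t ht
      · simpa [e10 t ht] using h2.snd_eq t ht
      · simpa [e11 t ht] using h2.fst_eq t ht

theorem isExtendedFrame_extendedFrame (hT : 0 ≤ T) (q : Potential T) (lam : ℂ) :
    IsExtendedFrame T q lam (extendedFrame T q lam) := by
  obtain ⟨u, v, h1⟩ := exists_isRow hT (firstRow T q lam)
  obtain ⟨u', v', h2⟩ := exists_isRow hT (secondRow T q lam)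
  refine Classical.epsilon_spec (p := IsExtendedFrame T q lam)
    ⟨fun t => !![u t, v t; v' t, u' t], ?_⟩
  rw [isExtendedFrame_iff]
  simpa using ⟨h1, h2⟩

theorem monodromy_apply (hT : 0 ≤ T) (q : Potential T) (lam : ℂ) :
    monodromy T q lam 0 0 = 1 + (endDeviation T hT (firstRow T q lam)).1 ∧
    monodromy T q lam 0 1 = (endDeviation T hT (firstRow T q lam)).2 ∧
    monodromy T q lam 1 1 = 1 + (endDeviation T hT (secondRow T q lam)).1 := by
  obtain ⟨h1, h2⟩ := (isExtendedFrame_iff q lam _).mp (isExtendedFrame_extendedFrame hT q lam)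
  exact ⟨(h1.end_eq hT).1, (h1.end_eq hT).2, (h2.end_eq hT).1⟩

/-! ### Gauge transformations -/

variable (T) in
/-- Multiplication of potentials by `t ↦ exp (c t)`. -/
noncomputable def mulExp (c : ℂ) : Potential T →L[ℂ] Potential T :=
  LinearMap.mkContinuous
    { toFun := fun p => (memLp_of_mul c p).toLp _
      map_add' := fun p p' => by
        rw [← MemLp.toLp_add]
        refine MemLp.toLp_congr _ _ ?_
        filter_upwards [Lp.coeFn_add p p'] with t ht
        simp only [Pi.add_apply] at ht ⊢
        rw [ht, mul_add]
      map_smul' := fun a p => by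
        rw [RingHom.id_apply, ← MemLp.toLp_const_smul]
        refine MemLp.toLp_congr _ _ ?_
        filter_upwards [Lp.coeFn_smul a p] with t ht
        simp only [Pi.smul_apply, smul_eq_mul] at ht ⊢
        rw [ht]
        ring }
    (Real.exp (‖c‖ * |T|)) (fun p => by
      refine Lp.norm_le_mul_norm_of_ae_le_mul ?_
      filter_upwards [(memLp_of_mul c p).coeFn_toLp, ae_restrict_mem measurableSet_Icc]
        with t ht ht'
      simp only [LinearMap.coe_mk, AddHom.coe_mk]
      rw [ht, norm_mul]
      gcongr
      exact norm_exp_mul_le c ht')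
where
  norm_exp_mul_le (c : ℂ) {t : ℝ} (ht : t ∈ Set.Icc (0 : ℝ) T) :
      ‖Complex.exp (c * t)‖ ≤ Real.exp (‖c‖ * |T|) := by
    refine (Complex.norm_exp_le_exp_norm _).trans ?_
    rw [norm_mul, Complex.norm_real, Real.norm_eq_abs, abs_of_nonneg ht.1]
    gcongr
    exact ht.2.trans (le_abs_self T)
  memLp_of_mul (c : ℂ) (p : Potential T) : MemLp (fun t : ℝ => Complex.exp (c * t) * p t) 2
      (volume.restrict (Set.Icc (0 : ℝ) T)) := by
    refine MemLp.of_le_mul (Lp.memLp p) (c := Real.exp (‖c‖ * |T|)) ?_ ?_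
    · exact (by fun_prop : Continuous fun t : ℝ => Complex.exp (c * t)).aestronglyMeasurable.mul
        (Lp.aestronglyMeasurable p)
    · filter_upwards [ae_restrict_mem measurableSet_Icc] with t ht
      rw [norm_mul]
      gcongr
      exact norm_exp_mul_le c ht

theorem mulExp_ae (c : ℂ) (p : Potential T) : ∀ᵐ t ∂(volume.restrict (Set.Icc (0 : ℝ) T)),
    mulExp T c p t = Complex.exp (c * t) * p t :=
  (mulExp.memLp_of_mul T c p).coeFn_toLp

theorem norm_mulExp_le_of_re_eq_zero {c : ℂ} (hc : c.re = 0) (p : Potential T) :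
    ‖mulExp T c p‖ ≤ ‖p‖ := by
  rw [← one_mul ‖p‖]
  refine Lp.norm_le_mul_norm_of_ae_le_mul ?_
  filter_upwards [mulExp_ae c p] with t ht
  rw [ht, norm_mul, Complex.norm_exp]
  simp [hc]

/-- Multiplying a primitive by an exponential. -/
theorem exp_mul_primitive {x g : ℝ → ℂ} {x₀ : ℂ} {t : ℝ} (c : ℂ) (ht : 0 ≤ t)
    (hg : IntervalIntegrable g volume 0 t)
    (hx : ∀ s ∈ Set.Icc 0 t, x s = x₀ + ∫ y in (0 : ℝ)..s, g y) :
    Complex.exp (c * t) * x t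
      = x₀ + ∫ s in (0 : ℝ)..t, (c * (Complex.exp (c * s) * x s) + Complex.exp (c * s) * g s) := by
  have hprim : ∀ s : ℝ, ∫ y in (0 : ℝ)..s, c * Complex.exp (c * y) = Complex.exp (c * s) - 1 := by
    intro s
    have hd : ∀ y ∈ Set.uIcc (0 : ℝ) s,
        HasDerivAt (fun y : ℝ => Complex.exp (c * y)) (c * Complex.exp (c * y)) y := by
      intro y _
      have h1 : HasDerivAt (fun y : ℝ => c * (y : ℂ)) (c * 1) y :=
        (Complex.ofRealCLM.hasDerivAt (x := y)).const_mul c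
      have h2 := h1.cexp
      rwa [mul_one, mul_comm] at h2
    rw [intervalIntegral.integral_eq_sub_of_hasDerivAt hd
      ((by fun_prop : Continuous fun y : ℝ => c * Complex.exp (c * y)).intervalIntegrable _ _)]
    simp
  have hf : IntervalIntegrable (fun y : ℝ => c * Complex.exp (c * y)) volume 0 t :=
    (by fun_prop : Continuous fun y : ℝ => c * Complex.exp (c * y)).intervalIntegrable _ _
  have h := primitive_mul_primitive ht hf hg
  have hGc : ContinuousOn (fun s => ∫ y in (0 : ℝ)..s, g y) (Set.uIcc 0 t) :=
    intervalIntegral.continuousOn_primitive_interval' hg Set.left_mem_uIcc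
  have i1 : IntervalIntegrable (fun s : ℝ => c * Complex.exp (c * s) * ∫ y in (0 : ℝ)..s, g y)
      volume 0 t := hf.mul_continuousOn hGc
  have i2 : IntervalIntegrable
      (fun s : ℝ => g s * ∫ y in (0 : ℝ)..s, c * Complex.exp (c * y)) volume 0 t := by
    simp only [hprim]
    exact hg.mul_continuousOn (by fun_prop)
  have e1 : ∫ s in (0 : ℝ)..t, (c * (Complex.exp (c * s) * x s) + Complex.exp (c * s) * g s)
      = ∫ s in (0 : ℝ)..t, ((x₀ * (c * Complex.exp (c * s)) + g s)
        + (c * Complex.exp (c * s) * (∫ y in (0 : ℝ)..s, g y)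
          + g s * ∫ y in (0 : ℝ)..s, c * Complex.exp (c * y))) := by
    refine intervalIntegral.integral_congr fun s hs => ?_
    rw [Set.uIcc_of_le ht] at hs
    rw [hx s hs, hprim]
    ring
  rw [e1, intervalIntegral.integral_add ((hf.const_mul _).add hg) (i1.add i2),
    intervalIntegral.integral_add (hf.const_mul _) hg, intervalIntegral.integral_add i1 i2, ← h,
    intervalIntegral.integral_const_mul, hprim, hx t ⟨ht, le_rfl⟩]
  ring

variable (T) in
/-- The coefficients of the system after the gauge transformation by
`diag (exp (-c t), exp (c t))`. -/
noncomputable def gauge (c : ℂ) (θ : Coeff T) : Coeff T :=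
  (mulExp T (-(2 * c)) θ.1, mulExp T (2 * c) θ.2.1, θ.2.2 - c)

theorem IsRow.gauge (c : ℂ) {θ : Coeff T} {u v : ℝ → ℂ} (h : IsRow T θ u v) :
    IsRow T (gauge T c θ) (fun t => Complex.exp (-c * t) * u t)
      (fun t => Complex.exp (c * t) * v t) := by
  have hexp : ∀ a : ℂ, ContinuousOn (fun t : ℝ => Complex.exp (a * t)) (Set.Icc 0 T) :=
    fun a => (by fun_prop : Continuous fun t : ℝ => Complex.exp (a * t)).continuousOn
  have i1 : Integrable (fun s => θ.2.2 * u s + θ.1 s * v s)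
      (volume.restrict (Set.Icc (0 : ℝ) T)) :=
    (((memLp_of_continuousOn h.continuousOn_fst).integrable (by norm_num)).const_mul _).add
      (integrable_mul_of_memLp (Lp.memLp _) (memLp_of_continuousOn h.continuousOn_snd))
  have i2 : Integrable (fun s => θ.2.1 s * u s - θ.2.2 * v s)
      (volume.restrict (Set.Icc (0 : ℝ) T)) :=
    (integrable_mul_of_memLp (Lp.memLp _) (memLp_of_continuousOn h.continuousOn_fst)).sub
      (((memLp_of_continuousOn h.continuousOn_snd).integrable (by norm_num)).const_mul _)
  refine ⟨(hexp _).mul h.continuousOn_fst, (hexp _).mul h.continuousOn_snd, fun t ht => ?_,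
    fun t ht => ?_⟩
  · have h0 : (0 : ℝ) ∈ Set.Icc 0 T := ⟨le_rfl, ht.1.trans ht.2⟩
    rw [exp_mul_primitive (-c) ht.1 (intervalIntegrable_of_integrable i1 h0 ht)
      (fun s hs => h.fst_eq s ⟨hs.1, hs.2.trans ht.2⟩)]
    congr 1
    refine primitive_congr ?_ ht
    filter_upwards [mulExp_ae (-(2 * c)) θ.1] with s hs
    simp only [PerturbedFourier.gauge]
    rw [hs]
    have : Complex.exp (-(2 * c) * s) * Complex.exp (c * s) = Complex.exp (-c * s) := by
      rw [← Complex.exp_add]; congr 1; ring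
    linear_combination (-(θ.1 s * v s)) * this
  · have h0 : (0 : ℝ) ∈ Set.Icc 0 T := ⟨le_rfl, ht.1.trans ht.2⟩
    rw [exp_mul_primitive (x₀ := 0) c ht.1 (intervalIntegrable_of_integrable i2 h0 ht)
      (fun s hs => by rw [zero_add]; exact h.snd_eq s ⟨hs.1, hs.2.trans ht.2⟩), zero_add]
    refine primitive_congr ?_ ht
    filter_upwards [mulExp_ae (2 * c) θ.2.1] with s hs
    simp only [PerturbedFourier.gauge]
    rw [hs]
    have : Complex.exp (2 * c * s) * Complex.exp (-c * s) = Complex.exp (c * s) := by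
      rw [← Complex.exp_add]; congr 1; ring
    linear_combination (-(θ.2.1 s * u s)) * this

theorem endDeviation_gauge (hT : 0 ≤ T) (c : ℂ) (θ : Coeff T) :
    1 + (endDeviation T hT (gauge T c θ)).1
      = Complex.exp (-c * T) * (1 + (endDeviation T hT θ).1) ∧
    (endDeviation T hT (gauge T c θ)).2 = Complex.exp (c * T) * (endDeviation T hT θ).2 := by
  obtain ⟨u, v, h⟩ := exists_isRow hT θ
  have h1 := h.end_eq hT
  have h2 := (h.gauge c).end_eq hT
  exact ⟨by rw [← h2.1, ← h1.1], by rw [← h2.2, ← h1.2]⟩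

end Frame


/-! ### Square-summable sequences -/

section Sequences

variable {ι : Type*} {E : ι → Type*} [∀ i, NormedAddCommGroup (E i)]

theorem memℓp_two_of_sum_le {f : ∀ i, E i} {C : ℝ}
    (h : ∀ s : Finset ι, ∑ i ∈ s, ‖f i‖ ^ 2 ≤ C) : Memℓp f 2 := by
  refine memℓp_gen' (C := C) fun s => ?_
  simpa using h s

theorem memℓp_two_iff_summable {f : ∀ i, E i} : Memℓp f 2 ↔ Summable fun i => ‖f i‖ ^ 2 := by
  rw [memℓp_gen_iff (by norm_num)]
  simp

theorem lp_sum_sq_le (f : lp E 2) (s : Finset ι) : ∑ i ∈ s, ‖f i‖ ^ 2 ≤ ‖f‖ ^ 2 := by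
  have := lp.sum_rpow_le_norm_rpow (p := 2) (by norm_num) f s
  simpa using this

theorem lp_hasSum_sq (f : lp E 2) : HasSum (fun i => ‖f i‖ ^ 2) (‖f‖ ^ 2) := by
  have := lp.hasSum_norm (p := 2) (by norm_num) f
  simpa using this

theorem lp_norm_le {f : lp E 2} {C : ℝ} (hC : 0 ≤ C)
    (h : ∀ s : Finset ι, ∑ i ∈ s, ‖f i‖ ^ 2 ≤ C ^ 2) : ‖f‖ ≤ C := by
  refine le_of_sq_le_sq ?_ hC
  exact le_of_tendsto' (lp_hasSum_sq f) h

theorem lp_norm_apply_le (f : lp E 2) (i : ι) : ‖f i‖ ≤ ‖f‖ :=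
  lp.norm_apply_le_norm (by norm_num) f i

end Sequences

/-! ### Fourier coefficients of potentials -/

section Fourier

variable (T : ℝ)

/-- The exponent `2πik/T`. -/
noncomputable def freq (k : ℤ) : ℂ := 2 * Real.pi * Complex.I / T * k

theorem freq_neg (k : ℤ) : freq T (-k) = -freq T k := by
  unfold freq; push_cast; ring

theorem freq_eq (k : ℤ) : freq T k = ((2 * Real.pi / T * k : ℝ) : ℂ) * Complex.I := by
  unfold freq; push_cast; ring

theorem freq_re (k : ℤ) : (freq T k).re = 0 := by
  rw [freq_eq, Complex.re_ofReal_mul, Complex.I_re, mul_zero]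

theorem hasSum_sq_fourierIntegral (hT : 0 < T) {f : ℝ → ℂ}
    (hf : MemLp f 2 (volume.restrict (Set.Icc (0 : ℝ) T))) :
    HasSum (fun k : ℤ => ‖∫ t in (0 : ℝ)..T, Complex.exp (freq T k * t) * f t‖ ^ 2)
      (T * ∫ t in (0 : ℝ)..T, ‖f t‖ ^ 2) := by
  have hf' : MemLp f 2 (volume.restrict (Set.Ioc 0 T)) :=
    hf.mono_measure (Measure.restrict_mono Set.Ioc_subset_Icc_self le_rfl)
  have h := (hasSum_sq_fourierCoeffOn hT hf').mul_left (T ^ 2)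
  rw [← (Equiv.neg ℤ).hasSum_iff] at h
  have e1 : T * ∫ t in (0 : ℝ)..T, ‖f t‖ ^ 2
      = T ^ 2 * ((T - 0)⁻¹ • ∫ t in (0 : ℝ)..T, ‖f t‖ ^ 2) := by
    rw [sub_zero, smul_eq_mul]
    field_simp
  have e2 : (fun k : ℤ => ‖∫ t in (0 : ℝ)..T, Complex.exp (freq T k * t) * f t‖ ^ 2)
      = (fun k => T ^ 2 * ‖fourierCoeffOn hT f k‖ ^ 2) ∘ Equiv.neg ℤ := by
    ext k
    rw [Function.comp_apply, Equiv.neg_apply]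
    rw [fourierCoeffOn_eq_integral, neg_neg, norm_smul, mul_pow, sub_zero, Real.norm_eq_abs, sq_abs]
    have h1 : ∫ t in (0 : ℝ)..T, Complex.exp (freq T k * t) * f t
        = ∫ x in (0 : ℝ)..T, fourier k (x : AddCircle T) • f x := by
      refine intervalIntegral.integral_congr fun t _ => ?_
      rw [fourier_coe_apply, smul_eq_mul, freq]
      congr 2
      ring
    rw [h1, one_div, inv_pow, mul_inv_cancel_left₀ (pow_ne_zero 2 hT.ne')]
  rw [e1, e2]
  exact h

theorem exp_freq_mul_T (hT : T ≠ 0) (k : ℤ) : Complex.exp (freq T k * T) = 1 := by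
  rw [Complex.exp_eq_one_iff]
  refine ⟨k, ?_⟩
  have : (T : ℂ) ≠ 0 := by exact_mod_cast hT
  unfold freq
  field_simp

theorem primitive_mulExp (p : Potential T) (c : ℂ) {t : ℝ} (ht : t ∈ Set.Icc (0 : ℝ) T) :
    ∫ s in (0 : ℝ)..t, mulExp T c p s = ∫ s in (0 : ℝ)..t, Complex.exp (c * s) * p s := by
  refine primitive_congr ?_ ht
  filter_upwards [mulExp_ae c p] with s hs
  rw [hs]

theorem pair_mulExp_one (hT : 0 ≤ T) (p : Potential T) (k : ℤ) :
    pair T hT (mulExp T (freq T k) p) (one T) = potentialFourierCoeff T p k := by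
  rw [pair_one_apply, primitive_mulExp T p _ ⟨hT, le_rfl⟩, potentialFourierCoeff,
    setIntegral_Icc_eq_intervalIntegral hT]
  refine intervalIntegral.integral_congr fun t _ => ?_
  simp only [freq]
  ring

theorem hasSum_sq_potentialFourierCoeff (hT : 0 < T) (p : Potential T) :
    HasSum (fun k : ℤ => ‖potentialFourierCoeff T p k‖ ^ 2) (T * ‖p‖ ^ 2) := by
  have h := hasSum_sq_fourierIntegral T hT (Lp.memLp p)
  rw [← norm_potential_sq T hT.le] at h
  convert h using 3 with k
  rw [← pair_mulExp_one T hT.le, pair_one_apply, primitive_mulExp T p _ ⟨hT.le, le_rfl⟩]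

/-- Bessel's inequality for the truncation of a potential to `[0, t]`. -/
theorem sum_sq_primitive_le (hT : 0 < T) (p : Potential T) (s : Finset ℤ) {t : ℝ}
    (ht : t ∈ Set.Icc (0 : ℝ) T) :
    ∑ k ∈ s, ‖∫ x in (0 : ℝ)..t, Complex.exp (freq T k * x) * p x‖ ^ 2 ≤ T * ‖p‖ ^ 2 := by
  have hind : MemLp ((Set.Iic t).indicator p) 2 (volume.restrict (Set.Icc (0 : ℝ) T)) :=
    (Lp.memLp p).indicator measurableSet_Iic
  have hcut : ∀ {F : Type} [NormedAddCommGroup F] [NormedSpace ℝ F] (g : ℝ → F),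
      ∫ x in (0 : ℝ)..T, (Set.Iic t).indicator g x = ∫ x in (0 : ℝ)..t, g x := by
    intro F _ _ g
    rw [intervalIntegral.integral_of_le hT.le, intervalIntegral.integral_of_le ht.1,
      integral_indicator measurableSet_Iic, Measure.restrict_restrict measurableSet_Iic]
    congr 2
    ext x
    simp only [Set.mem_inter_iff, Set.mem_Iic, Set.mem_Ioc]
    exact ⟨fun h => ⟨h.2.1, h.1⟩, fun h => ⟨h.2, h.1, h.2.trans ht.2⟩⟩
  have h := sum_le_hasSum s (fun _ _ => by positivity) (hasSum_sq_fourierIntegral T hT hind)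
  have e1 : ∀ k : ℤ, ∫ x in (0 : ℝ)..T, Complex.exp (freq T k * x) * (Set.Iic t).indicator p x
      = ∫ x in (0 : ℝ)..t, Complex.exp (freq T k * x) * p x := by
    intro k
    rw [← hcut]
    refine intervalIntegral.integral_congr fun x _ => ?_
    simp only [Set.indicator_apply]
    split_ifs <;> simp
  have e2 : ∫ x in (0 : ℝ)..T, ‖(Set.Iic t).indicator p x‖ ^ 2 = ∫ x in (0 : ℝ)..t, ‖p x‖ ^ 2 := by
    rw [← hcut]
    refine intervalIntegral.integral_congr fun x _ => ?_
    simp only [Set.indicator_apply]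
    split_ifs <;> simp
  simp only [e1, e2] at h
  refine h.trans ?_
  gcongr
  exact primitive_sq_le T hT.le p ht

theorem sum_sq_norm_vol_mulExp_le (hT : 0 < T) (p : Potential T) (e : ℤ ≃ ℤ) (s : Finset ℤ) :
    ∑ k ∈ s, ‖vol T (mulExp T (freq T (e k)) p) (one T)‖ ^ 2 ≤ T ^ 2 * ‖p‖ ^ 2 := by
  have h0 : (0 : ℝ) ∈ Set.Icc 0 T := ⟨le_rfl, hT.le⟩
  have h1 : T ∈ Set.Icc 0 T := ⟨hT.le, le_rfl⟩
  have hi : ∀ k ∈ s, IntervalIntegrable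
      (fun t => ‖vol T (mulExp T (freq T (e k)) p) (one T) t‖ ^ 2) volume 0 T := fun k _ =>
    intervalIntegrable_of_integrable (integrable_sq_norm (Lp.memLp _)) h0 h1
  simp only [norm_potential_sq T hT.le (vol T _ _)]
  rw [← intervalIntegral.integral_finsetSum hi]
  have hb : ∫ t in (0 : ℝ)..T, ∑ k ∈ s, ‖vol T (mulExp T (freq T (e k)) p) (one T) t‖ ^ 2
      ≤ ∫ t in (0 : ℝ)..T, T * ‖p‖ ^ 2 := by
    refine intervalIntegral.integral_mono_ae_restrict hT.le
      (by simpa only [Finset.sum_fn] using IntervalIntegrable.sum s hi) (by simp) ?_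
    have hae : ∀ᵐ t ∂(volume.restrict (Set.Icc (0 : ℝ) T)), ∀ k : ℤ,
        vol T (mulExp T (freq T (e k)) p) (one T) t
          = ∫ x in (0 : ℝ)..t, mulExp T (freq T (e k)) p x :=
      ae_all_iff.mpr fun k => vol_one_ae T _
    filter_upwards [hae, ae_restrict_mem measurableSet_Icc] with t ht ht'
    have := sum_sq_primitive_le T hT p (s.map e.toEmbedding) ht'
    rw [Finset.sum_map] at this
    refine le_trans (le_of_eq ?_) this
    refine Finset.sum_congr rfl fun k _ => ?_
    rw [ht k, primitive_mulExp T p _ ht']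
    rfl
  refine hb.trans_eq ?_
  simp
  ring

theorem sum_sq_norm_pair_mulExp_le (hT : 0 < T) (p : Potential T) (e : ℤ ≃ ℤ) (s : Finset ℤ) :
    ∑ k ∈ s, ‖pair T hT.le (mulExp T (freq T (e k)) p) (one T)‖ ^ 2 ≤ T * ‖p‖ ^ 2 := by
  have h := sum_le_hasSum (s.map e.toEmbedding) (fun _ _ => by positivity)
    (hasSum_sq_potentialFourierCoeff T hT p)
  rw [Finset.sum_map] at h
  simpa only [pair_mulExp_one, Equiv.coe_toEmbedding] using h

/-! ### The Fourier isomorphism -/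

theorem potentialFourierCoeff_smul_complex (c : ℂ) (q : Potential T) (k : ℤ) :
    potentialFourierCoeff T (c • q) k = c * potentialFourierCoeff T q k := by
  unfold potentialFourierCoeff
  rw [← integral_const_mul]
  refine integral_congr_ae ?_
  filter_upwards [smul_ae c q] with t ht
  rw [ht, mul_assoc]

/-- The Fourier transform from potentials to square-summable sequences. -/
noncomputable def fourierL (hT : 0 < T) : Potential T →L[ℂ] lp (fun _ : ℤ => ℂ) 2 :=
  LinearMap.mkContinuous
    { toFun := fun q => ⟨fun k => potentialFourierCoeff T q k,
        memℓp_two_iff_summable.mpr (hasSum_sq_potentialFourierCoeff T hT q).summable⟩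
      map_add' := fun p q => by
        ext k
        exact potentialFourierCoeff_add T p q k
      map_smul' := fun c q => by
        ext k
        exact potentialFourierCoeff_smul_complex T c q k }
    (√T) (fun q => by
      refine lp_norm_le (by positivity) fun s => ?_
      rw [mul_pow, Real.sq_sqrt hT.le]
      exact sum_le_hasSum s (fun _ _ => by positivity) (hasSum_sq_potentialFourierCoeff T hT q))

@[simp] theorem fourierL_apply (hT : 0 < T) (q : Potential T) (k : ℤ) :
    fourierL T hT q k = potentialFourierCoeff T q k := rfl

theorem norm_sq_fourierL (hT : 0 < T) (q : Potential T) :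
    ‖fourierL T hT q‖ ^ 2 = T * ‖q‖ ^ 2 :=
  (lp_hasSum_sq (fourierL T hT q)).unique (hasSum_sq_potentialFourierCoeff T hT q)

theorem norm_fourierL (hT : 0 < T) (q : Potential T) : ‖fourierL T hT q‖ = √T * ‖q‖ := by
  rw [← Real.sqrt_sq (norm_nonneg (fourierL T hT q)), norm_sq_fourierL, Real.sqrt_mul hT.le,
    Real.sqrt_sq (norm_nonneg q)]

theorem integral_exp_freq (hT : 0 < T) (j : ℤ) :
    ∫ t in (0 : ℝ)..T, Complex.exp (freq T j * t) = if j = 0 then (T : ℂ) else 0 := by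
  split_ifs with h
  · simp [h, freq]
  · have hT' : (T : ℂ) ≠ 0 := by exact_mod_cast hT.ne'
    have hj : freq T j ≠ 0 := by
      unfold freq
      simp [hT.ne', h]
    rw [integral_exp_mul_complex hj, exp_freq_mul_T T hT.ne']
    simp

theorem surjective_fourierL (hT : 0 < T) : Function.Surjective (fourierL T hT) := by
  have hclosed : IsClosed (Set.range (fourierL T hT)) := by
    have hanti : AntilipschitzWith (Real.toNNReal (√T)⁻¹) (fourierL T hT) := by
      refine AddMonoidHomClass.antilipschitz_of_bound _ fun q => ?_
      rw [norm_fourierL, Real.coe_toNNReal _ (by positivity)]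
      have : √T ≠ 0 := (Real.sqrt_pos.mpr hT).ne'
      field_simp
      exact le_rfl
    exact hanti.isClosed_range (fourierL T hT).uniformContinuous
  have hsingle : ∀ (k : ℤ) (c : ℂ), lp.single 2 k c ∈ (fourierL T hT).range := by
    intro k c
    refine ⟨(c / T) • mulExp T (freq T (-k)) (one T), ?_⟩
    ext j
    rw [ContinuousLinearMap.coe_coe, fourierL_apply, potentialFourierCoeff_smul_complex,
      ← pair_mulExp_one T hT.le, pair_one_apply]
    have h1 : ∫ t in (0 : ℝ)..T, mulExp T (freq T j) (mulExp T (freq T (-k)) (one T)) t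
        = ∫ t in (0 : ℝ)..T, Complex.exp (freq T (j - k) * t) := by
      refine primitive_congr ?_ ⟨hT.le, le_rfl⟩
      filter_upwards [mulExp_ae (freq T j) (mulExp T (freq T (-k)) (one T)),
        mulExp_ae (freq T (-k)) (one T), one_ae T] with t a1 a2 a3
      rw [a1, a2, a3, mul_one, ← Complex.exp_add]
      congr 1
      unfold freq
      push_cast
      ring
    have hT' : (T : ℂ) ≠ 0 := by exact_mod_cast hT.ne'
    rw [h1, integral_exp_freq T hT, lp.single_apply]
    by_cases hjk : j = k
    · subst hjk
      simp [hT']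
    · rw [if_neg (sub_ne_zero.mpr hjk)]
      simp [hjk]
  intro f
  have hmem : f ∈ closure (Set.range (fourierL T hT)) := by
    refine mem_closure_of_tendsto (lp.hasSum_single (by norm_num) f) (Eventually.of_forall ?_)
    intro s
    exact Submodule.sum_mem (fourierL T hT).range fun k _ => hsingle k (f k)
  rwa [hclosed.closure_eq] at hmem

variable (N : ℕ)

/-- Restriction of a sequence to the indices `|k| > N`. -/
noncomputable def tailRestrict : lp (fun _ : ℤ => ℂ) 2 →L[ℝ] EllTwoTail N :=
  LinearMap.mkContinuous
    { toFun := fun f => ⟨fun k => f k.1, memℓp_two_of_sum_le (C := ‖f‖ ^ 2) fun s => by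
        have := lp_sum_sq_le f (s.map (Function.Embedding.subtype _))
        rwa [Finset.sum_map] at this⟩
      map_add' := fun f g => rfl
      map_smul' := fun c f => rfl }
    1 (fun f => by
      refine lp_norm_le (by positivity) fun s => ?_
      have := lp_sum_sq_le f (s.map (Function.Embedding.subtype _))
      rw [Finset.sum_map] at this
      rw [one_mul]
      exact this)

@[simp] theorem tailRestrict_apply (f : lp (fun _ : ℤ => ℂ) 2)
    (k : {k : ℤ // (N : ℤ) < |k|}) : tailRestrict N f k = f k.1 := rfl

theorem norm_tailRestrict_le (f : lp (fun _ : ℤ => ℂ) 2) : ‖tailRestrict N f‖ ≤ ‖f‖ := by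
  refine lp_norm_le (norm_nonneg f) fun s => ?_
  have := lp_sum_sq_le f (s.map (Function.Embedding.subtype _))
  rwa [Finset.sum_map] at this

theorem sum_sq_tailExtend_le (f : EllTwoTail N) (s : Finset ℤ) :
    ∑ k ∈ s, ‖if h : (N : ℤ) < |k| then f ⟨k, h⟩ else 0‖ ^ 2 ≤ ‖f‖ ^ 2 := by
  classical
  have h := lp_sum_sq_le f (s.subtype fun k => (N : ℤ) < |k|)
  refine le_trans (le_of_eq ?_) h
  rw [← Finset.sum_filter_add_sum_filter_not s (fun k => (N : ℤ) < |k|)]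
  have h0 : ∑ k ∈ s with ¬ (N : ℤ) < |k|, ‖if h : (N : ℤ) < |k| then f ⟨k, h⟩ else 0‖ ^ 2 = 0 := by
    refine Finset.sum_eq_zero fun k hk => ?_
    rw [dif_neg (Finset.mem_filter.mp hk).2]
    simp
  rw [h0, add_zero, ← Finset.sum_subtype_eq_sum_filter]
  refine Finset.sum_congr rfl fun k _ => ?_
  rw [dif_pos k.2]

/-- Extension by zero of a sequence on the indices `|k| > N`. -/
noncomputable def tailExtend : EllTwoTail N →L[ℝ] lp (fun _ : ℤ => ℂ) 2 :=
  LinearMap.mkContinuous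
    { toFun := fun f => ⟨fun k => if h : (N : ℤ) < |k| then f ⟨k, h⟩ else 0,
        memℓp_two_of_sum_le (sum_sq_tailExtend_le N f)⟩
      map_add' := fun f g => by
        ext k
        change (if h : (N : ℤ) < |k| then (f + g) ⟨k, h⟩ else 0)
          = (if h : (N : ℤ) < |k| then f ⟨k, h⟩ else 0) + if h : (N : ℤ) < |k| then g ⟨k, h⟩ else 0
        split_ifs <;> simp
      map_smul' := fun c f => by
        ext k
        change (if h : (N : ℤ) < |k| then (c • f) ⟨k, h⟩ else 0)
          = c • if h : (N : ℤ) < |k| then f ⟨k, h⟩ else 0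
        split_ifs <;> simp }
    1 (fun f => by
      refine lp_norm_le (by positivity) fun s => ?_
      rw [one_mul]
      exact sum_sq_tailExtend_le N f s)

theorem tailExtend_apply (f : EllTwoTail N) (k : ℤ) :
    tailExtend N f k = if h : (N : ℤ) < |k| then f ⟨k, h⟩ else 0 := rfl

theorem tailExtend_apply_of_lt (f : EllTwoTail N) (k : {k : ℤ // (N : ℤ) < |k|}) :
    tailExtend N f k.1 = f k := by
  rw [tailExtend_apply, dif_pos k.2]

theorem norm_tailExtend_le (f : EllTwoTail N) : ‖tailExtend N f‖ ≤ ‖f‖ :=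
  lp_norm_le (norm_nonneg f) (sum_sq_tailExtend_le N f)

theorem tailExtend_tailRestrict_fourierL (hT : 0 < T) (h : vanishingFourierCoeffs T N) :
    tailExtend N (tailRestrict N (fourierL T hT h)) = fourierL T hT h := by
  ext k
  rw [tailExtend_apply]
  split_ifs with hk
  · rfl
  · exact (h.2 k (not_lt.mp hk)).symm

theorem norm_tailRestrict_fourierL (hT : 0 < T) (h : vanishingFourierCoeffs T N) :
    ‖tailRestrict N (fourierL T hT h)‖ = √T * ‖h‖ := by
  refine le_antisymm ((norm_tailRestrict_le N _).trans_eq (norm_fourierL T hT h)) ?_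
  have := norm_tailExtend_le N (tailRestrict N (fourierL T hT h))
  rw [tailExtend_tailRestrict_fourierL, norm_fourierL] at this
  exact this

/-- The Fourier coefficients of index `|k| > N` of potentials in `L²([0,T])_{0,N}`. -/
noncomputable def fourierTailL (hT : 0 < T) : vanishingFourierCoeffs T N →L[ℝ] EllTwoTail N :=
  tailRestrict N ∘L (fourierL T hT).restrictScalars ℝ ∘L (vanishingFourierCoeffs T N).subtypeL

theorem fourierTailL_apply (hT : 0 < T) (h : vanishingFourierCoeffs T N) :
    fourierTailL T N hT h = tailRestrict N (fourierL T hT h) := rfl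

theorem norm_fourierTailL (hT : 0 < T) (h : vanishingFourierCoeffs T N) :
    ‖fourierTailL T N hT h‖ = √T * ‖h‖ := norm_tailRestrict_fourierL T N hT h

theorem bijective_fourierTailL (hT : 0 < T) : Function.Bijective (fourierTailL T N hT) := by
  constructor
  · rw [injective_iff_map_eq_zero]
    intro h hh
    have h1 := norm_fourierTailL T N hT h
    rw [hh, norm_zero] at h1
    have := (mul_eq_zero.mp h1.symm).resolve_left (Real.sqrt_pos.mpr hT).ne'
    exact norm_eq_zero.mp this
  · intro f
    obtain ⟨q, hq⟩ := surjective_fourierL T hT (tailExtend N f)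
    refine ⟨⟨q, fun k hk => ?_⟩, ?_⟩
    · rw [← fourierL_apply T hT, hq, tailExtend_apply, dif_neg (not_lt.mpr hk)]
    · rw [fourierTailL_apply]
      simp only
      rw [hq]
      ext k
      rw [tailRestrict_apply, tailExtend_apply_of_lt]

theorem isClosed_vanishingFourierCoeffs (hT : 0 < T) :
    IsClosed (vanishingFourierCoeffs T N : Set (Potential T)) := by
  have h : (vanishingFourierCoeffs T N : Set (Potential T))
      = ⋂ k : ℤ, ⋂ _ : |k| ≤ (N : ℤ), {q | fourierL T hT q k = 0} := by
    ext q
    simp only [Set.mem_iInter, Set.mem_ofPred_eq, fourierL_apply]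
    exact Iff.rfl
  rw [h]
  refine isClosed_iInter fun k => isClosed_iInter fun _ => isClosed_eq ?_ continuous_const
  exact (lp.evalCLM ℂ (fun _ : ℤ => ℂ) 2 k).continuous.comp (fourierL T hT).continuous

theorem completeSpace_vanishingFourierCoeffs (hT : 0 < T) :
    CompleteSpace (vanishingFourierCoeffs T N) :=
  (isClosed_vanishingFourierCoeffs T N hT).completeSpace_coe

/-- The Fourier coefficients identify `L²([0,T])_{0,N}` with `ℓ²(|k| > N)`. -/
noncomputable def fourierTail (hT : 0 < T) :
    vanishingFourierCoeffs T N ≃L[ℝ] EllTwoTail N :=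
  haveI := completeSpace_vanishingFourierCoeffs T N hT
  ContinuousLinearEquiv.ofBijective (fourierTailL T N hT)
    (LinearMap.ker_eq_bot.mpr (bijective_fourierTailL T N hT).1)
    (LinearMap.range_eq_top.mpr (bijective_fourierTailL T N hT).2)

theorem fourierTail_apply (hT : 0 < T) (h : vanishingFourierCoeffs T N) :
    fourierTail T N hT h = fourierTailL T N hT h := rfl

theorem norm_fourierTail_symm_le (hT : 0 < T) :
    ‖((fourierTail T N hT).symm : EllTwoTail N →L[ℝ] vanishingFourierCoeffs T N)‖ ≤ (√T)⁻¹ := by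
  refine ContinuousLinearMap.opNorm_le_bound _ (by positivity) fun f => ?_
  obtain ⟨h, rfl⟩ := (fourierTail T N hT).surjective f
  rw [ContinuousLinearEquiv.coe_coe, ContinuousLinearEquiv.symm_apply_apply, fourierTail_apply,
    norm_fourierTailL, inv_mul_cancel_left₀ (Real.sqrt_pos.mpr hT).ne']

end Fourier


/-! ### Diagonal operators on spaces of square-summable sequences -/

section Diagonal

variable {ι P V E F : Type*} [NormedAddCommGroup P] [NormedSpace ℂ P]
  [NormedAddCommGroup V] [NormedSpace ℂ V] [NormedAddCommGroup E] [NormedSpace ℂ E]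
  [NormedAddCommGroup F] [NormedSpace ℂ F]

/-- A square-summable family of linear maps, as a linear map to square-summable sequences. -/
noncomputable def summableFamily (A : ι → P →L[ℂ] V) (C : ℝ) (hC : 0 ≤ C)
    (hA : ∀ θ (s : Finset ι), ∑ i ∈ s, ‖A i θ‖ ^ 2 ≤ (C * ‖θ‖) ^ 2) :
    P →L[ℂ] lp (fun _ : ι => V) 2 :=
  LinearMap.mkContinuous
    { toFun := fun θ => ⟨fun i => A i θ, memℓp_two_of_sum_le (hA θ)⟩
      map_add' := fun θ θ' => by ext i; exact map_add (A i) θ θ'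
      map_smul' := fun c θ => by ext i; exact map_smul (A i) c θ }
    C (fun θ => lp_norm_le (by positivity) (hA θ))

theorem sum_sq_diagonal_le (A : ι → P →L[ℂ] E →L[ℂ] F) {C : ℝ}
    (hA : ∀ i θ, ‖A i θ‖ ≤ C * ‖θ‖) (θ : P) (x : lp (fun _ : ι => E) 2) (s : Finset ι) :
    ∑ i ∈ s, ‖A i θ (x i)‖ ^ 2 ≤ (C * ‖θ‖ * ‖x‖) ^ 2 := by
  rw [mul_pow (C * ‖θ‖)]
  refine le_trans ?_ (mul_le_mul_of_nonneg_left (lp_sum_sq_le x s) (by positivity))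
  rw [Finset.mul_sum]
  refine Finset.sum_le_sum fun i _ => ?_
  rw [← mul_pow]
  refine pow_le_pow_left₀ (norm_nonneg _) (((A i θ).le_opNorm _).trans ?_) 2
  exact mul_le_mul_of_nonneg_right (hA i θ) (norm_nonneg _)

/-- The operators on square-summable sequences that act on each entry by a member of a uniformly
bounded family of operators, all of them depending linearly on a parameter. -/
noncomputable def diagonal (A : ι → P →L[ℂ] E →L[ℂ] F) (C : ℝ) (hC : 0 ≤ C)
    (hA : ∀ i θ, ‖A i θ‖ ≤ C * ‖θ‖) :
    P →L[ℂ] lp (fun _ : ι => E) 2 →L[ℂ] lp (fun _ : ι => F) 2 :=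
  LinearMap.mkContinuous₂
    (LinearMap.mk₂ ℂ (fun θ x => (⟨fun i => A i θ (x i),
        memℓp_two_of_sum_le (sum_sq_diagonal_le A hA θ x)⟩ : lp (fun _ : ι => F) 2))
      (fun θ θ' x => by
        ext1; ext1 i
        exact congrArg (fun L : E →L[ℂ] F => L (x i)) (map_add (A i) θ θ'))
      (fun c θ x => by
        ext1; ext1 i
        exact congrArg (fun L : E →L[ℂ] F => L (x i)) (map_smul (A i) c θ))
      (fun θ x x' => by ext1; ext1 i; exact map_add (A i θ) (x i) (x' i))
      (fun c θ x => by ext1; ext1 i; exact map_smul (A i θ) c (x i)))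
    C (fun θ x => lp_norm_le (mul_nonneg (mul_nonneg hC (norm_nonneg _)) (norm_nonneg _))
      (sum_sq_diagonal_le A hA θ x))

end Diagonal

/-! ### The system at all vacuum frequencies -/

section SequenceSystem

variable (T : ℝ)

/-- The coefficients `(p, r, ν)` of the systems at all vacuum frequencies, where `ν` is a
square-summable sequence. -/
abbrev SeqCoeff : Type := Potential T × Potential T × lp (fun _ : ℤ => ℂ) 2

/-- The coefficients of the `k`-th system: `p` and `r` are twisted by `exp (∓ 2πi e(k) t / T)`.
The permutation `e` is the identity for the first row of the frame and `k ↦ -k` for the second. -/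
noncomputable def coeffAt (e : ℤ ≃ ℤ) (k : ℤ) : SeqCoeff T →L[ℂ] Coeff T :=
  ((mulExp T (-freq T (e k))) ∘L ContinuousLinearMap.fst ℂ _ _).prod
    (((mulExp T (freq T (e k))) ∘L ContinuousLinearMap.fst ℂ _ _ ∘L
        ContinuousLinearMap.snd ℂ _ _).prod
      (lp.evalCLM ℂ (fun _ : ℤ => ℂ) 2 k ∘L ContinuousLinearMap.snd ℂ _ _ ∘L
        ContinuousLinearMap.snd ℂ _ _))

theorem coeffAt_apply (e : ℤ ≃ ℤ) (k : ℤ) (θ : SeqCoeff T) :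
    coeffAt T e k θ = (mulExp T (-freq T (e k)) θ.1, mulExp T (freq T (e k)) θ.2.1, θ.2.2 k) := rfl

theorem SeqCoeff.norm_le {T : ℝ} (θ : SeqCoeff T) :
    ‖θ.1‖ ≤ ‖θ‖ ∧ ‖θ.2.1‖ ≤ ‖θ‖ ∧ ‖θ.2.2‖ ≤ ‖θ‖ :=
  ⟨norm_fst_le θ, (norm_fst_le θ.2).trans (norm_snd_le θ),
    (norm_snd_le θ.2).trans (norm_snd_le θ)⟩

theorem norm_coeffAt_le (e : ℤ ≃ ℤ) (k : ℤ) (θ : SeqCoeff T) : ‖coeffAt T e k θ‖ ≤ ‖θ‖ := by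
  obtain ⟨h1, h2, h3⟩ := θ.norm_le
  rw [coeffAt_apply]
  refine norm_prod_le_iff.mpr ⟨?_, norm_prod_le_iff.mpr ⟨?_, ?_⟩⟩
  · exact (norm_mulExp_le_of_re_eq_zero (by rw [Complex.neg_re, freq_re, neg_zero]) _).trans h1
  · exact (norm_mulExp_le_of_re_eq_zero (freq_re T _) _).trans h2
  · exact (lp_norm_apply_le _ k).trans h3

theorem exists_sum_sq_size_le (hT : 0 < T) (e : ℤ ≃ ℤ) : ∃ C : ℝ, 0 ≤ C ∧
    ∀ (θ : SeqCoeff T) (s : Finset ℤ),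
      ∑ k ∈ s, size T hT.le (coeffAt T e k θ) ^ 2 ≤ (C * ‖θ‖) ^ 2 := by
  refine ⟨√(5 * (1 + 2 * (T ^ 2 + T))), by positivity, fun θ s => ?_⟩
  obtain ⟨h1, h2, h3⟩ := θ.norm_le
  have e1 : ∀ a b c d f : ℝ, (a + (b + c) + (d + f)) ^ 2
      ≤ 5 * (a ^ 2 + b ^ 2 + c ^ 2 + d ^ 2 + f ^ 2) := by
    intro a b c d f
    nlinarith [sq_nonneg (a - b), sq_nonneg (a - c), sq_nonneg (a - d), sq_nonneg (a - f),
      sq_nonneg (b - c), sq_nonneg (b - d), sq_nonneg (b - f), sq_nonneg (c - d),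
      sq_nonneg (c - f), sq_nonneg (d - f)]
  have b1 := lp_sum_sq_le θ.2.2 s
  have b2 := sum_sq_norm_vol_mulExp_le T hT θ.1 (e.trans (Equiv.neg ℤ)) s
  have b3 := sum_sq_norm_pair_mulExp_le T hT θ.1 (e.trans (Equiv.neg ℤ)) s
  have b4 := sum_sq_norm_vol_mulExp_le T hT θ.2.1 e s
  have b5 := sum_sq_norm_pair_mulExp_le T hT θ.2.1 e s
  simp only [Equiv.trans_apply, Equiv.neg_apply, freq_neg] at b2 b3
  have q1 : ‖θ.1‖ ^ 2 ≤ ‖θ‖ ^ 2 := by gcongr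
  have q2 : ‖θ.2.1‖ ^ 2 ≤ ‖θ‖ ^ 2 := by gcongr
  have q3 : ‖θ.2.2‖ ^ 2 ≤ ‖θ‖ ^ 2 := by gcongr
  have hT2 : 0 ≤ T ^ 2 := by positivity
  rw [mul_pow, Real.sq_sqrt (by positivity)]
  calc ∑ k ∈ s, size T hT.le (coeffAt T e k θ) ^ 2
      ≤ ∑ k ∈ s, 5 * (‖θ.2.2 k‖ ^ 2
        + ‖vol T (mulExp T (-freq T (e k)) θ.1) (one T)‖ ^ 2
        + ‖pair T hT.le (mulExp T (-freq T (e k)) θ.1) (one T)‖ ^ 2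
        + ‖vol T (mulExp T (freq T (e k)) θ.2.1) (one T)‖ ^ 2
        + ‖pair T hT.le (mulExp T (freq T (e k)) θ.2.1) (one T)‖ ^ 2) :=
        Finset.sum_le_sum fun k _ => e1 _ _ _ _ _
    _ ≤ 5 * (‖θ‖ ^ 2 + T ^ 2 * ‖θ‖ ^ 2 + T * ‖θ‖ ^ 2 + T ^ 2 * ‖θ‖ ^ 2 + T * ‖θ‖ ^ 2) := by
        rw [← Finset.mul_sum]
        simp only [Finset.sum_add_distrib]
        have := mul_le_mul_of_nonneg_left q1 hT2
        have := mul_le_mul_of_nonneg_left q1 hT.le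
        have := mul_le_mul_of_nonneg_left q2 hT2
        have := mul_le_mul_of_nonneg_left q2 hT.le
        linarith
    _ = _ := by ring

/-- The Volterra operators of all systems. -/
noncomputable def seqVolBlock (e : ℤ ≃ ℤ) : SeqCoeff T →L[ℂ]
    lp (fun _ : ℤ => Potential T × Potential T) 2 →L[ℂ]
      lp (fun _ : ℤ => Potential T × Potential T) 2 :=
  diagonal (fun k => volBlock T ∘L coeffAt T e k) ‖volBlock T‖ (by positivity) fun k θ =>
    ((volBlock T).le_opNorm _).trans
      (mul_le_mul_of_nonneg_left (norm_coeffAt_le T e k θ) (by positivity))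

theorem seqVolBlock_apply (e : ℤ ≃ ℤ) (θ : SeqCoeff T)
    (x : lp (fun _ : ℤ => Potential T × Potential T) 2) (k : ℤ) :
    seqVolBlock T e θ x k = volBlock T (coeffAt T e k θ) (x k) := rfl

/-- The endpoint functionals of all systems. -/
noncomputable def seqEndBlock (hT : 0 ≤ T) (e : ℤ ≃ ℤ) : SeqCoeff T →L[ℂ]
    lp (fun _ : ℤ => Potential T × Potential T) 2 →L[ℂ] lp (fun _ : ℤ => ℂ × ℂ) 2 :=
  diagonal (fun k => endBlock T hT ∘L coeffAt T e k) ‖endBlock T hT‖ (by positivity) fun k θ =>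
    ((endBlock T hT).le_opNorm _).trans
      (mul_le_mul_of_nonneg_left (norm_coeffAt_le T e k θ) (by positivity))

theorem exists_seqForce (hT : 0 < T) (e : ℤ ≃ ℤ) :
    ∃ (f : SeqCoeff T →L[ℂ] lp (fun _ : ℤ => Potential T × Potential T) 2)
      (g : SeqCoeff T →L[ℂ] lp (fun _ : ℤ => ℂ × ℂ) 2),
      (∀ θ k, f θ k = volBlock T (coeffAt T e k θ) (initial T)) ∧
      ∀ θ k, g θ k = endBlock T hT.le (coeffAt T e k θ) (initial T) := by
  obtain ⟨C, hC, hsize⟩ := exists_sum_sq_size_le T hT e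
  obtain ⟨C', hC', hb⟩ := exists_norm_block_initial_le T hT.le
  have key : ∀ (θ : SeqCoeff T) (s : Finset ℤ) (a : ℤ → ℝ), (∀ k, 0 ≤ a k) →
      (∀ k, a k ≤ C' * size T hT.le (coeffAt T e k θ)) →
      ∑ k ∈ s, a k ^ 2 ≤ (C' * C * ‖θ‖) ^ 2 := by
    intro θ s a ha0 ha
    calc ∑ k ∈ s, a k ^ 2 ≤ ∑ k ∈ s, (C' * size T hT.le (coeffAt T e k θ)) ^ 2 := by
          refine Finset.sum_le_sum fun k _ => ?_
          have := ha0 k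
          have := ha k
          gcongr
      _ = C' ^ 2 * ∑ k ∈ s, size T hT.le (coeffAt T e k θ) ^ 2 := by
          rw [Finset.mul_sum]; simp only [mul_pow]
      _ ≤ C' ^ 2 * (C * ‖θ‖) ^ 2 := by gcongr; exact hsize θ s
      _ = _ := by ring
  exact ⟨summableFamily (fun k => (volBlock T).flip (initial T) ∘L coeffAt T e k) (C' * C)
      (by positivity) (fun θ s => key θ s _ (fun _ => norm_nonneg _) fun k => (hb _).1),
    summableFamily (fun k => (endBlock T hT.le).flip (initial T) ∘L coeffAt T e k) (C' * C)
      (by positivity) (fun θ s => key θ s _ (fun _ => norm_nonneg _) fun k => (hb _).2),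
    fun _ _ => rfl, fun _ _ => rfl⟩

theorem seqVolBlock_pow_apply (e : ℤ ≃ ℤ) (θ : SeqCoeff T) (n : ℕ)
    (x : lp (fun _ : ℤ => Potential T × Potential T) 2) (k : ℤ) :
    (seqVolBlock T e θ ^ n) x k = (volBlock T (coeffAt T e k θ) ^ n) (x k) := by
  induction n with
  | zero => rfl
  | succ n ih =>
    rw [pow_succ', pow_succ', mul_apply_eq_comp, mul_apply_eq_comp, seqVolBlock_apply, ih]

theorem isUnit_one_sub_seqVolBlock (hT : 0 ≤ T) (e : ℤ ≃ ℤ) (θ : SeqCoeff T) :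
    IsUnit (1 - seqVolBlock T e θ) := by
  obtain ⟨n, hn⟩ := exists_norm_volBlock_pow_le T hT ‖θ‖
  refine isUnit_one_sub_of_norm_pow_lt (n := n) (lt_of_le_of_lt ?_ (by norm_num : (1 / 2 : ℝ) < 1))
  refine ContinuousLinearMap.opNorm_le_bound _ (by norm_num) fun x => ?_
  refine lp_norm_le (by positivity) fun s => ?_
  rw [mul_pow]
  refine le_trans ?_ (mul_le_mul_of_nonneg_left (lp_sum_sq_le x s) (by positivity))
  rw [Finset.mul_sum]
  refine Finset.sum_le_sum fun k _ => ?_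
  rw [← mul_pow, seqVolBlock_pow_apply]
  refine pow_le_pow_left₀ (norm_nonneg _) ((ContinuousLinearMap.le_opNorm _ _).trans ?_) 2
  exact mul_le_mul_of_nonneg_right (hn _ (norm_coeffAt_le T e k θ)) (norm_nonneg _)

/-- The endpoints of the solutions at all vacuum frequencies depend smoothly on the coefficients,
as a square-summable sequence. Their first variation is the one at the zero potential, up to a
family of functionals with square-summable norms. -/
theorem exists_seqEndDeviation (hT : 0 < T) (e : ℤ ≃ ℤ) :
    ∃ G : SeqCoeff T → lp (fun _ : ℤ => ℂ × ℂ) 2, ContDiff ℂ ∞ G ∧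
      (∀ θ k, G θ k = endDeviation T hT.le (coeffAt T e k θ)) ∧
      ∀ θ, ∃ c : ℤ → ℝ, (∀ k, 0 ≤ c k) ∧ (Summable fun k => c k ^ 2) ∧ ∀ k δ,
        ‖fderiv ℂ G θ δ k - endBlock T hT.le (coeffAt T e k δ) (initial T)‖ ≤ c k * ‖δ‖ := by
  obtain ⟨f, g, hf, hg⟩ := exists_seqForce T hT e
  set W : SeqCoeff T → lp (fun _ : ℤ => Potential T × Potential T) 2 := fun θ =>
    Ring.inverse (1 - seqVolBlock T e θ) (f θ) with hW
  have hWeq : ∀ θ, W θ = seqVolBlock T e θ (W θ) + f θ := by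
    intro θ
    have h := Ring.mul_inverse_cancel _ (isUnit_one_sub_seqVolBlock T hT.le e θ)
    have h1 := congrArg (fun A => A (f θ)) h
    simp only [mul_apply_eq_comp, one_apply_eq_self] at h1
    change (1 - seqVolBlock T e θ) (W θ) = _ at h1
    rw [sub_apply, one_apply_eq_self] at h1
    rw [← h1]
    abel
  have hWdev : ∀ θ k, W θ k = deviation T (coeffAt T e k θ) := by
    intro θ k
    refine eq_deviation T hT.le _ ?_
    have h := congrArg (fun x => x k) (hWeq θ)
    change W θ k = volBlock T (coeffAt T e k θ) (W θ k) + f θ k at h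
    rw [hf] at h
    exact h
  have hWsmooth : ContDiff ℂ ∞ W := by
    rw [contDiff_iff_contDiffAt]
    intro θ
    have h1 : ContDiffAt ℂ ∞ (fun θ => Ring.inverse (1 - seqVolBlock T e θ)) θ := by
      have := contDiffAt_ringInverse ℂ (n := ∞) (isUnit_one_sub_seqVolBlock T hT.le e θ).unit
      exact this.comp θ (contDiffAt_const.sub (seqVolBlock T e).contDiff.contDiffAt)
    exact h1.clm_apply f.contDiff.contDiffAt
  refine ⟨fun θ => g θ + seqEndBlock T hT.le e θ (W θ), ?_, ?_, ?_⟩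
  · exact g.contDiff.add ((seqEndBlock T hT.le e).contDiff.clm_apply hWsmooth)
  · intro θ k
    change g θ k + endBlock T hT.le (coeffAt T e k θ) (W θ k) = _
    rw [hg, hWdev, endDeviation, map_add]
  · intro θ
    obtain ⟨C, hC, hvar⟩ := exists_norm_variation_le T hT.le ‖θ‖
    obtain ⟨C', hC', hsize⟩ := exists_sum_sq_size_le T hT e
    refine ⟨fun k => C * size T hT.le (coeffAt T e k θ),
      fun k => mul_nonneg hC (size_nonneg _ _ _), ?_, fun k δ => ?_⟩
    · simp only [mul_pow]
      exact (summable_of_sum_le (fun _ => by positivity) (hsize θ)).mul_left _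
    · have hdW : HasFDerivAt W (fderiv ℂ W θ) θ :=
        (hWsmooth.differentiable (by simp)).differentiableAt.hasFDerivAt
      have hv : HasFDerivAt (fun θ => seqVolBlock T e θ)
          (seqVolBlock T e) θ :=
        (seqVolBlock T e).hasFDerivAt
      have hE : HasFDerivAt (fun θ => seqEndBlock T hT.le e θ)
          (seqEndBlock T hT.le e) θ :=
        (seqEndBlock T hT.le e).hasFDerivAt
      have h1 := (hv.clm_apply hdW).add f.hasFDerivAt
      have h2 : HasFDerivAt W _ θ := h1.congr_of_eventuallyEq (Eventually.of_forall hWeq)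
      have h3 := congrArg (fun L => L δ k) (hdW.unique h2)
      have h4 := (g.hasFDerivAt (x := θ)).add (hE.clm_apply hdW)
      have h5 : fderiv ℂ (fun θ => g θ + seqEndBlock T hT.le e θ (W θ)) θ = _ :=
        h4.fderiv
      rw [h5]
      change fderiv ℂ W θ δ k = (volBlock T (coeffAt T e k θ) (fderiv ℂ W θ δ k)
        + volBlock T (coeffAt T e k δ) (W θ k)) + f δ k at h3
      change ‖(g δ k + (endBlock T hT.le (coeffAt T e k θ) (fderiv ℂ W θ δ k)
        + endBlock T hT.le (coeffAt T e k δ) (W θ k)))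
        - endBlock T hT.le (coeffAt T e k δ) (initial T)‖ ≤ _
      rw [hWdev, hf] at h3
      have h6 := hvar (coeffAt T e k θ) (coeffAt T e k δ) (norm_coeffAt_le T e k θ)
        (fderiv ℂ W θ δ k) (by
          conv_lhs => rw [h3]
          rw [map_add]
          abel)
      rw [hg, hWdev]
      refine le_trans (le_of_eq ?_) (h6.trans ?_)
      · congr 1
        rw [map_add]
        abel
      · have := norm_coeffAt_le T e k δ
        have := size_nonneg T hT.le (coeffAt T e k θ)
        gcongr

/-- The endpoint of the solution is a holomorphic function of the coefficients. -/
theorem contDiff_endDeviation (hT : 0 ≤ T) : ContDiff ℂ ∞ (endDeviation T hT) := by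
  have h1 : ContDiff ℂ ∞ (deviation T) := by
    rw [contDiff_iff_contDiffAt]
    intro θ
    have h1 : ContDiffAt ℂ ∞ (fun θ => Ring.inverse (1 - volBlock T θ)) θ := by
      have := contDiffAt_ringInverse ℂ (n := ∞) (isUnit_one_sub_volBlock T hT θ).unit
      exact this.comp θ (contDiffAt_const.sub (volBlock T).contDiff.contDiffAt)
    exact h1.clm_apply ((volBlock T).contDiff.contDiffAt.clm_apply contDiffAt_const)
  exact (endBlock T hT).contDiff.clm_apply (contDiff_const.add h1)

end SequenceSystem


/-! ### The zero equation and the perturbed Fourier coefficients as smooth maps -/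

section SequenceMaps

variable (T : ℝ)

theorem I_mul_vacuumZero (k : ℤ) : Complex.I * vacuumZero T k = freq T k := by
  unfold vacuumZero freq
  ring

theorem exp_half_freq (hT : T ≠ 0) (k : ℤ) :
    Complex.exp (freq T k / 2 * T) = (-1) ^ k ∧ Complex.exp (-(freq T k / 2) * T) = (-1) ^ k := by
  have hT' : (T : ℂ) ≠ 0 := by exact_mod_cast hT
  have h1 : freq T k / 2 * T = k * (Real.pi * Complex.I) := by
    unfold freq
    field_simp
  have h2 : Complex.exp (freq T k / 2 * T) = (-1) ^ k := by
    rw [h1, Complex.exp_int_mul, Complex.exp_pi_mul_I]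
  refine ⟨h2, ?_⟩
  rw [neg_mul, Complex.exp_neg, h2, ← inv_zpow]
  norm_num

/-- The coefficients of the first rows of the frames at `lam_{k,0} + μ_k`, up to a gauge
transformation. -/
noncomputable def firstRowSeq : Potential T × lp (fun _ : ℤ => ℂ) 2 →L[ℝ] SeqCoeff T :=
  ((-(1 / 2 : ℂ) • (conjL T : Potential T →L[ℝ] Potential T)) ∘L
      ContinuousLinearMap.fst ℝ _ _).prod
    ((((1 / 2 : ℂ) • ContinuousLinearMap.id ℝ (Potential T)) ∘L
        ContinuousLinearMap.fst ℝ _ _).prod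
      (((Complex.I / 2) • ContinuousLinearMap.id ℝ (lp (fun _ : ℤ => ℂ) 2)) ∘L
        ContinuousLinearMap.snd ℝ _ _))

/-- The coefficients of the second rows of the frames at `lam_{k,0} + μ_k`, up to a gauge
transformation. -/
noncomputable def secondRowSeq : Potential T × lp (fun _ : ℤ => ℂ) 2 →L[ℝ] SeqCoeff T :=
  (((1 / 2 : ℂ) • ContinuousLinearMap.id ℝ (Potential T)) ∘L
      ContinuousLinearMap.fst ℝ _ _).prod
    (((-(1 / 2 : ℂ) • (conjL T : Potential T →L[ℝ] Potential T)) ∘L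
        ContinuousLinearMap.fst ℝ _ _).prod
      ((-(Complex.I / 2) • ContinuousLinearMap.id ℝ (lp (fun _ : ℤ => ℂ) 2)) ∘L
        ContinuousLinearMap.snd ℝ _ _))

theorem coeffAt_firstRowSeq (x : Potential T × lp (fun _ : ℤ => ℂ) 2) (k : ℤ) :
    coeffAt T (Equiv.refl ℤ) k (firstRowSeq T x)
      = gauge T (freq T k / 2) (firstRow T x.1 (vacuumZero T k + x.2 k)) := by
  refine Prod.ext ?_ (Prod.ext ?_ ?_)
  · change mulExp T (-freq T k) (-(1 / 2 : ℂ) • conjL T x.1)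
      = mulExp T (-(2 * (freq T k / 2))) (-(1 / 2 : ℂ) • conjL T x.1)
    congr 2
    ring
  · change mulExp T (freq T k) ((1 / 2 : ℂ) • x.1)
      = mulExp T (2 * (freq T k / 2)) ((1 / 2 : ℂ) • x.1)
    congr 2
    ring
  · change Complex.I / 2 * x.2 k
      = Complex.I * (vacuumZero T k + x.2 k) / 2 - freq T k / 2
    rw [← I_mul_vacuumZero]
    ring

theorem coeffAt_secondRowSeq (x : Potential T × lp (fun _ : ℤ => ℂ) 2) (k : ℤ) :
    coeffAt T (Equiv.neg ℤ) k (secondRowSeq T x)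
      = gauge T (-(freq T k / 2)) (secondRow T x.1 (vacuumZero T k + x.2 k)) := by
  refine Prod.ext ?_ (Prod.ext ?_ ?_)
  · change mulExp T (-freq T (-k)) ((1 / 2 : ℂ) • x.1)
      = mulExp T (-(2 * -(freq T k / 2))) ((1 / 2 : ℂ) • x.1)
    congr 2
    rw [freq_neg]
    ring
  · change mulExp T (freq T (-k)) (-(1 / 2 : ℂ) • conjL T x.1)
      = mulExp T (2 * -(freq T k / 2)) (-(1 / 2 : ℂ) • conjL T x.1)
    congr 2
    rw [freq_neg]
    ring
  · change -(Complex.I / 2) * x.2 k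
      = -(Complex.I * (vacuumZero T k + x.2 k) / 2) - -(freq T k / 2)
    rw [← I_mul_vacuumZero]
    ring

/-- A linear functional applied to all entries of a square-summable sequence. -/
noncomputable def entrywise {ι E F : Type*} [NormedAddCommGroup E] [NormedSpace ℂ E]
    [NormedAddCommGroup F] [NormedSpace ℂ F] (L : E →L[ℂ] F) :
    lp (fun _ : ι => E) 2 →L[ℂ] lp (fun _ : ι => F) 2 :=
  summableFamily (fun i => L ∘L lp.evalCLM ℂ (fun _ : ι => E) 2 i) ‖L‖ (norm_nonneg L) (by
    intro θ s
    rw [mul_pow]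
    refine le_trans ?_ (mul_le_mul_of_nonneg_left (lp_sum_sq_le θ s) (by positivity))
    rw [Finset.mul_sum]
    refine Finset.sum_le_sum fun i _ => ?_
    rw [← mul_pow]
    exact pow_le_pow_left₀ (norm_nonneg _) (L.le_opNorm _) 2)

theorem endBlock_initial (hT : 0 ≤ T) (θ : Coeff T) :
    endBlock T hT θ (initial T) = (θ.2.2 * T, pair T hT θ.2.1 (one T)) := by
  have h : pair T hT (one T) (one T) = T := by
    rw [pair_one_apply]
    have : ∫ s in (0 : ℝ)..T, one T s = ∫ s in (0 : ℝ)..T, (1 : ℂ) :=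
      primitive_congr (one_ae T) ⟨hT, le_rfl⟩
    rw [this]
    simp
  rw [block_apply, initial]
  simp [h]

/-- The functions `(-1)^k (a - d)` and `2 (-1)^k b` at the points `lam_{k,0} + μ_k`, as square-
summable sequences that depend smoothly on the potential and on the square-summable sequence `μ`.
Up to functionals with square-summable norms, their derivatives are the ones at `q = 0`, `μ = 0`:
multiplication of `μ` by `i T`, and the Fourier transform of the potential. -/
theorem exists_sequenceMaps (hT : 0 < T) :
    ∃ A Z : Potential T × lp (fun _ : ℤ => ℂ) 2 → lp (fun _ : ℤ => ℂ) 2,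
      ContDiff ℝ ∞ A ∧ ContDiff ℝ ∞ Z ∧
      (∀ q μ k, A (q, μ) k = (-1) ^ k * diagDiff T q (vacuumZero T k + μ k)) ∧
      (∀ q μ k, Z (q, μ) k = 2 * (-1) ^ k * monodromy T q (vacuumZero T k + μ k) 0 1) ∧
      ∀ x, ∃ c : ℤ → ℝ, (∀ k, 0 ≤ c k) ∧ (Summable fun k => c k ^ 2) ∧ ∀ k δ,
        ‖fderiv ℝ A x δ k - Complex.I * T * δ.2 k‖ ≤ c k * ‖δ‖ ∧
        ‖fderiv ℝ Z x δ k - potentialFourierCoeff T δ.1 k‖ ≤ c k * ‖δ‖ := by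
  obtain ⟨G, hG, hGk, hGd⟩ := exists_seqEndDeviation T hT (Equiv.refl ℤ)
  obtain ⟨G', hG', hGk', hGd'⟩ := exists_seqEndDeviation T hT (Equiv.neg ℤ)
  have sG : ContDiff ℝ ∞ G := hG.restrict_scalars ℝ
  have sG' : ContDiff ℝ ∞ G' := hG'.restrict_scalars ℝ
  have s1 : ContDiff ℝ ∞ fun x => G (firstRowSeq T x) := sG.comp (firstRowSeq T).contDiff
  have s2 : ContDiff ℝ ∞ fun x => G' (secondRowSeq T x) := sG'.comp (secondRowSeq T).contDiff
  set p₁ : lp (fun _ : ℤ => ℂ × ℂ) 2 →L[ℝ] lp (fun _ : ℤ => ℂ) 2 :=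
    (entrywise (ContinuousLinearMap.fst ℂ ℂ ℂ)).restrictScalars ℝ with hp₁
  set p₂ : lp (fun _ : ℤ => ℂ × ℂ) 2 →L[ℝ] lp (fun _ : ℤ => ℂ) 2 :=
    (entrywise ((2 : ℂ) • ContinuousLinearMap.snd ℂ ℂ ℂ)).restrictScalars ℝ with hp₂
  have d1 : ∀ x, HasFDerivAt (fun x => G (firstRowSeq T x))
      (((fderiv ℂ G (firstRowSeq T x)).restrictScalars ℝ) ∘L firstRowSeq T) x := fun x =>
    (((hG.differentiable (by simp)).differentiableAt.hasFDerivAt).restrictScalars ℝ).comp x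
      (firstRowSeq T).hasFDerivAt
  have d2 : ∀ x, HasFDerivAt (fun x => G' (secondRowSeq T x))
      (((fderiv ℂ G' (secondRowSeq T x)).restrictScalars ℝ) ∘L secondRowSeq T) x := fun x =>
    (((hG'.differentiable (by simp)).differentiableAt.hasFDerivAt).restrictScalars ℝ).comp x
      (secondRowSeq T).hasFDerivAt
  refine ⟨fun x => p₁ (G (firstRowSeq T x)) - p₁ (G' (secondRowSeq T x)),
    fun x => p₂ (G (firstRowSeq T x)), (p₁.contDiff.comp s1).sub (p₁.contDiff.comp s2),
    p₂.contDiff.comp s1, fun q μ k => ?_, fun q μ k => ?_, fun x => ?_⟩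
  · change (G (firstRowSeq T (q, μ)) k).1 - (G' (secondRowSeq T (q, μ)) k).1 = _
    obtain ⟨m1, m2, m3⟩ := monodromy_apply hT.le q (vacuumZero T k + μ k)
    have g1 := (endDeviation_gauge hT.le (freq T k / 2)
      (firstRow T q (vacuumZero T k + μ k))).1
    have g2 := (endDeviation_gauge hT.le (-(freq T k / 2))
      (secondRow T q (vacuumZero T k + μ k))).1
    rw [neg_neg, (exp_half_freq T hT.ne' k).1] at g2
    rw [(exp_half_freq T hT.ne' k).2] at g1
    rw [hGk, hGk', coeffAt_firstRowSeq, coeffAt_secondRowSeq, diagDiff, m1, m3, mul_sub, ← g1,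
      ← g2]
    ring
  · change 2 * (G (firstRowSeq T (q, μ)) k).2 = _
    obtain ⟨m1, m2, m3⟩ := monodromy_apply hT.le q (vacuumZero T k + μ k)
    have g1 := (endDeviation_gauge hT.le (freq T k / 2)
      (firstRow T q (vacuumZero T k + μ k))).2
    rw [(exp_half_freq T hT.ne' k).1] at g1
    rw [hGk, coeffAt_firstRowSeq, g1, m2]
    ring
  · obtain ⟨c, hc0, hc, hcb⟩ := hGd (firstRowSeq T x)
    obtain ⟨c', hc0', hc', hcb'⟩ := hGd' (secondRowSeq T x)
    have n1 := (firstRowSeq T).le_opNorm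
    have n2 := (secondRowSeq T).le_opNorm
    refine ⟨fun k => 2 * ‖firstRowSeq T‖ * c k + ‖secondRowSeq T‖ * c' k, fun k => ?_, ?_,
      fun k δ => ?_⟩
    · have := hc0 k
      have := hc0' k
      positivity
    · refine Summable.of_nonneg_of_le (fun k => by positivity) (fun k => ?_)
        ((hc.mul_left (2 * (2 * ‖firstRowSeq T‖) ^ 2)).add
          (hc'.mul_left (2 * ‖secondRowSeq T‖ ^ 2)))
      nlinarith [sq_nonneg (2 * ‖firstRowSeq T‖ * c k - ‖secondRowSeq T‖ * c' k)]
    · have b1 := hcb k (firstRowSeq T δ)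
      have b2 := hcb' k (secondRowSeq T δ)
      rw [endBlock_initial] at b1 b2
      have b1' : ‖fderiv ℂ G (firstRowSeq T x) (firstRowSeq T δ) k
          - (Complex.I / 2 * δ.2 k * T, 1 / 2 * potentialFourierCoeff T δ.1 k)‖
          ≤ c k * (‖firstRowSeq T‖ * ‖δ‖) := by
        refine le_trans (le_of_eq ?_) (b1.trans
          (mul_le_mul_of_nonneg_left (n1 δ) (hc0 k)))
        rw [← potentialFourierCoeff_smul_complex, ← pair_mulExp_one T hT.le]
        rfl
      have b2' : ‖fderiv ℂ G' (secondRowSeq T x) (secondRowSeq T δ) k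
          - (-(Complex.I / 2) * δ.2 k * T, pair T hT.le (coeffAt T (Equiv.neg ℤ) k
            (secondRowSeq T δ)).2.1 (one T))‖ ≤ c' k * (‖secondRowSeq T‖ * ‖δ‖) :=
        b2.trans (mul_le_mul_of_nonneg_left (n2 δ) (hc0' k))
      have f1 := (norm_fst_le _).trans b1'
      have f2 := (norm_snd_le _).trans b1'
      have f3 := (norm_fst_le _).trans b2'
      rw [Prod.fst_sub] at f1 f3
      rw [Prod.snd_sub] at f2
      have p1 : 0 ≤ c k * (‖firstRowSeq T‖ * ‖δ‖) := mul_nonneg (hc0 k) (by positivity)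
      have p2 : 0 ≤ c' k * (‖secondRowSeq T‖ * ‖δ‖) := mul_nonneg (hc0' k) (by positivity)
      have e1 := ((p₁.hasFDerivAt.comp x (d1 x)).sub (p₁.hasFDerivAt.comp x (d2 x))).fderiv
      have e2 := (p₂.hasFDerivAt.comp x (d1 x)).fderiv
      constructor
      · have : fderiv ℝ (fun x => p₁ (G (firstRowSeq T x)) - p₁ (G' (secondRowSeq T x))) x δ k
            = (fderiv ℂ G (firstRowSeq T x) (firstRowSeq T δ) k).1
              - (fderiv ℂ G' (secondRowSeq T x) (secondRowSeq T δ) k).1 :=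
          congrArg (fun L => L δ k) e1
        rw [this]
        have e3 : ∀ u v m : ℂ, u - v - Complex.I * T * m
            = (u - Complex.I / 2 * m * T) - (v - -(Complex.I / 2) * m * T) := by
          intro u v m; ring
        rw [e3]
        refine (norm_sub_le _ _).trans ?_
        nlinarith
      · have : fderiv ℝ (fun x => p₂ (G (firstRowSeq T x))) x δ k
            = 2 * (fderiv ℂ G (firstRowSeq T x) (firstRowSeq T δ) k).2 :=
          congrArg (fun L => L δ k) e2
        rw [this]
        have e3 : ∀ u m : ℂ, 2 * u - m = 2 * (u - 1 / 2 * m) := by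
          intro u m; ring
        rw [e3, norm_mul, Complex.norm_ofNat]
        nlinarith

end SequenceMaps


/-! ### Asymptotics of the monodromy for large spectral parameters -/

section Asymptotics

variable {T : ℝ}

theorem IsRow.eq_exp_mul {θ : Coeff T} {u v : ℝ → ℂ} (h : IsRow T θ u v) {t : ℝ}
    (ht : t ∈ Set.Icc (0 : ℝ) T) :
    u t = Complex.exp (θ.2.2 * t)
        * (1 + ∫ s in (0 : ℝ)..t, Complex.exp (-θ.2.2 * s) * (θ.1 s * v s)) ∧
      v t = Complex.exp (-θ.2.2 * t)
        * ∫ s in (0 : ℝ)..t, Complex.exp (θ.2.2 * s) * (θ.2.1 s * u s) := by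
  have h1 := (h.gauge θ.2.2).fst_eq t ht
  have h2 := (h.gauge θ.2.2).snd_eq t ht
  have e1 : ∫ s in (0 : ℝ)..t,
      ((PerturbedFourier.gauge T θ.2.2 θ).2.2 * (Complex.exp (-θ.2.2 * s) * u s)
      + (PerturbedFourier.gauge T θ.2.2 θ).1 s * (Complex.exp (θ.2.2 * s) * v s))
      = ∫ s in (0 : ℝ)..t, Complex.exp (-θ.2.2 * s) * (θ.1 s * v s) := by
    refine primitive_congr ?_ ht
    filter_upwards [mulExp_ae (-(2 * θ.2.2)) θ.1] with s hs
    change (θ.2.2 - θ.2.2) * _ + mulExp T (-(2 * θ.2.2)) θ.1 s * _ = _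
    have : Complex.exp (-θ.2.2 * s) = Complex.exp (-(2 * θ.2.2) * s) * Complex.exp (θ.2.2 * s) := by
      rw [← Complex.exp_add]
      congr 1
      ring
    rw [hs, this, sub_self]
    ring
  have e2 : ∫ s in (0 : ℝ)..t,
      ((PerturbedFourier.gauge T θ.2.2 θ).2.1 s * (Complex.exp (-θ.2.2 * s) * u s)
      - (PerturbedFourier.gauge T θ.2.2 θ).2.2 * (Complex.exp (θ.2.2 * s) * v s))
      = ∫ s in (0 : ℝ)..t, Complex.exp (θ.2.2 * s) * (θ.2.1 s * u s) := by
    refine primitive_congr ?_ ht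
    filter_upwards [mulExp_ae (2 * θ.2.2) θ.2.1] with s hs
    change mulExp T (2 * θ.2.2) θ.2.1 s * _ - (θ.2.2 - θ.2.2) * _ = _
    have : Complex.exp (θ.2.2 * s) = Complex.exp (2 * θ.2.2 * s) * Complex.exp (-θ.2.2 * s) := by
      rw [← Complex.exp_add]
      congr 1
      ring
    rw [hs, this, sub_self]
    ring
  rw [e1] at h1
  rw [e2] at h2
  have e3 : Complex.exp (θ.2.2 * t) * Complex.exp (-θ.2.2 * t) = 1 := by
    rw [← Complex.exp_add]
    simp
  constructor
  · rw [← h1, ← mul_assoc, e3, one_mul]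
  · rw [← h2, ← mul_assoc, mul_comm (Complex.exp _), e3, one_mul]

/-- An exponentially weighted Cauchy–Schwarz estimate. The extra weight `exp (c t)` makes the
integral operator small, however large `ν` is. -/
theorem norm_exp_mul_primitive_le (p : Potential T) {f : ℝ → ℂ}
    (hf : ContinuousOn f (Set.Icc 0 T)) {ν : ℂ} {ρ c m M : ℝ} (hν : |ν.re| ≤ ρ) (hc : 0 < c)
    (hp : ‖p‖ ≤ m) (hM : 0 ≤ M) (hfM : ∀ t ∈ Set.Icc 0 T, ‖f t‖ ≤ M * Real.exp ((ρ + c) * t))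
    {t : ℝ} (ht : t ∈ Set.Icc (0 : ℝ) T) :
    ‖Complex.exp (ν * t) * ∫ s in (0 : ℝ)..t, Complex.exp (-ν * s) * (p s * f s)‖
      ≤ m / √(2 * c) * M * Real.exp ((ρ + c) * t) := by
  have hT : 0 ≤ T := ht.1.trans ht.2
  have hg : ContinuousOn (fun s : ℝ => Complex.exp (ν * (t - s)) * f s) (Set.Icc 0 T) :=
    ((by fun_prop : Continuous fun s : ℝ => Complex.exp (ν * (t - s))).continuousOn).mul hf
  have e1 : Complex.exp (ν * t) * ∫ s in (0 : ℝ)..t, Complex.exp (-ν * s) * (p s * f s)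
      = ∫ s in (0 : ℝ)..t, p s * (Complex.exp (ν * (t - s)) * f s) := by
    rw [← intervalIntegral.integral_const_mul]
    congr 1
    ext s
    rw [mul_sub, sub_eq_add_neg, Complex.exp_add, neg_mul]
    ring
  have h1 := norm_primitive_mul_sq_le (Lp.memLp p) (memLp_of_continuousOn hg) ht
  have h2 : ∫ s in (0 : ℝ)..t, ‖Complex.exp (ν * (t - s)) * f s‖ ^ 2
      ≤ ∫ s in (0 : ℝ)..t, M ^ 2 * Real.exp (2 * ρ * t) * Real.exp (2 * c * s) := by
    refine intervalIntegral.integral_mono_on ht.1 ?_ ?_ fun s hs => ?_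
    · exact intervalIntegrable_of_integrable (integrable_sq_norm (memLp_of_continuousOn hg))
        ⟨le_rfl, hT⟩ ht
    · exact (by fun_prop : Continuous fun s : ℝ =>
        M ^ 2 * Real.exp (2 * ρ * t) * Real.exp (2 * c * s)).intervalIntegrable _ _
    · have h3 : ‖Complex.exp (ν * (t - s))‖ ≤ Real.exp (ρ * (t - s)) := by
        rw [Complex.norm_exp, Real.exp_le_exp, ← Complex.ofReal_sub, Complex.re_mul_ofReal]
        have := sub_nonneg.mpr hs.2
        have := (le_abs_self _).trans hν
        gcongr
      have h4 : ‖Complex.exp (ν * (t - s)) * f s‖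
          ≤ Real.exp (ρ * (t - s)) * (M * Real.exp ((ρ + c) * s)) := by
        rw [norm_mul]
        have := hfM s ⟨hs.1, hs.2.trans ht.2⟩
        gcongr
      refine (pow_le_pow_left₀ (norm_nonneg _) h4 2).trans (le_of_eq ?_)
      rw [show Real.exp (ρ * (t - s)) * (M * Real.exp ((ρ + c) * s))
        = M * (Real.exp (ρ * (t - s)) * Real.exp ((ρ + c) * s)) by ring, ← Real.exp_add, mul_pow,
        ← Real.exp_nat_mul, mul_assoc, ← Real.exp_add]
      congr 2
      push_cast
      ring
  have h3 : ∫ s in (0 : ℝ)..t, M ^ 2 * Real.exp (2 * ρ * t) * Real.exp (2 * c * s)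
      ≤ M ^ 2 * Real.exp (2 * ρ * t) * (Real.exp (2 * c * t) / (2 * c)) := by
    rw [intervalIntegral.integral_const_mul, intervalIntegral.integral_comp_mul_left
      (fun x => Real.exp x) (by positivity), integral_exp, mul_zero, Real.exp_zero, smul_eq_mul,
      inv_mul_eq_div]
    gcongr
    linarith
  rw [e1]
  refine le_of_sq_le_sq (h1.trans ?_) (by
    have := (norm_nonneg p).trans hp
    positivity)
  have h5 : ∫ s in (0 : ℝ)..t, ‖p s‖ ^ 2 ≤ m ^ 2 :=
    (primitive_sq_le T hT p ht).trans (pow_le_pow_left₀ (norm_nonneg _) hp 2)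
  calc _ ≤ m ^ 2 * (M ^ 2 * Real.exp (2 * ρ * t) * (Real.exp (2 * c * t) / (2 * c))) := by
        refine mul_le_mul h5 (h2.trans h3) ?_ (sq_nonneg m)
        exact intervalIntegral.integral_nonneg ht.1 fun s _ => by positivity
    _ = _ := by
        rw [mul_pow, mul_pow, div_pow, Real.sq_sqrt (by positivity), ← Real.exp_nat_mul,
          show ((2 : ℕ) : ℝ) * ((ρ + c) * t) = 2 * ρ * t + 2 * c * t by push_cast; ring,
          Real.exp_add]
        field_simp

/-- If `u` solves the system, then `u(T) - exp (ν T)` is controlled by the first Picard iterate of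
the other component. -/
theorem IsRow.norm_end_sub_exp_le (hT : 0 ≤ T) {θ : Coeff T} {u v : ℝ → ℂ} (h : IsRow T θ u v)
    {m Z : ℝ} (hm : 0 < m) (hp : ‖θ.1‖ ≤ m) (hr : ‖θ.2.1‖ ≤ m)
    (hZ : ∀ t ∈ Set.Icc 0 T, ‖Complex.exp (-θ.2.2 * t)
      * ∫ s in (0 : ℝ)..t, Complex.exp (2 * θ.2.2 * s) * θ.2.1 s‖
        ≤ Z * Real.exp (|θ.2.2.re| * t)) :
    ‖u T - Complex.exp (θ.2.2 * T)‖ ≤ Z * Real.exp ((|θ.2.2.re| + 2 * m ^ 2) * T) := by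
  set ν := θ.2.2 with hνdef
  set ρ := |ν.re| with hρ
  set c := 2 * m ^ 2 with hcdef
  have hc : 0 < c := by positivity
  have hκ : m / √(2 * c) = 1 / 2 := by
    rw [hcdef, show 2 * (2 * m ^ 2) = (2 * m) ^ 2 by ring, Real.sqrt_sq (by positivity)]
    field_simp
  have hexp : ContinuousOn (fun t : ℝ => Complex.exp (ν * t)) (Set.Icc 0 T) :=
    (by fun_prop : Continuous fun t : ℝ => Complex.exp (ν * t)).continuousOn
  set y : ℝ → ℂ := fun t => u t - Complex.exp (ν * t) with hy
  have hyc : ContinuousOn y (Set.Icc 0 T) := h.continuousOn_fst.sub hexp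
  obtain ⟨t₁, ht₁, hmax⟩ := isCompact_Icc.exists_isMaxOn (Set.nonempty_Icc.mpr hT)
    ((h.continuousOn_snd.norm).mul
      (by fun_prop : Continuous fun t : ℝ => Real.exp (-((ρ + c) * t))).continuousOn)
  set V : ℝ := ‖v t₁‖ * Real.exp (-((ρ + c) * t₁)) with hV
  have hV0 : 0 ≤ V := by positivity
  have hvV : ∀ t ∈ Set.Icc 0 T, ‖v t‖ ≤ V * Real.exp ((ρ + c) * t) := by
    intro t ht
    have h1 : ‖v t‖ * Real.exp (-((ρ + c) * t)) ≤ V := hmax ht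
    rwa [Real.exp_neg, ← div_eq_mul_inv, div_le_iff₀ (Real.exp_pos _)] at h1
  have hyV : ∀ t ∈ Set.Icc 0 T, ‖y t‖ ≤ 1 / 2 * V * Real.exp ((ρ + c) * t) := by
    intro t ht
    have h1 := norm_exp_mul_primitive_le θ.1 h.continuousOn_snd (le_refl ρ) hc hp hV0 hvV ht
    rw [hκ] at h1
    refine le_trans (le_of_eq ?_) h1
    rw [hy]
    simp only
    rw [(h.eq_exp_mul ht).1, mul_add, mul_one, add_sub_cancel_left]
  have hvZ : ∀ t ∈ Set.Icc 0 T,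
      ‖v t‖ ≤ Z * Real.exp (ρ * t) + 1 / 2 * (1 / 2 * V) * Real.exp ((ρ + c) * t) := by
    intro t ht
    have h1 := norm_exp_mul_primitive_le θ.2.1 hyc (ν := -ν) (ρ := ρ)
      (by rw [Complex.neg_re, abs_neg]) hc hr (by positivity) hyV ht
    rw [hκ, neg_neg] at h1
    refine le_trans ?_ ((norm_add_le _ _).trans (add_le_add (hZ t ht) h1))
    rw [(h.eq_exp_mul ht).2, ← mul_add, ← hνdef, ← intervalIntegral.integral_add]
    · refine le_of_eq ?_
      congr 3
      ext s
      rw [hy, show 2 * ν * (s : ℂ) = ν * s + ν * s by ring, Complex.exp_add]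
      ring
    · refine intervalIntegrable_of_integrable (integrable_mul_of_memLp
        (memLp_of_continuousOn ?_) (Lp.memLp _)) ⟨le_rfl, hT⟩ ht
      exact (by fun_prop : Continuous fun t : ℝ => Complex.exp (2 * ν * t)).continuousOn
    · have : (fun s : ℝ => Complex.exp (ν * s) * (θ.2.1 s * y s))
          = fun s : ℝ => θ.2.1 s * (Complex.exp (ν * s) * y s) := by
        ext s; ring
      rw [this]
      exact intervalIntegrable_of_integrable (integrable_mul_of_memLp
        (Lp.memLp _) (memLp_of_continuousOn (hexp.mul hyc))) ⟨le_rfl, hT⟩ ht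
  have hZ0 : 0 ≤ Z := by
    have h1 := (norm_nonneg _).trans (hZ 0 ⟨le_rfl, hT⟩)
    simpa using h1
  have hVZ : V ≤ Z + 1 / 2 * (1 / 2 * V) := by
    have h1 := hvZ t₁ ht₁
    have h2 : Z * Real.exp (ρ * t₁) ≤ Z * Real.exp ((ρ + c) * t₁) := by
      have := ht₁.1
      gcongr
      linarith
    have h3 : ‖v t₁‖ = V * Real.exp ((ρ + c) * t₁) := by
      rw [hV, mul_assoc, ← Real.exp_add, neg_add_cancel, Real.exp_zero, mul_one]
    refine le_of_mul_le_mul_right ?_ (Real.exp_pos ((ρ + c) * t₁))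
    linarith
  have h1 := hyV T ⟨hT, le_rfl⟩
  refine h1.trans ?_
  gcongr
  linarith

/-- A Riemann–Lebesgue lemma, uniform in a neighbourhood of the potential and up to the endpoint,
for complex frequencies. -/
theorem exists_eventually_norm_exp_mul_primitive_le (hT : 0 < T) (r₀ : Potential T) {ε : ℝ}
    (hε : 0 < ε) : ∃ R : ℝ, ∀ᶠ r in 𝓝 r₀, ∀ ν : ℂ, R ≤ ‖ν‖ → ∀ t ∈ Set.Icc 0 T,
      ‖Complex.exp (-ν * t) * ∫ s in (0 : ℝ)..t, Complex.exp (2 * ν * s) * r s‖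
        ≤ ε * Real.exp (|ν.re| * t) := by
  set L : Potential T → ℂ → ℝ → ℂ := fun r ν t =>
    Complex.exp (-ν * t) * ∫ s in (0 : ℝ)..t, Complex.exp (2 * ν * s) * r s with hL
  have hint : ∀ (r : Potential T) (ν : ℂ) {t : ℝ}, t ∈ Set.Icc 0 T →
      IntervalIntegrable (fun s : ℝ => Complex.exp (2 * ν * s) * r s) volume 0 t := fun r ν t ht =>
    intervalIntegrable_of_integrable (integrable_mul_of_memLp (memLp_of_continuousOn
      (by fun_prop : Continuous fun t : ℝ => Complex.exp (2 * ν * t)).continuousOn)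
      (Lp.memLp _)) ⟨le_rfl, hT.le⟩ ht
  have hadd : ∀ (r r' : Potential T) (ν : ℂ) {t : ℝ}, t ∈ Set.Icc 0 T →
      L (r + r') ν t = L r ν t + L r' ν t := by
    intro r r' ν t ht
    rw [hL]
    simp only
    rw [← mul_add, ← intervalIntegral.integral_add (hint r ν ht) (hint r' ν ht)]
    congr 1
    refine primitive_congr ?_ ht
    filter_upwards [Lp.coeFn_add r r'] with s hs
    rw [hs, Pi.add_apply, mul_add]
  have hbound : ∀ (r : Potential T) (ν : ℂ) {t : ℝ}, t ∈ Set.Icc 0 T →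
      ‖L r ν t‖ ≤ √T * ‖r‖ * Real.exp (|ν.re| * t) := by
    intro r ν t ht
    have hg : ContinuousOn (fun s : ℝ => Complex.exp (ν * (2 * s - t))) (Set.Icc 0 T) :=
      (by fun_prop : Continuous fun s : ℝ => Complex.exp (ν * (2 * s - t))).continuousOn
    have e1 : L r ν t = ∫ s in (0 : ℝ)..t, r s * Complex.exp (ν * (2 * s - t)) := by
      rw [hL]
      simp only
      rw [← intervalIntegral.integral_const_mul]
      congr 1
      ext s
      rw [show ν * (2 * s - t) = -ν * t + 2 * ν * s by ring, Complex.exp_add]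
      ring
    have h1 := norm_primitive_mul_sq_le (Lp.memLp r) (memLp_of_continuousOn hg) ht
    have h2 : ∫ s in (0 : ℝ)..t, ‖Complex.exp (ν * (2 * s - t))‖ ^ 2
        ≤ ∫ s in (0 : ℝ)..t, Real.exp (|ν.re| * t) ^ 2 := by
      refine intervalIntegral.integral_mono_on ht.1 ?_ (by simp) fun s hs => ?_
      · exact (by fun_prop : Continuous fun s : ℝ =>
          ‖Complex.exp (ν * (2 * s - t))‖ ^ 2).intervalIntegrable _ _
      · refine pow_le_pow_left₀ (norm_nonneg _) ?_ 2
        rw [Complex.norm_exp, Real.exp_le_exp,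
          show (2 * (s : ℂ) - t) = ((2 * s - t : ℝ) : ℂ) by push_cast; ring, Complex.re_mul_ofReal]
        refine (le_abs_self _).trans ?_
        rw [abs_mul]
        gcongr
        rw [abs_le]
        constructor <;> linarith [hs.1, hs.2]
    rw [e1]
    refine le_of_sq_le_sq (h1.trans ?_) (by positivity)
    calc _ ≤ ‖r‖ ^ 2 * (T * Real.exp (|ν.re| * t) ^ 2) := by
          refine mul_le_mul (primitive_sq_le T hT.le r ht) (h2.trans ?_) ?_ (by positivity)
          · rw [intervalIntegral.integral_const, sub_zero, smul_eq_mul]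
            have := ht.2
            gcongr
          · exact intervalIntegral.integral_nonneg ht.1 fun s _ => by positivity
      _ = _ := by
          rw [mul_pow, mul_pow, Real.sq_sqrt hT.le]
          ring
  -- For trigonometric polynomials the integral can be evaluated.
  have hsum : ∀ (s : Finset ℤ) (f : ℤ → ℂ), ∀ η : ℝ, 0 < η → ∃ R : ℝ, ∀ ν : ℂ, R ≤ ‖ν‖ →
      ∀ t ∈ Set.Icc 0 T, ‖L (∑ k ∈ s, f k • mulExp T (freq T k) (one T)) ν t‖
        ≤ η * Real.exp (|ν.re| * t) := by
    classical
    intro s f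
    induction s using Finset.induction_on with
    | empty =>
      intro η hη
      refine ⟨0, fun ν _ t ht => ?_⟩
      have := hbound 0 ν ht
      rw [norm_zero, mul_zero, zero_mul] at this
      rw [Finset.sum_empty]
      exact this.trans (by positivity)
    | insert k s hk ih =>
      intro η hη
      obtain ⟨R, hR⟩ := ih (η / 2) (by positivity)
      refine ⟨max R (‖freq T k‖ + 4 * ‖f k‖ / η + 1), fun ν hν t ht => ?_⟩
      rw [Finset.sum_insert hk, hadd _ _ _ ht]
      have h1 := hR ν ((le_max_left _ _).trans hν) t ht
      have hν' := (le_max_right _ _).trans hν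
      have h4 : 0 ≤ 4 * ‖f k‖ / η := by positivity
      have h2 : 4 * ‖f k‖ / η + 1 ≤ ‖2 * ν + freq T k‖ := by
        have := norm_sub_le (2 * ν + freq T k) (freq T k)
        rw [add_sub_cancel_right, norm_mul, Complex.norm_ofNat] at this
        have := norm_nonneg ν
        linarith
      have h3 : 2 * ν + freq T k ≠ 0 := by
        rw [← norm_pos_iff]
        linarith
      have e1 : L (f k • mulExp T (freq T k) (one T)) ν t = f k / (2 * ν + freq T k)
          * (Complex.exp (ν * t) * Complex.exp (freq T k * t) - Complex.exp (-ν * t)) := by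
        have e2 : ∫ s in (0 : ℝ)..t, Complex.exp (2 * ν * s)
            * (f k • mulExp T (freq T k) (one T) : Potential T) s
            = ∫ s in (0 : ℝ)..t, f k * Complex.exp ((2 * ν + freq T k) * s) := by
          refine primitive_congr ?_ ht
          filter_upwards [smul_ae (f k) (mulExp T (freq T k) (one T)),
            mulExp_ae (freq T k) (one T), one_ae T] with s s1 s2 s3
          rw [s1, s2, s3, add_mul, Complex.exp_add]
          ring
        rw [hL]
        simp only
        rw [e2, intervalIntegral.integral_const_mul, integral_exp_mul_complex h3,
          Complex.ofReal_zero, mul_zero, Complex.exp_zero, show (2 * ν + freq T k) * t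
          = ν * t + ν * t + freq T k * t by ring, Complex.exp_add, Complex.exp_add, neg_mul,
          Complex.exp_neg]
        have := Complex.exp_ne_zero (ν * t)
        field_simp
      have e3 : ‖Complex.exp (freq T k * t)‖ = 1 := by
        rw [Complex.norm_exp, Complex.re_mul_ofReal, freq_re, zero_mul, Real.exp_zero]
      have e4 : ∀ z : ℂ, |z.re| = |ν.re| → ‖Complex.exp (z * t)‖ ≤ Real.exp (|ν.re| * t) := by
        intro z hz
        rw [Complex.norm_exp, Complex.re_mul_ofReal, Real.exp_le_exp, ← hz]
        exact mul_le_mul_of_nonneg_right (le_abs_self _) ht.1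
      have e5 : ‖Complex.exp (ν * t) * Complex.exp (freq T k * t) - Complex.exp (-ν * t)‖
          ≤ 2 * Real.exp (|ν.re| * t) := by
        refine (norm_sub_le _ _).trans ?_
        rw [norm_mul, e3, mul_one]
        linarith [e4 ν rfl, e4 (-ν) (by rw [Complex.neg_re, abs_neg])]
      have e6 : ‖f k / (2 * ν + freq T k)‖ ≤ η / 4 := by
        rw [norm_div, div_le_iff₀ (norm_pos_iff.mpr h3)]
        have : η / 4 * (4 * ‖f k‖ / η + 1) ≤ η / 4 * ‖2 * ν + freq T k‖ := by gcongr
        have e7 : η / 4 * (4 * ‖f k‖ / η + 1) = ‖f k‖ + η / 4 := by field_simp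
        linarith
      have e8 : ‖L (f k • mulExp T (freq T k) (one T)) ν t‖
          ≤ η / 4 * (2 * Real.exp (|ν.re| * t)) := by
        rw [e1, norm_mul]
        gcongr
      refine (norm_add_le _ _).trans ?_
      linarith
  -- Trigonometric polynomials are dense, as the Fourier transform is an isometry onto `ℓ²`.
  obtain ⟨s, f, hsf⟩ : ∃ (s : Finset ℤ) (f : ℤ → ℂ),
      √T * ‖r₀ - ∑ k ∈ s, f k • mulExp T (freq T k) (one T)‖ < ε / 4 := by
    have h1 := lp.hasSum_single (p := 2) (by norm_num) (fourierL T hT r₀)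
    have h2 := (Metric.tendsto_atTop.mp h1) (ε / 4) (by positivity)
    obtain ⟨s, hs⟩ := h2
    have hT' : (T : ℂ) ≠ 0 := by exact_mod_cast hT.ne'
    have h3 : ∀ k (z : ℂ), fourierL T hT ((z / T) • mulExp T (freq T (-k)) (one T))
        = lp.single 2 k z := by
      intro k z
      ext j
      rw [map_smul, lp.coeFn_smul, Pi.smul_apply, fourierL_apply, ← pair_mulExp_one T hT.le,
        pair_one_apply, primitive_mulExp T _ _ ⟨hT.le, le_rfl⟩]
      have e1 : ∫ s in (0 : ℝ)..T, Complex.exp (freq T j * s) * mulExp T (freq T (-k)) (one T) s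
          = ∫ s in (0 : ℝ)..T, Complex.exp (freq T (j - k) * s) := by
        refine primitive_congr ?_ ⟨hT.le, le_rfl⟩
        filter_upwards [mulExp_ae (freq T (-k)) (one T), one_ae T] with s s2 s3
        rw [s2, s3, mul_one, ← Complex.exp_add]
        congr 1
        unfold freq
        push_cast
        ring
      rw [e1, integral_exp_freq T hT, lp.single_apply]
      by_cases hjk : j = k
      · subst hjk
        simp [hT']
      · simp [hjk, sub_eq_zero]
    refine ⟨s.map (Equiv.neg ℤ).toEmbedding, fun k => fourierL T hT r₀ (-k) / T, ?_⟩
    have h4 := hs s le_rfl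
    rw [Finset.sum_map, ← norm_fourierL T hT, map_sub, map_sum, ← dist_eq_norm, dist_comm]
    simp only [Equiv.coe_toEmbedding, Equiv.neg_apply, neg_neg, h3]
    exact h4
  obtain ⟨R, hR⟩ := hsum s f (ε / 2) (by positivity)
  have hnear : ∀ᶠ r in 𝓝 r₀, √T * ‖r - r₀‖ < ε / 4 := by
    have : Continuous fun r : Potential T => √T * ‖r - r₀‖ := by fun_prop
    refine (this.tendsto r₀).eventually (gt_mem_nhds ?_)
    simpa using hε
  refine ⟨R, ?_⟩
  filter_upwards [hnear] with r hr ν hν t ht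
  set P := ∑ k ∈ s, f k • mulExp T (freq T k) (one T)
  have h1 : r = (r - P) + P := by abel
  have h2 : √T * ‖r - P‖ ≤ ε / 2 := by
    have : ‖r - P‖ ≤ ‖r - r₀‖ + ‖r₀ - P‖ := norm_sub_le_norm_sub_add_norm_sub _ _ _
    have := mul_le_mul_of_nonneg_left this (Real.sqrt_nonneg T)
    linarith
  change ‖L r ν t‖ ≤ _
  rw [h1, hadd _ _ _ ht]
  refine (norm_add_le _ _).trans ?_
  have h3 := hbound (r - P) ν ht
  have h4 := hR ν hν t ht
  have h5 : √T * ‖r - P‖ * Real.exp (|ν.re| * t) ≤ ε / 2 * Real.exp (|ν.re| * t) := by gcongr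
  linarith

/-- Locally uniformly in the potential, `a - d` is asymptotic to `2 i sin (lam T / 2)`, relative to
the growth of the latter. -/
theorem exists_eventually_norm_diagDiff_sub_le (hT : 0 < T) (q₀ : Potential T) {ε : ℝ}
    (hε : 0 < ε) : ∃ R : ℝ, ∀ᶠ q in 𝓝 q₀, ∀ lam : ℂ, R ≤ ‖lam‖ →
      ‖diagDiff T q lam - 2 * Complex.I * Complex.sin (lam * T / 2)‖
        ≤ ε * Real.exp (|lam.im| * T / 2) := by
  set C := ‖conjL T‖ with hC
  set m : ℝ := (1 + C) * (‖q₀‖ + 1) with hm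
  have hC0 : 0 ≤ C := norm_nonneg _
  have hm0 : 0 < m := by positivity
  set ε' := ε / 2 * Real.exp (-(2 * m ^ 2 * T)) with hε'
  have hε'0 : 0 < ε' := by positivity
  obtain ⟨R₁, h1⟩ := exists_eventually_norm_exp_mul_primitive_le hT ((1 / 2 : ℂ) • q₀) hε'0
  obtain ⟨R₂, h2⟩ := exists_eventually_norm_exp_mul_primitive_le hT
    (-(1 / 2 : ℂ) • conjL T q₀) hε'0
  have c1 : Continuous fun q : Potential T => (1 / 2 : ℂ) • q := continuous_const_smul _
  have c2 : Continuous fun q : Potential T => -(1 / 2 : ℂ) • conjL T q :=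
    Continuous.const_smul (conjL T).continuous (-(1 / 2 : ℂ))
  have hnear : ∀ᶠ q in 𝓝 q₀, ‖q‖ < ‖q₀‖ + 1 :=
    (continuous_norm.tendsto q₀).eventually (gt_mem_nhds (by linarith))
  refine ⟨2 * max R₁ R₂, ?_⟩
  filter_upwards [(c1.tendsto q₀).eventually h1, (c2.tendsto q₀).eventually h2, hnear] with
    q k1 k2 hq lam hlam
  have nν : ‖Complex.I * lam / 2‖ = ‖lam‖ / 2 := by simp
  have rν : |(Complex.I * lam / 2).re| = |lam.im| / 2 := by
    have : (Complex.I * lam / 2).re = -lam.im / 2 := by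
      rw [show Complex.I * lam / 2 = ((1 / 2 : ℝ) : ℂ) * (Complex.I * lam) by push_cast; ring,
        Complex.re_ofReal_mul, Complex.I_mul_re]
      ring
    rw [this, abs_div, abs_neg, abs_two]
  have hm1 : ‖(1 / 2 : ℂ) • q‖ ≤ m := by
    rw [norm_smul, hm]
    have : ‖(1 / 2 : ℂ)‖ = 1 / 2 := by simp
    rw [this]
    have := norm_nonneg q
    nlinarith [norm_nonneg q₀]
  have hm2 : ‖-(1 / 2 : ℂ) • conjL T q‖ ≤ m := by
    rw [norm_smul, hm]
    have : ‖-(1 / 2 : ℂ)‖ = 1 / 2 := by simp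
    rw [this]
    have h3 := (conjL T).le_opNorm q
    have h4 : C * ‖q‖ ≤ C * (‖q₀‖ + 1) := by gcongr
    have := norm_nonneg (conjL T q)
    nlinarith [norm_nonneg q₀]
  have hR1 : R₁ ≤ ‖Complex.I * lam / 2‖ := by
    rw [nν]; linarith [le_max_left R₁ R₂]
  have hR2 : R₂ ≤ ‖-(Complex.I * lam / 2)‖ := by
    rw [norm_neg, nν]; linarith [le_max_right R₁ R₂]
  obtain ⟨u, v, hrow⟩ := exists_isRow hT.le (firstRow T q lam)
  obtain ⟨u', v', hrow'⟩ := exists_isRow hT.le (secondRow T q lam)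
  have b1 := hrow.norm_end_sub_exp_le hT.le hm0 hm2 hm1 (k1 _ hR1)
  have b2 := hrow'.norm_end_sub_exp_le hT.le hm0 hm1 hm2 (k2 _ hR2)
  obtain ⟨m1, -, m3⟩ := monodromy_apply hT.le q lam
  rw [(hrow.end_eq hT.le).1, ← m1] at b1
  rw [(hrow'.end_eq hT.le).1, ← m3] at b2
  change ‖monodromy T q lam 0 0 - Complex.exp (Complex.I * lam / 2 * T)‖
    ≤ ε' * Real.exp ((|(Complex.I * lam / 2).re| + 2 * m ^ 2) * T) at b1
  change ‖monodromy T q lam 1 1 - Complex.exp (-(Complex.I * lam / 2) * T)‖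
    ≤ ε' * Real.exp ((|(-(Complex.I * lam / 2)).re| + 2 * m ^ 2) * T) at b2
  rw [Complex.neg_re, abs_neg] at b2
  have e1 : ε' * Real.exp ((|(Complex.I * lam / 2).re| + 2 * m ^ 2) * T)
      = ε / 2 * Real.exp (|lam.im| * T / 2) := by
    rw [rν, hε', mul_assoc, ← Real.exp_add]
    congr 2
    ring
  rw [e1] at b1 b2
  have e2 : 2 * Complex.I * Complex.sin (lam * T / 2)
      = Complex.exp (Complex.I * lam / 2 * T) - Complex.exp (-(Complex.I * lam / 2) * T) := by
    rw [Complex.sin, show Complex.I * lam / 2 * T = lam * T / 2 * Complex.I by ring,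
      show -(Complex.I * lam / 2) * T = -(lam * T / 2) * Complex.I by ring]
    have := Complex.I_sq
    linear_combination (Complex.exp (-(lam * T / 2) * Complex.I)
      - Complex.exp (lam * T / 2 * Complex.I)) * this
  rw [e2, diagDiff, show ∀ a b c d : ℂ, a - b - (c - d) = (a - c) - (b - d) by intros; ring]
  refine (norm_sub_le _ _).trans ?_
  linarith

/-- The function `a - d` is entire. -/
theorem differentiable_diagDiff (hT : 0 ≤ T) (q : Potential T) :
    Differentiable ℂ (diagDiff T q) := by
  have h : Differentiable ℂ (endDeviation T hT) :=
    (contDiff_endDeviation T hT).differentiable (by simp)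
  have h1 : Differentiable ℂ fun lam => firstRow T q lam := by
    unfold firstRow
    fun_prop
  have h2 : Differentiable ℂ fun lam => secondRow T q lam := by
    unfold secondRow
    fun_prop
  have e : diagDiff T q = fun lam => (endDeviation T hT (firstRow T q lam)).1
      - (endDeviation T hT (secondRow T q lam)).1 := by
    ext lam
    obtain ⟨m1, -, m3⟩ := monodromy_apply hT q lam
    rw [diagDiff, m1, m3]
    ring
  rw [e]
  exact ((h.comp h1).fst).sub ((h.comp h2).fst)

end Asymptotics


/-! ### Rouché's theorem -/

section Rouche

/-- Division of an entire function by the largest power of `z - w`. -/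
theorem exists_eq_pow_mul_of_analyticOrderAt_eq {w : ℂ} (n : ℕ) : ∀ {f : ℂ → ℂ},
    Differentiable ℂ f → analyticOrderAt f w = n →
      ∃ g : ℂ → ℂ, Differentiable ℂ g ∧ g w ≠ 0 ∧ ∀ z, f z = (z - w) ^ n * g z := by
  induction n with
  | zero =>
    intro f hf hn
    refine ⟨f, hf, ?_, fun z => by simp⟩
    exact ((hf.analyticAt w).analyticOrderAt_eq_zero).mp hn
  | succ n ih =>
    intro f hf hn
    have hfw : f w = 0 := apply_eq_zero_of_analyticOrderAt_ne_zero (by rw [hn]; simp)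
    have hd : Differentiable ℂ (dslope f w) := by
      rw [← differentiableOn_univ] at hf ⊢
      exact (Complex.differentiableOn_dslope univ_mem).mpr hf
    have hfd : ∀ z, f z = (z - w) * dslope f w z := by
      intro z
      have := sub_smul_dslope f w z
      rw [smul_eq_mul, hfw, sub_zero] at this
      exact this.symm
    have ho : analyticOrderAt f w = 1 + analyticOrderAt (dslope f w) w := by
      have h1 : f = (· - w) * dslope f w := funext hfd
      conv_lhs => rw [h1]
      rw [analyticOrderAt_mul (by fun_prop) (hd.analyticAt w), analyticOrderAt_id_sub_const_self]
    rw [hn, Nat.cast_add, Nat.cast_one, add_comm] at ho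
    obtain ⟨g, hg, hgw, hfg⟩ := ih hd (ENat.add_right_injective_of_ne_top ENat.one_ne_top ho.symm)
    exact ⟨g, hg, hgw, fun z => by rw [hfd, hfg, pow_succ']; ring⟩

theorem analyticOrderAt_ne_top_of_differentiable {f : ℂ → ℂ} (hf : Differentiable ℂ f) {z₀ : ℂ}
    (h0 : f z₀ ≠ 0) (w : ℂ) : analyticOrderAt f w ≠ ⊤ := by
  have han : AnalyticOnNhd ℂ f Set.univ := fun z _ => hf.analyticAt z
  refine han.analyticOrderAt_ne_top_of_isPreconnected isPreconnected_univ (Set.mem_univ z₀)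
    (Set.mem_univ w) ?_
  rw [((hf.analyticAt z₀).analyticOrderAt_eq_zero).mpr h0]
  simp

/-- The zeros of a nonzero entire function in a compact set can be divided out. -/
theorem exists_eq_prod_mul {f : ℂ → ℂ} (hf : Differentiable ℂ f) {z₀ : ℂ} (h0 : f z₀ ≠ 0)
    {K : Set ℂ} (hK : IsCompact K) : ∃ (S : Multiset ℂ) (g : ℂ → ℂ), Differentiable ℂ g ∧
      (∀ w ∈ S, w ∈ K ∧ f w = 0) ∧ (∀ z ∈ K, g z ≠ 0) ∧
        ∀ z, f z = (S.map (z - ·)).prod * g z := by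
  have han : AnalyticOnNhd ℂ f Set.univ := fun z _ => hf.analyticAt z
  have hfin : {z | z ∈ K ∧ f z = 0}.Finite := by
    by_contra hinf
    obtain ⟨x, -, hx⟩ := Set.Infinite.exists_accPt_of_subset_isCompact hinf hK fun z hz => hz.1
    rw [accPt_iff_frequently_nhdsNE] at hx
    have := han.eq_of_frequently_eq (g := fun _ => 0) (fun _ _ => analyticAt_const)
      (hx.mono fun z hz => hz.2)
    exact h0 (congrFun this z₀)
  have key : ∀ Z : Finset ℂ, (∀ w ∈ Z, w ∈ K ∧ f w = 0) → ∃ (S : Multiset ℂ) (g : ℂ → ℂ),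
      Differentiable ℂ g ∧ (∀ w ∈ S, w ∈ K ∧ f w = 0) ∧ (∀ z ∈ Z, g z ≠ 0) ∧
        ∀ z, f z = (S.map (z - ·)).prod * g z := by
    classical
    intro Z
    induction Z using Finset.induction_on with
    | empty => exact fun _ => ⟨0, f, hf, by simp, by simp, by simp⟩
    | insert w Z hw ih =>
      intro hZ
      obtain ⟨S, g, hg, hS, hgZ, hfg⟩ := ih fun z hz => hZ z (Finset.mem_insert_of_mem hz)
      have hg0 : g z₀ ≠ 0 := fun h => h0 (by rw [hfg, h, mul_zero])
      obtain ⟨n, hn⟩ := ENat.ne_top_iff_exists.mp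
        (analyticOrderAt_ne_top_of_differentiable hg hg0 w)
      obtain ⟨k, hk, hkw, hgk⟩ := exists_eq_pow_mul_of_analyticOrderAt_eq n hg hn.symm
      refine ⟨S + Multiset.replicate n w, k, hk, fun z hz => ?_, fun z hz => ?_, fun z => ?_⟩
      · rcases Multiset.mem_add.mp hz with hz | hz
        · exact hS z hz
        · rw [Multiset.eq_of_mem_replicate hz]
          exact hZ w (Finset.mem_insert_self w Z)
      · rcases Finset.mem_insert.mp hz with rfl | hz
        · exact hkw
        · exact fun h => hgZ z hz (by rw [hgk, h, mul_zero])
      · rw [hfg, hgk, Multiset.map_add, Multiset.prod_add, Multiset.map_replicate,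
          Multiset.prod_replicate, mul_assoc]
  obtain ⟨S, g, hg, hS, hgZ, hfg⟩ := key hfin.toFinset fun w hw => by simpa using hw
  refine ⟨S, g, hg, hS, fun z hz hgz => ?_, hfg⟩
  have hfz : f z = 0 := by rw [hfg, hgz, mul_zero]
  exact hgZ z (by simpa using ⟨hz, hfz⟩) hgz

theorem differentiable_prod_sub (S : Multiset ℂ) :
    Differentiable ℂ fun z => (S.map (z - ·)).prod := by
  induction S using Multiset.induction_on with
  | empty => simp
  | cons a S ih =>
    simp only [Multiset.map_cons, Multiset.prod_cons]
    fun_prop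

theorem analyticOrderAt_prod_sub (S : Multiset ℂ) (w : ℂ) :
    analyticOrderAt (fun z => (S.map (z - ·)).prod) w = S.count w := by
  induction S using Multiset.induction_on with
  | empty =>
    refine (((differentiable_prod_sub 0).analyticAt w).analyticOrderAt_eq_zero).mpr ?_
    simp
  | cons a S ih =>
    have h1 : (fun z : ℂ => ((a ::ₘ S).map (z - ·)).prod)
        = (· - a) * fun z => (S.map (z - ·)).prod := by
      ext z
      simp
    rw [h1, analyticOrderAt_mul (by fun_prop) ((differentiable_prod_sub S).analyticAt w), ih,
      Multiset.count_cons]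
    by_cases h : w = a
    · rw [h, analyticOrderAt_id_sub_const_self, if_pos rfl, Nat.cast_add, Nat.cast_one, add_comm]
    · rw [analyticOrderAt_id_sub_const_of_ne h, if_neg h, zero_add, add_zero]

/-- The argument principle for a product of linear factors and a function without zeros. -/
theorem circleIntegral_logDeriv_prod_mul {c : ℂ} {R : ℝ} (hR : 0 < R) (S : Multiset ℂ)
    (hS : ∀ w ∈ S, w ∈ Metric.ball c R) {g : ℂ → ℂ} (hg : Differentiable ℂ g)
    (hg0 : ∀ z ∈ Metric.closedBall c R, g z ≠ 0) :
    CircleIntegrable (logDeriv fun z => (S.map (z - ·)).prod * g z) c R ∧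
    ∮ z in C(c, R), logDeriv (fun z => (S.map (z - ·)).prod * g z) z
      = 2 * Real.pi * Complex.I * S.card := by
  induction S using Multiset.induction_on with
  | empty =>
    simp only [Multiset.map_zero, Multiset.prod_zero, one_mul, Multiset.card_zero, Nat.cast_zero,
      mul_zero]
    have hd : DifferentiableOn ℂ (deriv g) Set.univ := hg.differentiableOn.deriv isOpen_univ
    rw [differentiableOn_univ] at hd
    have hc : DifferentiableOn ℂ (logDeriv g) (Metric.closedBall c R) :=
      hd.differentiableOn.div hg.differentiableOn hg0
    refine ⟨(hc.continuousOn.mono Metric.sphere_subset_closedBall).circleIntegrable hR.le, ?_⟩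
    exact Complex.circleIntegral_eq_zero_of_differentiable_on_off_countable hR.le
      Set.countable_empty hc.continuousOn fun z hz =>
        (hc z (Metric.ball_subset_closedBall hz.1)).differentiableAt
          (Metric.closedBall_mem_nhds_of_mem hz.1)
  | cons a S ih =>
    obtain ⟨i1, h1⟩ := ih fun w hw => hS w (Multiset.mem_cons_of_mem hw)
    have ha : a ∈ Metric.ball c R := hS a (Multiset.mem_cons_self a S)
    have hne : ∀ b ∈ Metric.ball c R, ∀ z ∈ Metric.sphere c R, z - b ≠ 0 := by
      intro b hb z hz h
      rw [sub_eq_zero] at h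
      rw [Metric.mem_ball] at hb
      rw [Metric.mem_sphere, h] at hz
      exact hb.ne hz
    have i2 : CircleIntegrable (fun z => (z - a)⁻¹) c R :=
      ContinuousOn.circleIntegrable hR.le
        (((by fun_prop : Continuous fun z : ℂ => z - a).continuousOn).inv₀ (hne a ha))
    have heq : Set.EqOn (logDeriv fun z => ((a ::ₘ S).map (z - ·)).prod * g z)
        (fun z => (z - a)⁻¹ + logDeriv (fun z => (S.map (z - ·)).prod * g z) z)
        (Metric.sphere c R) := by
      intro z hz
      have e1 : (fun z : ℂ => ((a ::ₘ S).map (z - ·)).prod * g z)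
          = fun z => (z - a) * ((S.map (z - ·)).prod * g z) := by
        ext z
        rw [Multiset.map_cons, Multiset.prod_cons, mul_assoc]
      have hp : (S.map (z - ·)).prod ≠ 0 := by
        rw [Ne, Multiset.prod_eq_zero_iff, Multiset.mem_map]
        rintro ⟨b, hb, hzb⟩
        exact hne b (hS b (Multiset.mem_cons_of_mem hb)) z hz hzb
      have hd : Differentiable ℂ fun z => (S.map (z - ·)).prod * g z :=
        (differentiable_prod_sub S).mul hg
      simp only
      rw [e1, logDeriv_mul (f := fun z => z - a) (g := fun z => (S.map (z - ·)).prod * g z) z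
        (hne a ha z hz) (mul_ne_zero hp (hg0 z (Metric.sphere_subset_closedBall hz)))
        (by fun_prop) hd.differentiableAt]
      congr 1
      rw [logDeriv_apply]
      simp
    refine ⟨(circleIntegrable_congr (by rwa [abs_of_pos hR])).mpr (i2.add i1), ?_⟩
    rw [circleIntegral.integral_congr hR.le heq, circleIntegral.integral_add i2 i1, h1,
      circleIntegral.integral_sub_inv_of_mem_ball ha, Multiset.card_cons]
    push_cast
    ring

/-- **Rouché's theorem** for entire functions: if `|f - g| < |g|` on a circle, then `f` and `g` have
the same number of zeros in the disk, counted with multiplicities. -/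
theorem exists_card_eq_of_norm_sub_lt {f g : ℂ → ℂ} (hf : Differentiable ℂ f)
    (hg : Differentiable ℂ g) {c : ℂ} {R : ℝ} (hR : 0 < R)
    (h : ∀ z ∈ Metric.sphere c R, ‖f z - g z‖ < ‖g z‖) :
    ∃ S S' : Multiset ℂ, S.card = S'.card ∧ (∀ w ∈ S, w ∈ Metric.ball c R) ∧
      (∀ w ∈ S', w ∈ Metric.ball c R) ∧ ∀ w ∈ Metric.ball c R,
        analyticOrderAt f w = S.count w ∧ analyticOrderAt g w = S'.count w := by
  obtain ⟨z₀, hz₀⟩ : (Metric.sphere c R).Nonempty := NormedSpace.sphere_nonempty.mpr hR.le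
  have g0 : ∀ z ∈ Metric.sphere c R, g z ≠ 0 := fun z hz =>
    norm_pos_iff.mp ((norm_nonneg _).trans_lt (h z hz))
  have f0 : ∀ z ∈ Metric.sphere c R, f z ≠ 0 := by
    intro z hz hfz
    have := h z hz
    rw [hfz, zero_sub, norm_neg] at this
    exact lt_irrefl _ this
  have hK := isCompact_closedBall c R
  obtain ⟨S, k, hk, hS, hk0, hfk⟩ := exists_eq_prod_mul hf (f0 z₀ hz₀) hK
  obtain ⟨S', k', hk', hS', hk0', hgk⟩ := exists_eq_prod_mul hg (g0 z₀ hz₀) hK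
  have hball : ∀ {φ : ℂ → ℂ} {w : ℂ}, (∀ z ∈ Metric.sphere c R, φ z ≠ 0) →
      w ∈ Metric.closedBall c R ∧ φ w = 0 → w ∈ Metric.ball c R := by
    intro φ w hφ hw
    rw [Metric.mem_ball]
    exact lt_of_le_of_ne hw.1 fun h => hφ w h hw.2
  have hSb : ∀ w ∈ S, w ∈ Metric.ball c R := fun w hw => hball f0 (hS w hw)
  have hSb' : ∀ w ∈ S', w ∈ Metric.ball c R := fun w hw => hball g0 (hS' w hw)
  have hord : ∀ {φ κ : ℂ → ℂ} (M : Multiset ℂ), Differentiable ℂ κ →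
      (∀ z ∈ Metric.closedBall c R, κ z ≠ 0) → (∀ z, φ z = (M.map (z - ·)).prod * κ z) →
      ∀ w ∈ Metric.ball c R, analyticOrderAt φ w = M.count w := by
    intro φ κ M hκ hκ0 hφ w hw
    have e1 : φ = (fun z => (M.map (z - ·)).prod) * κ := funext hφ
    rw [e1, analyticOrderAt_mul ((differentiable_prod_sub M).analyticAt w) (hκ.analyticAt w),
      analyticOrderAt_prod_sub, ((hκ.analyticAt w).analyticOrderAt_eq_zero).mpr
        (hκ0 w (Metric.ball_subset_closedBall hw)), add_zero]
  refine ⟨S, S', ?_, hSb, hSb', fun w hw =>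
    ⟨hord S hk hk0 hfk w hw, hord S' hk' hk0' hgk w hw⟩⟩
  obtain ⟨i1, n1⟩ := circleIntegral_logDeriv_prod_mul hR S hSb hk hk0
  obtain ⟨i2, n2⟩ := circleIntegral_logDeriv_prod_mul hR S' hSb' hk' hk0'
  rw [← funext hfk] at i1 n1
  rw [← funext hgk] at i2 n2
  -- On the circle, `f / g` lies in the disk of radius `1` around `1`, where `log` is holomorphic.
  have hzero : ∮ z in C(c, R), (logDeriv f z - logDeriv g z) = 0 := by
    refine circleIntegral.integral_eq_zero_of_hasDerivWithinAt
      (f := fun z => Complex.log (f z / g z))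
      hR.le fun z hz => HasDerivAt.hasDerivWithinAt ?_
    have hslit : f z / g z ∈ Complex.slitPlane := by
      have h1 : ‖(f z - g z) / g z‖ < 1 := by
        rw [norm_div, div_lt_one (norm_pos_iff.mpr (g0 z hz))]
        exact h z hz
      have h2 := Complex.mem_slitPlane_of_norm_lt_one h1
      rwa [sub_div, div_self (g0 z hz), add_sub_cancel] at h2
    have hd := ((hf z).hasDerivAt.div (hg z).hasDerivAt (g0 z hz)).clog hslit
    refine hd.congr_deriv ?_
    rw [Pi.div_apply, logDeriv_apply, logDeriv_apply]
    have := f0 z hz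
    have := g0 z hz
    field_simp
  rw [circleIntegral.integral_sub i1 i2, n1, n2, sub_eq_zero] at hzero
  have hpi : (2 * Real.pi * Complex.I : ℂ) ≠ 0 := by simp [Real.pi_ne_zero]
  exact_mod_cast mul_left_cancel₀ hpi hzero

end Rouche

/-! ### The zeros of the sine -/

section Sine

theorem norm_sq_sin (z : ℂ) :
    ‖Complex.sin z‖ ^ 2 = Real.sin z.re ^ 2 + Real.sinh z.im ^ 2 := by
  rw [← Complex.normSq_eq_norm_sq, Complex.sin_eq, Complex.normSq_apply]
  simp only [← Complex.ofReal_sin, ← Complex.ofReal_cos, ← Complex.ofReal_sinh,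
    ← Complex.ofReal_cosh, ← Complex.ofReal_mul, Complex.add_re, Complex.add_im, Complex.ofReal_re,
    Complex.ofReal_im, Complex.mul_re, Complex.mul_im, Complex.I_re, Complex.I_im]
  have h1 := Real.cosh_sq z.im
  have h2 := Real.sin_sq_add_cos_sq z.re
  linear_combination Real.sin z.re ^ 2 * h1 + Real.sinh z.im ^ 2 * h2

theorem mul_norm_le_norm_sin {z : ℂ} (hz : ‖z‖ ≤ Real.pi / 2) :
    2 / Real.pi * ‖z‖ ≤ ‖Complex.sin z‖ := by
  have hpi := Real.pi_pos
  have h1 := Real.mul_abs_le_abs_sin ((Complex.abs_re_le_norm z).trans hz)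
  have h2 : |z.im| ≤ |Real.sinh z.im| := by
    rw [Real.abs_sinh]
    exact Real.self_le_sinh_iff.mpr (abs_nonneg _)
  refine le_of_sq_le_sq ?_ (norm_nonneg _)
  have h3 : (2 / Real.pi * |z.re|) ^ 2 ≤ Real.sin z.re ^ 2 := by
    rw [← sq_abs (Real.sin z.re)]
    gcongr
  have h4 : z.im ^ 2 ≤ Real.sinh z.im ^ 2 := sq_le_sq.mpr h2
  have h5 : (2 / Real.pi) ^ 2 ≤ 1 := by
    refine pow_le_one₀ (by positivity) ?_
    rw [div_le_one hpi]
    linarith [Real.pi_gt_three]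
  rw [norm_sq_sin, mul_pow, ← Complex.normSq_eq_norm_sq, Complex.normSq_apply]
  rw [mul_pow, sq_abs] at h3
  nlinarith [sq_nonneg z.im]

/-- Away from its zeros, the sine is as large as `exp |Im z|`. -/
theorem exp_abs_im_lt_norm_sin {z : ℂ} (hz : ∀ j : ℤ, Real.pi / 2 ≤ ‖z - j * Real.pi‖) :
    Real.exp |z.im| < 4 * ‖Complex.sin z‖ := by
  have hpi := Real.pi_pos
  set j : ℤ := round (z.re / Real.pi) with hj
  set w : ℂ := z - j * Real.pi with hw
  have hre : |w.re| ≤ Real.pi / 2 := by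
    have h1 := abs_sub_round (z.re / Real.pi)
    have h2 : w.re = (z.re / Real.pi - j) * Real.pi := by
      rw [hw]
      simp
      field_simp
    rw [h2, abs_mul, abs_of_pos hpi]
    nlinarith
  have him : w.im = z.im := by simp [hw]
  have hsin : Real.sin w.re ^ 2 = Real.sin z.re ^ 2 := by
    have : w.re = z.re - j * Real.pi := by simp [hw]
    rw [this, Real.sin_sub_int_mul_pi, mul_pow, ← zpow_natCast, ← zpow_mul, mul_comm j, zpow_mul]
    norm_num
  have hnorm : Real.pi ^ 2 / 4 ≤ w.re ^ 2 + z.im ^ 2 := by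
    have h1 := hz j
    have h2 : ‖w‖ ^ 2 = w.re ^ 2 + z.im ^ 2 := by
      rw [← Complex.normSq_eq_norm_sq, Complex.normSq_apply, him]
      ring
    rw [← h2]
    have : (Real.pi / 2) ^ 2 ≤ ‖w‖ ^ 2 := by gcongr
    linarith
  have hsin' : (2 / Real.pi) ^ 2 * w.re ^ 2 ≤ Real.sin z.re ^ 2 := by
    have h1 := Real.mul_abs_le_abs_sin hre
    rw [← hsin, ← sq_abs (Real.sin w.re), ← sq_abs w.re, ← mul_pow]
    gcongr
  set E := Real.exp |z.im| with hE
  have hE0 : 0 < E := Real.exp_pos _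
  have hsinh : Real.sinh z.im ^ 2 = (E - E⁻¹) ^ 2 / 4 := by
    rw [← sq_abs (Real.sinh z.im), Real.abs_sinh, Real.sinh_eq, Real.exp_neg]
    ring
  refine lt_of_pow_lt_pow_left₀ 2 (by positivity) ?_
  rw [mul_pow, norm_sq_sin, hsinh]
  have hEE : E * E⁻¹ = 1 := mul_inv_cancel₀ hE0.ne'
  have hE1 : 1 + |z.im| ≤ E := by linarith [Real.add_one_le_exp |z.im|]
  have hEi : 0 < E⁻¹ := by positivity
  by_cases hlarge : 8 / 3 ≤ E ^ 2
  · nlinarith [sq_nonneg (Real.sin z.re), sq_nonneg E⁻¹]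
  · have h1 : 1 + 2 * |z.im| ≤ E ^ 2 := by
      rw [hE, ← Real.exp_nat_mul]
      push_cast
      linarith [Real.add_one_le_exp (2 * |z.im|)]
    have h2 : z.im ^ 2 ≤ 25 / 36 := by
      rw [← sq_abs]
      have := abs_nonneg z.im
      nlinarith
    have h3 : 25 / 36 ≤ 25 / 81 * (Real.pi ^ 2 / 4) := by nlinarith [Real.pi_gt_three]
    have h4 : 1 - 25 / 81 ≤ (2 / Real.pi) ^ 2 * w.re ^ 2 := by
      rw [div_pow, div_mul_eq_mul_div, le_div_iff₀ (by positivity)]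
      nlinarith
    nlinarith [sq_nonneg E⁻¹]

end Sine


/-! ### Counting the zeros of functions asymptotic to the sine -/

section Counting

variable {T : ℝ}

/-- The function `2 i sin (lam T / 2)`, which is `a - d` for the vacuum. -/
noncomputable def vacuumDiff (T : ℝ) (lam : ℂ) : ℂ :=
  2 * Complex.I * Complex.sin (lam * T / 2)

theorem differentiable_vacuumDiff : Differentiable ℂ (vacuumDiff T) := by
  unfold vacuumDiff
  fun_prop

theorem vacuumZero_mul (hT : 0 < T) (j : ℤ) : vacuumZero T j * T / 2 = j * Real.pi := by
  have hT' : (T : ℂ) ≠ 0 := by exact_mod_cast hT.ne'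
  unfold vacuumZero
  field_simp

theorem vacuumDiff_eq_zero_iff (hT : 0 < T) (w : ℂ) :
    vacuumDiff T w = 0 ↔ ∃ j : ℤ, vacuumZero T j = w := by
  have hT' : (T : ℂ) ≠ 0 := by exact_mod_cast hT.ne'
  have h : vacuumDiff T w = 0 ↔ Complex.sin (w * T / 2) = 0 := by
    unfold vacuumDiff
    simp
  rw [h, Complex.sin_eq_zero_iff]
  refine exists_congr fun j => ?_
  rw [← vacuumZero_mul hT j]
  constructor
  · intro h
    have h2 := mul_right_cancel₀ hT' ((div_left_inj' two_ne_zero).mp h)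
    exact h2.symm
  · rintro rfl
    rfl

theorem analyticOrderAt_vacuumDiff (hT : 0 < T) (j : ℤ) :
    analyticOrderAt (vacuumDiff T) (vacuumZero T j) = 1 := by
  have h0 : vacuumDiff T (vacuumZero T j) = 0 := (vacuumDiff_eq_zero_iff hT _).mpr ⟨j, rfl⟩
  refine (differentiable_vacuumDiff.analyticAt _).analyticOrderAt_eq_one_of_zero_deriv_ne_zero
    h0 ?_
  have h1 : HasDerivAt (vacuumDiff T)
      (2 * Complex.I * (Complex.cos (vacuumZero T j * T / 2) * (1 * T / 2))) (vacuumZero T j) :=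
    ((((hasDerivAt_id _).mul_const (T : ℂ)).div_const 2).csin).const_mul _
  rw [h1.deriv]
  have h2 : Complex.cos (vacuumZero T j * T / 2) ≠ 0 := by
    intro hc
    have hs : Complex.sin (vacuumZero T j * T / 2) = 0 := by
      unfold vacuumDiff at h0
      simpa using h0
    have := Complex.sin_sq_add_cos_sq (vacuumZero T j * T / 2)
    rw [hc, hs] at this
    norm_num at this
  have hT' : (T : ℂ) ≠ 0 := by exact_mod_cast hT.ne'
  simp [h2, hT']

theorem norm_vacuumZero (hT : 0 < T) (j : ℤ) :
    ‖vacuumZero T j‖ = 2 * |(j : ℝ)| * (Real.pi / T) := by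
  have : vacuumZero T j = ((2 * Real.pi / T * j : ℝ) : ℂ) := by
    unfold vacuumZero
    push_cast
    ring
  rw [this, Complex.norm_real, Real.norm_eq_abs, abs_mul, abs_of_pos (by positivity)]
  ring

theorem vacuumZero_sub (j k : ℤ) : vacuumZero T j - vacuumZero T k = vacuumZero T (j - k) := by
  unfold vacuumZero
  push_cast
  ring

theorem le_norm_vacuumZero_sub (hT : 0 < T) {j k : ℤ} (h : j ≠ k) :
    2 * (Real.pi / T) ≤ ‖vacuumZero T j - vacuumZero T k‖ := by
  rw [vacuumZero_sub, norm_vacuumZero hT]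
  have h1 : (1 : ℝ) ≤ |((j - k : ℤ) : ℝ)| := by
    exact_mod_cast Int.one_le_abs (sub_ne_zero.mpr h)
  have h2 : 0 < Real.pi / T := by positivity
  nlinarith

theorem vacuumZero_injective (hT : 0 < T) : Function.Injective (vacuumZero T) := by
  intro j k h
  by_contra hjk
  have h1 := le_norm_vacuumZero_sub hT hjk
  rw [h, sub_self, norm_zero] at h1
  have : 0 < Real.pi / T := by positivity
  linarith

theorem exp_lt_norm_vacuumDiff (hT : 0 < T) {lam : ℂ}
    (h : ∀ j : ℤ, Real.pi / T ≤ ‖lam - vacuumZero T j‖) :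
    1 / 2 * Real.exp (|lam.im| * T / 2) < ‖vacuumDiff T lam‖ := by
  have him : |(lam * T / 2).im| = |lam.im| * T / 2 := by
    have : lam * T / 2 = lam * ((T / 2 : ℝ) : ℂ) := by push_cast; ring
    rw [this, Complex.im_mul_ofReal, abs_mul, abs_of_pos (by positivity : 0 < T / 2)]
    ring
  have h1 : Real.exp |(lam * T / 2).im| < 4 * ‖Complex.sin (lam * T / 2)‖ := by
    refine exp_abs_im_lt_norm_sin fun j => ?_
    have h2 : lam * T / 2 - j * Real.pi = (lam - vacuumZero T j) * ((T / 2 : ℝ) : ℂ) := by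
      rw [← vacuumZero_mul hT j]
      push_cast
      ring
    rw [h2, norm_mul, Complex.norm_real, Real.norm_of_nonneg (by positivity)]
    have h3 := mul_le_mul_of_nonneg_right (h j) (by positivity : 0 ≤ T / 2)
    have h4 : Real.pi / T * (T / 2) = Real.pi / 2 := by field_simp
    linarith
  rw [him] at h1
  unfold vacuumDiff
  rw [norm_mul, norm_mul, Complex.norm_I, Complex.norm_ofNat]
  linarith

/-- An entire function within `exp (|Im lam| T / 2) / 2` of `2 i sin (lam T / 2)` for all `lam`
outside the disk of radius `(2n+1) π / T`. This is less than the modulus of `2 i sin (lam T / 2)`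
at distance at least `π / T` from its zeros. -/
structure IsNearVacuum (T : ℝ) (n : ℕ) (f : ℂ → ℂ) : Prop where
  differentiable : Differentiable ℂ f
  norm_sub_le : ∀ lam : ℂ, (2 * n + 1) * (Real.pi / T) ≤ ‖lam‖ →
    ‖f lam - vacuumDiff T lam‖ ≤ 1 / 2 * Real.exp (|lam.im| * T / 2)

theorem IsNearVacuum.norm_sub_lt {n : ℕ} {f : ℂ → ℂ} (hf : IsNearVacuum T n f) (hT : 0 < T)
    {lam : ℂ} (h1 : (2 * n + 1) * (Real.pi / T) ≤ ‖lam‖)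
    (h2 : ∀ j : ℤ, Real.pi / T ≤ ‖lam - vacuumZero T j‖) :
    ‖f lam - vacuumDiff T lam‖ < ‖vacuumDiff T lam‖ :=
  (hf.norm_sub_le lam h1).trans_lt (exp_lt_norm_vacuumDiff hT h2)

/-- By Rouché's theorem, a function close to `2 i sin (lam T / 2)` on a circle has as many zeros
inside as there are integers `j` with `lam_{j,0}` inside. -/
theorem exists_zeros_of_norm_sub_lt (hT : 0 < T) {f : ℂ → ℂ} (hf : Differentiable ℂ f) {c : ℂ}
    {R : ℝ} (hR : 0 < R)
    (h : ∀ z ∈ Metric.sphere c R, ‖f z - vacuumDiff T z‖ < ‖vacuumDiff T z‖) (J : Finset ℤ)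
    (hJ : ∀ j, vacuumZero T j ∈ Metric.ball c R ↔ j ∈ J) :
    ∃ S : Multiset ℂ, S.card = J.card ∧ (∀ w ∈ S, w ∈ Metric.ball c R) ∧
      ∀ w ∈ Metric.ball c R, analyticOrderAt f w = S.count w := by
  classical
  obtain ⟨S, S', hcard, hS, hS', hord⟩ :=
    exists_card_eq_of_norm_sub_lt hf differentiable_vacuumDiff hR h
  refine ⟨S, ?_, hS, fun w hw => (hord w hw).1⟩
  have hnodup : (J.val.map (vacuumZero T)).Nodup :=
    J.nodup.map (vacuumZero_injective hT)
  have : S' = J.val.map (vacuumZero T) := by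
    ext w
    rw [Multiset.count_eq_of_nodup hnodup]
    split_ifs with hw
    · obtain ⟨j, hj, rfl⟩ := Multiset.mem_map.mp hw
      have h1 := (hord _ ((hJ j).mpr hj)).2
      rw [analyticOrderAt_vacuumDiff hT] at h1
      exact_mod_cast h1.symm
    · by_cases hwb : w ∈ Metric.ball c R
      · have h1 := (hord w hwb).2
        rw [((differentiable_vacuumDiff.analyticAt w).analyticOrderAt_eq_zero).mpr] at h1
        · exact_mod_cast h1.symm
        · intro h0
          obtain ⟨j, rfl⟩ := (vacuumDiff_eq_zero_iff hT w).mp h0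
          exact hw (Multiset.mem_map_of_mem _ ((hJ j).mp hwb))
      · exact Multiset.count_eq_zero.mpr fun hw' => hwb (hS' w hw')
  rw [hcard, this, Multiset.card_map]
  rfl

theorem norm_lt_iff_abs_le (hT : 0 < T) (n : ℕ) (j : ℤ) :
    ‖vacuumZero T j‖ < (2 * n + 1) * (Real.pi / T) ↔ |j| ≤ n := by
  rw [norm_vacuumZero hT]
  have h2 : 0 < Real.pi / T := by positivity
  rw [mul_lt_mul_iff_left₀ h2]
  have : (2 * |(j : ℝ)| < 2 * n + 1) ↔ 2 * |j| < 2 * (n : ℤ) + 1 := by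
    rw [← Int.cast_lt (R := ℝ)]
    push_cast
    rfl
  rw [this]
  omega

theorem IsNearVacuum.exists_zeros_ball {n : ℕ} {f : ℂ → ℂ} (hf : IsNearVacuum T n f)
    (hT : 0 < T) : ∃ S : Multiset ℂ, S.card = (Finset.Icc (-n : ℤ) n).card ∧
      (∀ w ∈ S, ‖w‖ < (2 * n + 1) * (Real.pi / T)) ∧
      ∀ w, ‖w‖ < (2 * n + 1) * (Real.pi / T) → analyticOrderAt f w = S.count w := by
  have h2 : 0 < Real.pi / T := by positivity
  obtain ⟨S, h1, h3, h4⟩ := exists_zeros_of_norm_sub_lt hT hf.differentiable (c := 0)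
    (R := (2 * n + 1) * (Real.pi / T)) (by positivity) (fun z hz => by
      rw [mem_sphere_zero_iff_norm] at hz
      refine hf.norm_sub_lt hT hz.ge fun j => ?_
      have h5 := abs_norm_sub_norm_le z (vacuumZero T j)
      rw [hz, norm_vacuumZero hT, ← sub_mul, abs_mul, abs_of_pos h2] at h5
      have h6 : (1 : ℝ) ≤ abs (2 * (n : ℝ) + 1 - 2 * |(j : ℝ)|) := by
        have : (1 : ℤ) ≤ abs (2 * (n : ℤ) + 1 - 2 * |j|) := Int.one_le_abs (by omega)
        exact_mod_cast this
      nlinarith) (Finset.Icc (-n : ℤ) n) (fun j => by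
      rw [mem_ball_zero_iff, norm_lt_iff_abs_le hT, Finset.mem_Icc, abs_le])
  simp only [mem_ball_zero_iff] at h3 h4
  exact ⟨S, h1, h3, h4⟩

theorem le_norm_of_mem_closedBall (hT : 0 < T) {n : ℕ} {k : ℤ} (hk : (n : ℤ) < |k|) {w : ℂ}
    (hw : ‖w - vacuumZero T k‖ ≤ Real.pi / T) : (2 * n + 1) * (Real.pi / T) ≤ ‖w‖ := by
  have h1 := norm_sub_norm_le (vacuumZero T k) w
  rw [norm_sub_rev, norm_vacuumZero hT] at h1
  have h2 : (n : ℝ) + 1 ≤ |(k : ℝ)| := by exact_mod_cast hk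
  have h3 : 0 < Real.pi / T := by positivity
  nlinarith

theorem IsNearVacuum.exists_zero_ball {n : ℕ} {f : ℂ → ℂ} (hf : IsNearVacuum T n f)
    (hT : 0 < T) {k : ℤ} (hk : (n : ℤ) < |k|) :
    ∃ w ∈ Metric.ball (vacuumZero T k) (Real.pi / T), analyticOrderAt f w = 1 ∧
      ∀ w' ∈ Metric.ball (vacuumZero T k) (Real.pi / T), f w' = 0 → w' = w := by
  have h2 : 0 < Real.pi / T := by positivity
  obtain ⟨S, h1, h3, h4⟩ := exists_zeros_of_norm_sub_lt hT hf.differentiable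
    (c := vacuumZero T k) h2 (fun z hz => by
      rw [mem_sphere_iff_norm] at hz
      refine hf.norm_sub_lt hT (le_norm_of_mem_closedBall hT hk hz.le) fun j => ?_
      by_cases hjk : j = k
      · rw [hjk, hz]
      · have h5 := le_norm_vacuumZero_sub hT hjk
        have h6 := norm_sub_le_norm_sub_add_norm_sub (vacuumZero T j) z (vacuumZero T k)
        rw [norm_sub_rev _ z] at h6
        linarith) {k} (fun j => by
      rw [Finset.mem_singleton, mem_ball_iff_norm]
      refine ⟨fun h => ?_, fun h => by rw [h, sub_self, norm_zero]; exact h2⟩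
      by_contra hjk
      have := le_norm_vacuumZero_sub hT hjk
      linarith)
  rw [Finset.card_singleton, Multiset.card_eq_one] at h1
  obtain ⟨w, rfl⟩ := h1
  refine ⟨w, h3 w (Multiset.mem_singleton_self w), ?_, fun w' hw' hfw' => ?_⟩
  · rw [h4 w (h3 w (Multiset.mem_singleton_self w)), Multiset.count_singleton_self, Nat.cast_one]
  · by_contra hne
    have h5 := h4 w' hw'
    rw [Multiset.count_singleton, if_neg hne, Nat.cast_zero,
      (hf.differentiable.analyticAt w').analyticOrderAt_eq_zero] at h5
    exact h5 hfw'

theorem exists_map_eq_of_card_eq (S : Multiset ℂ) : ∀ J : Finset ℤ, S.card = J.card →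
    ∃ φ : ℤ → ℂ, J.val.map φ = S := by
  classical
  induction S using Multiset.induction_on with
  | empty =>
    intro J hJ
    refine ⟨fun _ => 0, ?_⟩
    rw [Multiset.card_zero, eq_comm, Finset.card_eq_zero] at hJ
    rw [hJ]
    rfl
  | cons a S ih =>
    intro J hJ
    rw [Multiset.card_cons] at hJ
    obtain ⟨j, hj⟩ : J.Nonempty := Finset.card_pos.mp (by omega)
    obtain ⟨φ, hφ⟩ := ih (J.erase j) (by rw [Finset.card_erase_of_mem hj]; omega)
    refine ⟨Function.update φ j a, ?_⟩
    rw [← Finset.insert_erase hj, Finset.insert_val_of_notMem (Finset.notMem_erase j J),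
      Multiset.map_cons, Function.update_self, ← hφ]
    congr 1
    refine Multiset.map_congr rfl fun i hi => ?_
    exact Function.update_of_ne (Finset.ne_of_mem_erase hi) _ _

/-- The zeros of a function close to `2 i sin (lam T / 2)` can be enumerated so that all but
finitely many of them have their natural labels. -/
theorem IsNearVacuum.exists_enumeration {n : ℕ} {f : ℂ → ℂ} (hf : IsNearVacuum T n f)
    (hT : 0 < T) : ∃ lam : ℤ → ℂ,
      (∀ w, analyticOrderAt f w = {k : ℤ | lam k = w}.encard) ∧
      ∀ k : ℤ, (n : ℤ) < |k| → lam k ∈ Metric.ball (vacuumZero T k) (Real.pi / T) ∧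
        ∀ w ∈ Metric.ball (vacuumZero T k) (Real.pi / T), f w = 0 → w = lam k := by
  classical
  have h2 : 0 < Real.pi / T := by positivity
  obtain ⟨S, hcard, hS, hSord⟩ := hf.exists_zeros_ball hT
  obtain ⟨φ, hφ⟩ := exists_map_eq_of_card_eq S _ hcard
  have hφS : ∀ k : ℤ, |k| ≤ n → ‖φ k‖ < (2 * n + 1) * (Real.pi / T) := by
    intro k hk
    refine hS _ ?_
    rw [← hφ]
    exact Multiset.mem_map_of_mem _ (Finset.mem_Icc.mpr (abs_le.mp hk))
  choose! ψ hψ hψ1 hψu using fun (k : ℤ) (hk : (n : ℤ) < |k|) => hf.exists_zero_ball hT hk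
  have hψn : ∀ k : ℤ, (n : ℤ) < |k| → (2 * n + 1) * (Real.pi / T) ≤ ‖ψ k‖ := fun k hk =>
    le_norm_of_mem_closedBall hT hk (mem_ball_iff_norm.mp (hψ k hk)).le
  have hl1 : ∀ k : ℤ, |k| ≤ n → (if (n : ℤ) < |k| then ψ k else φ k) = φ k := fun k hk =>
    if_neg (not_lt.mpr hk)
  have hl2 : ∀ k : ℤ, (n : ℤ) < |k| → (if (n : ℤ) < |k| then ψ k else φ k) = ψ k := fun k hk =>
    if_pos hk
  refine ⟨fun k => if (n : ℤ) < |k| then ψ k else φ k, fun w => ?_, fun k hk => ?_⟩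
  · rcases lt_or_ge ‖w‖ ((2 * n + 1) * (Real.pi / T)) with hw | hw
    · have hset : {k : ℤ | (if (n : ℤ) < |k| then ψ k else φ k) = w}
          = ((Finset.Icc (-n : ℤ) n).filter fun k => w = φ k : Finset ℤ) := by
        ext k
        rw [Set.mem_ofPred_eq, Finset.mem_coe, Finset.mem_filter, Finset.mem_Icc, ← abs_le]
        rcases le_or_gt |k| (n : ℤ) with hk | hk
        · rw [hl1 k hk, eq_comm]
          exact (and_iff_right hk).symm
        · rw [hl2 k hk]
          refine ⟨fun h => ?_, fun h => absurd h.1 (not_le.mpr hk)⟩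
          have := hψn k hk
          rw [h] at this
          exact absurd this (not_le.mpr hw)
      rw [hSord w hw, hset, Set.encard_coe_eq_coe_finsetCard, ← hφ, Multiset.count_map]
      rfl
    · have hne : ∀ k : ℤ, |k| ≤ n → φ k ≠ w := by
        intro k hk h
        have := hφS k hk
        rw [h] at this
        exact absurd hw (not_le.mpr this)
      have hψz : ∀ k : ℤ, (n : ℤ) < |k| → f (ψ k) = 0 := fun k hk =>
        apply_eq_zero_of_analyticOrderAt_ne_zero (by rw [hψ1 k hk]; exact one_ne_zero)
      by_cases hfw : f w = 0
      · obtain ⟨k, hk⟩ : ∃ k : ℤ, ‖w - vacuumZero T k‖ < Real.pi / T := by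
          by_contra! h
          have := hf.norm_sub_lt hT hw h
          rw [hfw, zero_sub, norm_neg] at this
          exact lt_irrefl _ this
        have hkn : (n : ℤ) < |k| := by
          by_contra! h
          have h3 := norm_sub_norm_le w (vacuumZero T k)
          rw [norm_vacuumZero hT] at h3
          have h4 : |(k : ℝ)| ≤ n := by exact_mod_cast h
          nlinarith
        have hwk : w = ψ k := hψu k hkn w (mem_ball_iff_norm.mpr hk) hfw
        have hset : {k : ℤ | (if (n : ℤ) < |k| then ψ k else φ k) = w} = {k} := by
          ext j
          rw [Set.mem_ofPred_eq, Set.mem_singleton_iff]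
          constructor
          · intro hj
            rcases le_or_gt |j| (n : ℤ) with hjn | hjn
            · rw [hl1 j hjn] at hj
              exact absurd hj (hne j hjn)
            · rw [hl2 j hjn] at hj
              by_contra hjk
              have h5 := le_norm_vacuumZero_sub hT hjk
              have h6 := norm_sub_le_norm_sub_add_norm_sub (vacuumZero T j) w (vacuumZero T k)
              have h7 := mem_ball_iff_norm.mp (hψ j hjn)
              rw [hj, norm_sub_rev] at h7
              linarith
          · rintro rfl
            rw [hl2 j hkn, hwk]
        rw [hset, Set.encard_singleton, hwk, hψ1 k hkn]
      · have hset : {k : ℤ | (if (n : ℤ) < |k| then ψ k else φ k) = w} = ∅ := by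
          refine Set.eq_empty_of_forall_notMem fun j hj => ?_
          rw [Set.mem_ofPred_eq] at hj
          rcases le_or_gt |j| (n : ℤ) with hjn | hjn
          · rw [hl1 j hjn] at hj
            exact hne j hjn hj
          · rw [hl2 j hjn] at hj
            exact hfw (hj ▸ hψz j hjn)
        rw [hset, Set.encard_empty]
        exact ((hf.differentiable.analyticAt w).analyticOrderAt_eq_zero).mpr hfw
  · simp only [hl2 k hk]
    exact ⟨hψ k hk, hψu k hk⟩

end Counting

/-! ### Enumerations of the zeros of `a - d` -/

section Enumeration

variable {T : ℝ}

/-- If `a - d` is `exp (-π)`-close to `2 i sin (lam T / 2)` around `lam_{k,0}`, then the distance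
to `lam_{k,0}` of a zero of `a - d` is controlled by the value of `a - d` at `lam_{k,0}`. -/
theorem norm_sub_vacuumZero_le (hT : 0 < T) {f : ℂ → ℂ} (hf : Differentiable ℂ f) {k : ℤ}
    (h : ∀ lam ∈ Metric.ball (vacuumZero T k) (2 * (Real.pi / T)),
      ‖f lam - vacuumDiff T lam‖ ≤ Real.exp (-Real.pi) * Real.exp (|lam.im| * T / 2))
    {w : ℂ} (hw : w ∈ Metric.ball (vacuumZero T k) (Real.pi / T)) (hfw : f w = 0) :
    ‖w - vacuumZero T k‖ ≤ Real.pi / T * ‖f (vacuumZero T k)‖ := by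
  have h2 : 0 < Real.pi / T := by positivity
  have him : ∀ lam ∈ Metric.ball (vacuumZero T k) (2 * (Real.pi / T)),
      ‖f lam - vacuumDiff T lam‖ ≤ 1 := by
    intro lam hlam
    refine (h lam hlam).trans ?_
    rw [← Real.exp_add, Real.exp_le_one_iff]
    have h3 := (Complex.abs_im_le_norm _).trans (mem_ball_iff_norm.mp hlam).le
    have h4 : (vacuumZero T k).im = 0 := by
      have : vacuumZero T k = ((2 * Real.pi / T * k : ℝ) : ℂ) := by
        unfold vacuumZero
        push_cast
        ring
      rw [this, Complex.ofReal_im]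
    rw [Complex.sub_im, h4, sub_zero] at h3
    have h5 : |lam.im| * T / 2 ≤ 2 * (Real.pi / T) * T / 2 := by gcongr
    have h6 : 2 * (Real.pi / T) * T / 2 = Real.pi := by field_simp
    linarith
  have hmaps : Set.MapsTo (fun lam => f lam - vacuumDiff T lam)
      (Metric.ball (vacuumZero T k) (2 * (Real.pi / T)))
      (Metric.closedBall (f (vacuumZero T k) - vacuumDiff T (vacuumZero T k)) 2) := by
    intro lam hlam
    rw [mem_closedBall_iff_norm]
    refine (norm_sub_le _ _).trans ?_
    have := him lam hlam
    have := him _ (Metric.mem_ball_self (by positivity : 0 < 2 * (Real.pi / T)))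
    linarith
  have hw' : w ∈ Metric.ball (vacuumZero T k) (2 * (Real.pi / T)) :=
    Metric.ball_subset_ball (by linarith) hw
  have hs := Complex.dist_le_div_mul_dist_of_mapsTo_ball
    (hf.sub differentiable_vacuumDiff).differentiableOn hmaps hw'
  have hv : vacuumDiff T (vacuumZero T k) = 0 := (vacuumDiff_eq_zero_iff hT _).mpr ⟨k, rfl⟩
  have hsin : 2 * (T / Real.pi) * ‖w - vacuumZero T k‖ ≤ ‖vacuumDiff T w‖ := by
    have e1 : w * T / 2 = (w - vacuumZero T k) * ((T / 2 : ℝ) : ℂ) + k * Real.pi := by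
      rw [← vacuumZero_mul hT k]
      push_cast
      ring
    have e2 : ‖Complex.sin (w * T / 2)‖
        = ‖Complex.sin ((w - vacuumZero T k) * ((T / 2 : ℝ) : ℂ))‖ := by
      have e3 : ‖((-1 : ℂ)) ^ k‖ = 1 := by rw [norm_zpow, norm_neg, norm_one, one_zpow]
      rw [e1, Complex.sin_antiperiodic.add_int_mul_eq, norm_mul]
      simp
    have h3 := mem_ball_iff_norm.mp hw
    have h4 : ‖(w - vacuumZero T k) * ((T / 2 : ℝ) : ℂ)‖ = ‖w - vacuumZero T k‖ * (T / 2) := by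
      rw [norm_mul, Complex.norm_real, Real.norm_of_nonneg (by positivity)]
    have h5 := mul_norm_le_norm_sin (z := (w - vacuumZero T k) * ((T / 2 : ℝ) : ℂ)) (by
      rw [h4]
      have : ‖w - vacuumZero T k‖ * (T / 2) ≤ Real.pi / T * (T / 2) := by gcongr
      have h6 : Real.pi / T * (T / 2) = Real.pi / 2 := by field_simp
      linarith)
    rw [h4, ← e2] at h5
    unfold vacuumDiff
    rw [norm_mul, norm_mul, Complex.norm_I, Complex.norm_ofNat]
    have h6 : 2 * (T / Real.pi) * ‖w - vacuumZero T k‖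
        = 2 * (2 / Real.pi * (‖w - vacuumZero T k‖ * (T / 2))) := by field_simp
    rw [h6]
    linarith
  simp only [Pi.sub_apply, hfw, hv, zero_sub, sub_zero, dist_eq_norm] at hs
  have e7 : 2 / (2 * (Real.pi / T)) = T / Real.pi := by field_simp
  rw [e7] at hs
  have h8 : ‖vacuumDiff T w‖ ≤ ‖f (vacuumZero T k)‖ + ‖-vacuumDiff T w - f (vacuumZero T k)‖ := by
    have := norm_add_le (f (vacuumZero T k)) (-vacuumDiff T w - f (vacuumZero T k))
    rwa [add_sub_cancel, norm_neg] at this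
  have h9 : T / Real.pi * ‖w - vacuumZero T k‖ ≤ ‖f (vacuumZero T k)‖ := by linarith
  calc ‖w - vacuumZero T k‖ = Real.pi / T * (T / Real.pi * ‖w - vacuumZero T k‖) := by
        field_simp
    _ ≤ _ := by gcongr

/-- Locally uniformly in the potential, all zeros of `a - d` with large labels are the natural
ones. -/
theorem exists_isZeroLabelling (hT : 0 < T) (q : Potential T) :
    ∃ N₀ : ℕ, ∀ N ≥ N₀, ∃ lam : Potential T → ℤ → ℂ, IsZeroLabelling T q N lam := by
  obtain ⟨A, -, -, -, hA, -⟩ := exists_sequenceMaps T hT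
  have hpi := Real.pi_pos
  have h2 : 0 < Real.pi / T := by positivity
  have hε : Real.exp (-Real.pi) ≤ 1 / 2 := by
    rw [Real.exp_neg, ← one_div]
    refine one_div_le_one_div_of_le (by norm_num) ?_
    linarith [Real.add_one_le_exp Real.pi, Real.pi_gt_three]
  have hlarge : ∀ R : ℝ, ∃ N₀ : ℕ, ∀ N ≥ N₀, R ≤ (2 * N + 1) * (Real.pi / T) := by
    intro R
    obtain ⟨N₀, hN₀⟩ := exists_nat_ge (R / (Real.pi / T))
    refine ⟨N₀, fun N hN => ?_⟩
    rw [div_le_iff₀ h2] at hN₀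
    have : (N₀ : ℝ) ≤ N := by exact_mod_cast hN
    nlinarith
  have key : ∀ (q₁ : Potential T) (N : ℕ), (∀ lam : ℂ, (2 * N + 1) * (Real.pi / T) ≤ ‖lam‖ →
      ‖diagDiff T q₁ lam - vacuumDiff T lam‖
        ≤ Real.exp (-Real.pi) * Real.exp (|lam.im| * T / 2)) →
      ∃ lam : ℤ → ℂ, IsZeroEnumeration T q₁ lam ∧ ∀ k : ℤ, (N : ℤ) < |k| →
        lam k ∈ Metric.ball (vacuumZero T k) (Real.pi / T) ∧
        ∀ w ∈ Metric.ball (vacuumZero T k) (Real.pi / T), diagDiff T q₁ w = 0 → w = lam k := by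
    intro q₁ N hN
    have hd := differentiable_diagDiff hT.le q₁
    have hnear : IsNearVacuum T N (diagDiff T q₁) := ⟨hd, fun lam hlam =>
      (hN lam hlam).trans (by gcongr)⟩
    obtain ⟨lam, hlam, hlabel⟩ := hnear.exists_enumeration hT
    refine ⟨lam, ⟨hlam, ?_⟩, hlabel⟩
    have hzero : ∀ k, diagDiff T q₁ (lam k) = 0 := by
      intro k
      refine apply_eq_zero_of_analyticOrderAt_ne_zero ?_
      rw [hlam, Set.encard_ne_zero]
      exact ⟨k, rfl⟩
    rw [memℓp_two_iff_summable]
    have hs := (lp_hasSum_sq (A (q₁, 0))).summable.mul_left ((Real.pi / T) ^ 2)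
    refine Summable.of_norm_bounded_eventually hs ?_
    have hfin : {k : ℤ | |k| ≤ N + 1}.Finite := by
      refine (Finset.Icc (-(N + 1) : ℤ) (N + 1)).finite_toSet.subset fun k hk => ?_
      exact Finset.mem_coe.mpr (Finset.mem_Icc.mpr (abs_le.mp hk))
    refine hfin.subset fun k hk => ?_
    by_contra hk'
    rw [Set.mem_ofPred_eq, not_le] at hk'
    refine hk ?_
    have hk1 : (N : ℤ) < |k| := by omega
    have hb := norm_sub_vacuumZero_le hT hd (k := k) (fun l hl => hN l ?_) (hlabel k hk1).1
      (hzero k)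
    · change ‖‖lam k - vacuumZero T k‖ ^ 2‖ ≤ (Real.pi / T) ^ 2 * ‖A (q₁, 0) k‖ ^ 2
      rw [Real.norm_of_nonneg (by positivity), ← mul_pow]
      refine pow_le_pow_left₀ (norm_nonneg _) (hb.trans (le_of_eq ?_)) 2
      rw [hA, norm_mul, norm_zpow, norm_neg, norm_one, one_zpow, one_mul, lp.coeFn_zero,
        Pi.zero_apply, add_zero]
    · have h1 := norm_sub_norm_le (vacuumZero T k) l
      rw [norm_sub_rev, norm_vacuumZero hT] at h1
      have h3 : (N : ℝ) + 2 ≤ |(k : ℝ)| := by exact_mod_cast hk'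
      have h4 := mem_ball_iff_norm.mp hl
      nlinarith
  obtain ⟨R, hR⟩ := exists_eventually_norm_diagDiff_sub_le hT q (Real.exp_pos (-Real.pi))
  obtain ⟨N₀, hN₀⟩ := hlarge R
  refine ⟨N₀, fun N hN => ?_⟩
  have hex : ∀ q₁ : Potential T, ∃ lam : ℤ → ℂ, IsZeroEnumeration T q₁ lam ∧
      ((∀ l : ℂ, R ≤ ‖l‖ → ‖diagDiff T q₁ l - 2 * Complex.I * Complex.sin (l * T / 2)‖
        ≤ Real.exp (-Real.pi) * Real.exp (|l.im| * T / 2)) → ∀ k : ℤ, (N : ℤ) < |k| →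
        lam k ∈ Metric.ball (vacuumZero T k) (Real.pi / T) ∧
        ∀ w ∈ Metric.ball (vacuumZero T k) (Real.pi / T), diagDiff T q₁ w = 0 → w = lam k) := by
    intro q₁
    by_cases hq₁ : ∀ l : ℂ, R ≤ ‖l‖ → ‖diagDiff T q₁ l - 2 * Complex.I * Complex.sin (l * T / 2)‖
        ≤ Real.exp (-Real.pi) * Real.exp (|l.im| * T / 2)
    · obtain ⟨lam, h1, h3⟩ := key q₁ N fun l hl => hq₁ l ((hN₀ N hN).trans hl)
      exact ⟨lam, h1, fun _ => h3⟩
    · obtain ⟨R₁, hR₁⟩ := exists_eventually_norm_diagDiff_sub_le hT q₁ (Real.exp_pos (-Real.pi))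
      obtain ⟨N₁, hN₁⟩ := hlarge R₁
      obtain ⟨lam, h1, -⟩ := key q₁ N₁ fun l hl => hR₁.self_of_nhds l ((hN₁ N₁ le_rfl).trans hl)
      exact ⟨lam, h1, fun h => absurd h hq₁⟩
  choose lam hlam hlabel using hex
  exact ⟨lam, hlam, hR.mono fun q₁ hq₁ => hlabel q₁ hq₁⟩

end Enumeration


/-! ### Inverse functions -/

section Inverse

variable {E F : Type*} [NormedAddCommGroup E] [NormedSpace ℝ E] [CompleteSpace E]
  [NormedAddCommGroup F] [NormedSpace ℝ F]

/-- A bounded operator close enough to an isomorphism is an isomorphism, by the Neumann series. -/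
theorem exists_equiv_of_norm_sub_le (e : E ≃L[ℝ] F) (A : E →L[ℝ] F) {η C : ℝ}
    (hη : 0 ≤ η) (h : ∀ x, ‖A x - e x‖ ≤ η * ‖x‖) (hC : ∀ y, ‖e.symm y‖ ≤ C * ‖y‖) (hC0 : 0 ≤ C)
    (hlt : C * η < 1) : ∃ e' : E ≃L[ℝ] F, (e' : E →L[ℝ] F) = A := by
  set t : E →L[ℝ] E := ContinuousLinearMap.id ℝ E - (e.symm : F →L[ℝ] E) ∘L A with ht
  have ht1 : ‖t‖ < 1 := by
    refine (ContinuousLinearMap.opNorm_le_bound _ (mul_nonneg hC0 hη) fun x => ?_).trans_lt hlt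
    have h1 : t x = -e.symm (A x - e x) := by
      rw [map_sub, e.symm_apply_apply, neg_sub]
      rfl
    rw [h1, norm_neg, mul_assoc]
    exact (hC _).trans (mul_le_mul_of_nonneg_left (h x) hC0)
  refine ⟨(ContinuousLinearEquiv.ofUnit (Units.oneSub t ht1)).trans e, ?_⟩
  ext x
  change e ((1 - t) x) = A x
  rw [ht]
  change e (x - (x - e.symm (A x))) = A x
  rw [sub_sub_cancel, e.apply_symm_apply]

/-- The inverse function theorem for smooth functions: the local inverse is smooth on an open
set. -/
theorem exists_openPartialHomeomorph {f : E → F} {U : Set E} (hU : IsOpen U)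
    (hf : ContDiffOn ℝ ∞ f U) {a : E} (ha : a ∈ U) {f' : E ≃L[ℝ] F}
    (hf' : HasFDerivAt f (f' : E →L[ℝ] F) a) :
    ∃ e : OpenPartialHomeomorph E F, (∀ x, e x = f x) ∧ a ∈ e.source ∧ e.source ⊆ U ∧
      ContDiffOn ℝ ∞ e.symm e.target := by
  have hfa : ∀ x ∈ U, ContDiffAt ℝ ∞ f x := fun x hx => hf.contDiffAt (hU.mem_nhds hx)
  set e₀ := (hfa a ha).toOpenPartialHomeomorph f hf' (by simp) with he₀
  set V : Set E := U ∩ fderiv ℝ f ⁻¹' (Set.range ((↑) : (E ≃L[ℝ] F) → E →L[ℝ] F)) with hV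
  have hVo : IsOpen V :=
    (hf.continuousOn_fderiv_of_isOpen hU (by simp)).isOpen_inter_preimage hU
      ContinuousLinearEquiv.isOpen
  have haV : a ∈ V := ⟨ha, f', hf'.fderiv.symm⟩
  refine ⟨e₀.restrOpen V hVo, fun _ => rfl, ?_, ?_, ?_⟩
  · rw [OpenPartialHomeomorph.restrOpen_source]
    exact ⟨ContDiffAt.mem_toOpenPartialHomeomorph_source _ hf' _, haV⟩
  · rw [OpenPartialHomeomorph.restrOpen_source]
    exact fun x hx => hx.2.1
  · intro y hy
    have hx := (e₀.restrOpen V hVo).map_target hy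
    rw [OpenPartialHomeomorph.restrOpen_source] at hx
    obtain ⟨-, hxU, g, hg⟩ := hx
    refine ContDiffAt.contDiffWithinAt
      ((e₀.restrOpen V hVo).contDiffAt_symm (f₀' := g) hy ?_ (hfa _ hxU))
    rw [hg]
    exact ((hfa _ hxU).differentiableAt (by simp)).hasFDerivAt

end Inverse

/-! ### The local diffeomorphism -/

section LocalDiffeomorphism

theorem exists_norm_tail_le {c : ℤ → ℝ} (hc : Summable fun k => c k ^ 2) {η : ℝ} (hη : 0 < η) :
    ∃ N₀ : ℕ, ∀ N ≥ N₀, ∀ (f : EllTwoTail N) (B : ℝ), 0 ≤ B →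
      (∀ k, ‖f k‖ ≤ c k.1 * B) → ‖f‖ ≤ η * B := by
  obtain ⟨s, hs⟩ := summable_iff_vanishing_norm.mp hc (η ^ 2) (by positivity)
  obtain ⟨N₀, hN₀⟩ : ∃ N₀ : ℕ, ∀ k ∈ s, |k| ≤ (N₀ : ℤ) := by
    refine ⟨∑ k ∈ s, k.natAbs, fun k hk => ?_⟩
    have := Finset.single_le_sum (f := fun k : ℤ => k.natAbs) (fun _ _ => Nat.zero_le _) hk
    rw [Int.abs_eq_natAbs]
    exact_mod_cast this
  refine ⟨N₀, fun N hN f B hB hf => lp_norm_le (mul_nonneg hη.le hB) fun t => ?_⟩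
  have h1 := hs (t.map (Function.Embedding.subtype _)) (by
    rw [Finset.disjoint_left]
    intro k hk hks
    obtain ⟨j, -, rfl⟩ := Finset.mem_map.mp hk
    have h2 := hN₀ _ hks
    have h3 := j.2
    change |j.1| ≤ (N₀ : ℤ) at h2
    omega)
  rw [Real.norm_of_nonneg (Finset.sum_nonneg fun _ _ => sq_nonneg _), Finset.sum_map] at h1
  calc ∑ k ∈ t, ‖f k‖ ^ 2 ≤ ∑ k ∈ t, c k.1 ^ 2 * B ^ 2 := by
        refine Finset.sum_le_sum fun k _ => ?_
        rw [← mul_pow]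
        exact pow_le_pow_left₀ (norm_nonneg _) (hf k) 2
    _ = (∑ k ∈ t, c k.1 ^ 2) * B ^ 2 := by rw [Finset.sum_mul]
    _ ≤ η ^ 2 * B ^ 2 := mul_le_mul_of_nonneg_right h1.le (sq_nonneg B)
    _ = (η * B) ^ 2 := by ring

variable {T : ℝ}

/-- The directions of the pairs of a potential and a sequence that are free for given Fourier
coefficients and labels `|k| ≤ N`. -/
noncomputable def tailInclusion (T : ℝ) (N : ℕ) :
    vanishingFourierCoeffs T N × EllTwoTail N →L[ℝ] Potential T × lp (fun _ : ℤ => ℂ) 2 :=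
  ((vanishingFourierCoeffs T N).subtypeL ∘L ContinuousLinearMap.fst ℝ _ _).prod
    (tailExtend N ∘L ContinuousLinearMap.snd ℝ _ _)

theorem tailInclusion_apply (N : ℕ) (x : vanishingFourierCoeffs T N × EllTwoTail N) :
    tailInclusion T N x = ((x.1 : Potential T), tailExtend N x.2) := rfl

theorem norm_tailInclusion_le (N : ℕ) (x : vanishingFourierCoeffs T N × EllTwoTail N) :
    ‖tailInclusion T N x‖ ≤ ‖x‖ := by
  rw [tailInclusion_apply]
  exact max_le ((norm_fst_le x)) ((norm_tailExtend_le N x.2).trans (norm_snd_le x))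

set_option maxHeartbeats 400000 in
/-- The zeros with labels `|k| > N` as functions of the potential, by the implicit function theorem
applied to `A = 0`, and the derivative of the function `Z` at these zeros. The derivatives of `A`
and `Z` are close to multiplication by `i T` and to the Fourier transform, respectively. -/
theorem exists_implicit_zeros (hT : 0 < T)
    {A Z : Potential T × lp (fun _ : ℤ => ℂ) 2 → lp (fun _ : ℤ => ℂ) 2}
    (hA : ContDiff ℝ ∞ A) (hZ : ContDiff ℝ ∞ Z) (x₀ : Potential T × lp (fun _ : ℤ => ℂ) 2)
    (hx₀ : A x₀ = 0) {c : ℤ → ℝ}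
    (hder : ∀ k δ, ‖fderiv ℝ A x₀ δ k - Complex.I * T * δ.2 k‖ ≤ c k * ‖δ‖ ∧
        ‖fderiv ℝ Z x₀ δ k - potentialFourierCoeff T δ.1 k‖ ≤ c k * ‖δ‖)
    (hc0 : ∀ k, 0 ≤ c k) {N : ℕ} {η : ℝ} (hη0 : 0 < η) (hηT : 2 * η ≤ T) (hηT' : η < √T)
    (hη : ∀ (f : EllTwoTail N) (B : ℝ), 0 ≤ B → (∀ k, ‖f k‖ ≤ c k.1 * B) → ‖f‖ ≤ η * B) :
    ∃ (U : Set (vanishingFourierCoeffs T N)) (m : vanishingFourierCoeffs T N → EllTwoTail N),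
      IsOpen U ∧ 0 ∈ U ∧ m 0 = 0 ∧ ContDiffOn ℝ ∞ m U ∧
      (∀ h ∈ U, tailRestrict N (A (x₀ + tailInclusion T N (h, m h))) = 0) ∧
      ∃ f' : vanishingFourierCoeffs T N ≃L[ℝ] EllTwoTail N,
        HasFDerivAt (fun h => tailRestrict N (Z (x₀ + tailInclusion T N (h, m h))))
          (f' : vanishingFourierCoeffs T N →L[ℝ] EllTwoTail N) 0 := by
  have := completeSpace_vanishingFourierCoeffs T N hT
  set L := tailInclusion T N with hL
  set DA : vanishingFourierCoeffs T N × EllTwoTail N →L[ℝ] EllTwoTail N :=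
    tailRestrict N ∘L fderiv ℝ A x₀ ∘L L with hDA
  set DZ : vanishingFourierCoeffs T N × EllTwoTail N →L[ℝ] EllTwoTail N :=
    tailRestrict N ∘L fderiv ℝ Z x₀ ∘L L with hDZ
  have hDAb : ∀ x, ‖DA x - (Complex.I * T) • x.2‖ ≤ η * ‖x‖ := by
    intro x
    refine hη _ _ (norm_nonneg x) fun k => ?_
    refine le_trans ?_ (mul_le_mul_of_nonneg_left (norm_tailInclusion_le N x) (hc0 k.1))
    refine le_trans (le_of_eq ?_) (hder k.1 (L x)).1
    have : (L x).2 k.1 = x.2 k := tailExtend_apply_of_lt N x.2 k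
    rw [this]
    rfl
  have hDZb : ∀ x, ‖DZ x - fourierTail T N hT x.1‖ ≤ η * ‖x‖ := by
    intro x
    refine hη _ _ (norm_nonneg x) fun k => ?_
    refine le_trans ?_ (mul_le_mul_of_nonneg_left (norm_tailInclusion_le N x) (hc0 k.1))
    exact (hder k.1 (L x)).2
  have hadd : ∀ x, HasFDerivAt (fun x => x₀ + L x) L x := fun x => L.hasFDerivAt.const_add x₀
  have hx0 : x₀ + L 0 = x₀ := by rw [map_zero, add_zero]
  set FA : vanishingFourierCoeffs T N × EllTwoTail N → EllTwoTail N :=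
    fun x => tailRestrict N (A (x₀ + L x)) with hFA
  have hFAs : ContDiff ℝ ∞ FA :=
    (tailRestrict N).contDiff.comp (hA.comp (contDiff_const.add L.contDiff))
  have hFAd : HasFDerivAt FA DA 0 := by
    have h1 : HasFDerivAt A (fderiv ℝ A x₀) (x₀ + L 0) := by
      rw [hx0]
      exact (hA.differentiable (by simp)).differentiableAt.hasFDerivAt
    have h2 : HasFDerivAt (fun x => A (x₀ + L x)) (fderiv ℝ A x₀ ∘L L) 0 :=
      HasFDerivAt.comp (g := A) (f := fun x => x₀ + L x) 0 h1 (hadd 0)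
    exact (tailRestrict N).hasFDerivAt.comp 0 h2
  have hFZd : HasFDerivAt (fun x => tailRestrict N (Z (x₀ + L x))) DZ 0 := by
    have h1 : HasFDerivAt Z (fderiv ℝ Z x₀) (x₀ + L 0) := by
      rw [hx0]
      exact (hZ.differentiable (by simp)).differentiableAt.hasFDerivAt
    have h2 : HasFDerivAt (fun x => Z (x₀ + L x)) (fderiv ℝ Z x₀ ∘L L) 0 :=
      HasFDerivAt.comp (g := Z) (f := fun x => x₀ + L x) 0 h1 (hadd 0)
    exact (tailRestrict N).hasFDerivAt.comp 0 h2
  have hT' : (T : ℂ) ≠ 0 := by exact_mod_cast hT.ne'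
  have hnT : ∀ y : EllTwoTail N, ‖(Complex.I * T) • y‖ = T * ‖y‖ := by
    intro y
    rw [norm_smul, norm_mul, Complex.norm_I, one_mul, Complex.norm_real,
      Real.norm_of_nonneg hT.le]
  -- The partial derivative of the zero equation is a small perturbation of `i T`.
  obtain ⟨B, hB⟩ : ∃ B : EllTwoTail N ≃L[ℝ] EllTwoTail N,
      (B : EllTwoTail N →L[ℝ] EllTwoTail N) = DA ∘L ContinuousLinearMap.inr ℝ _ _ := by
    set u : ℂˣ := Units.mk0 (Complex.I * T) (mul_ne_zero Complex.I_ne_zero hT') with hu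
    refine exists_equiv_of_norm_sub_le
      (ContinuousLinearEquiv.smulLeft (R₁ := ℝ) (M₁ := EllTwoTail N) u)
      (DA ∘L ContinuousLinearMap.inr ℝ _ _) (η := η) (C := T⁻¹) hη0.le (fun y => ?_)
      (fun y => ?_) (by positivity) ?_
    · have h1 := hDAb (0, y)
      have h2 : ‖((0 : vanishingFourierCoeffs T N), y)‖ = ‖y‖ := by
        rw [Prod.norm_mk, norm_zero, max_eq_right (norm_nonneg y)]
      rw [h2] at h1
      exact h1
    · obtain ⟨z, rfl⟩ := (ContinuousLinearEquiv.smulLeft (R₁ := ℝ) (M₁ := EllTwoTail N)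
        u).surjective y
      rw [ContinuousLinearEquiv.symm_apply_apply]
      have h1 : ‖ContinuousLinearEquiv.smulLeft (R₁ := ℝ) (M₁ := EllTwoTail N) u z‖ = T * ‖z‖ :=
        hnT z
      rw [h1, inv_mul_cancel_left₀ hT.ne']
    · rw [inv_mul_eq_div, div_lt_one hT]
      linarith
  set Θ : vanishingFourierCoeffs T N × EllTwoTail N →
    vanishingFourierCoeffs T N × EllTwoTail N := fun x => (x.1, FA x) with hΘ
  have hΘs : ContDiff ℝ ∞ Θ := contDiff_fst.prodMk hFAs
  set Θ' := (ContinuousLinearEquiv.refl ℝ (vanishingFourierCoeffs T N)).skewProd B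
    (DA ∘L ContinuousLinearMap.inl ℝ _ _) with hΘ'
  have hΘd : HasFDerivAt Θ (Θ' : vanishingFourierCoeffs T N × EllTwoTail N →L[ℝ]
      vanishingFourierCoeffs T N × EllTwoTail N) 0 := by
    refine (hasFDerivAt_fst.prodMk hFAd).congr_fderiv ?_
    refine ContinuousLinearMap.ext fun x => Prod.ext rfl ?_
    have h1 : B x.2 = DA (0, x.2) := congrArg (fun M => M x.2) hB
    change DA x = B x.2 + DA (x.1, 0)
    rw [h1, ← map_add, Prod.mk_add_mk, zero_add, add_zero]
  obtain ⟨e, he, he0, -, hes⟩ := exists_openPartialHomeomorph isOpen_univ hΘs.contDiffOn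
    (Set.mem_univ _) hΘd
  have hFA0 : FA 0 = 0 := by
    rw [hFA]
    simp only
    rw [hx0, hx₀, map_zero]
  have heat0 : e 0 = ((0 : vanishingFourierCoeffs T N), (0 : EllTwoTail N)) := by
    rw [he, hΘ]
    simp only
    rw [hFA0]
    rfl
  set ι : vanishingFourierCoeffs T N → vanishingFourierCoeffs T N × EllTwoTail N :=
    fun h => (h, 0) with hι
  have hιs : ContDiff ℝ ∞ ι := contDiff_id.prodMk contDiff_const
  set U : Set (vanishingFourierCoeffs T N) := ι ⁻¹' e.target with hU
  have hUo : IsOpen U := e.open_target.preimage hιs.continuous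
  have h0U : (0 : vanishingFourierCoeffs T N) ∈ U := by
    change ((0 : vanishingFourierCoeffs T N), (0 : EllTwoTail N)) ∈ e.target
    rw [← heat0]
    exact e.map_source he0
  set m : vanishingFourierCoeffs T N → EllTwoTail N := fun h => (e.symm (ι h)).2 with hm
  have hms : ContDiffOn ℝ ∞ m U :=
    contDiff_snd.comp_contDiffOn (hes.comp hιs.contDiffOn fun h hh => hh)
  have hm0 : m 0 = 0 := by
    have h1 : e.symm (ι 0) = 0 := by
      change e.symm ((0 : vanishingFourierCoeffs T N), (0 : EllTwoTail N)) = 0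
      rw [← heat0, e.left_inv he0]
    rw [hm]
    simp only
    rw [h1]
    rfl
  have hzero : ∀ h ∈ U, FA (h, m h) = 0 := by
    intro h hh
    have h1 : Θ (e.symm (ι h)) = ι h := by rw [← he, e.right_inv hh]
    have h2 : (e.symm (ι h)).1 = h := congrArg Prod.fst h1
    have h3 : FA (e.symm (ι h)) = 0 := congrArg Prod.snd h1
    have h4 : (h, m h) = e.symm (ι h) := Prod.ext h2.symm rfl
    rw [h4, h3]
  refine ⟨U, m, hUo, h0U, hm0, hms, hzero, ?_⟩
  have hmd : HasFDerivAt m (fderiv ℝ m 0) 0 :=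
    ((hms.contDiffAt (hUo.mem_nhds h0U)).differentiableAt (by simp)).hasFDerivAt
  set m' := fderiv ℝ m 0
  have hgraph : HasFDerivAt (fun h => (h, m h))
      ((ContinuousLinearMap.id ℝ (vanishingFourierCoeffs T N)).prod m') 0 :=
    (hasFDerivAt_id 0).prodMk hmd
  have hgraph0 : ((0 : vanishingFourierCoeffs T N), m 0) = 0 := by rw [hm0]; rfl
  have hDA0 : ∀ h, DA (h, m' h) = 0 := by
    have h1 : HasFDerivAt (fun h => FA (h, m h))
        (DA ∘L (ContinuousLinearMap.id ℝ (vanishingFourierCoeffs T N)).prod m') 0 := by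
      refine HasFDerivAt.comp (g := FA) 0 ?_ hgraph
      rw [hgraph0]
      exact hFAd
    have h2 : HasFDerivAt (fun h => FA (h, m h))
        (0 : vanishingFourierCoeffs T N →L[ℝ] EllTwoTail N) 0 := by
      refine (hasFDerivAt_const (0 : EllTwoTail N) 0).congr_of_eventuallyEq ?_
      filter_upwards [hUo.mem_nhds h0U] with h hh using hzero h hh
    exact fun h => congrArg (fun M => M h) (h1.unique h2)
  have hm'b : ∀ h, ‖m' h‖ ≤ ‖h‖ := by
    intro h
    have h1 := hDAb (h, m' h)
    rw [hDA0, zero_sub, norm_neg, hnT, Prod.norm_mk] at h1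
    by_contra! hlt
    rw [max_eq_right hlt.le] at h1
    have h2 : 0 < ‖m' h‖ := (norm_nonneg h).trans_lt hlt
    nlinarith
  obtain ⟨f', hf'⟩ := exists_equiv_of_norm_sub_le (fourierTail T N hT)
    (DZ ∘L (ContinuousLinearMap.id ℝ (vanishingFourierCoeffs T N)).prod m') (η := η)
    (C := (√T)⁻¹) hη0.le (fun h => by
      have h1 := hDZb (h, m' h)
      rw [Prod.norm_mk, max_eq_left (hm'b h)] at h1
      exact h1) (fun y => (ContinuousLinearMap.le_opNorm _ y).trans
        (mul_le_mul_of_nonneg_right (norm_fourierTail_symm_le T N hT) (norm_nonneg y)))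
    (by positivity) (by
      rw [inv_mul_eq_div, div_lt_one (Real.sqrt_pos.mpr hT)]
      exact hηT')
  refine ⟨f', ?_⟩
  rw [hf']
  refine HasFDerivAt.comp (g := fun x => tailRestrict N (Z (x₀ + L x))) 0 ?_ hgraph
  rw [hgraph0]
  exact hFZd

theorem exists_norm_apply_lt (μ : lp (fun _ : ℤ => ℂ) 2) {ε : ℝ} (hε : 0 < ε) :
    ∃ N₀ : ℕ, ∀ k : ℤ, (N₀ : ℤ) < |k| → ‖μ k‖ < ε := by
  obtain ⟨N₀, hN₀⟩ := exists_norm_tail_le (lp_hasSum_sq μ).summable (half_pos hε)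
  refine ⟨N₀, fun k hk => ?_⟩
  have h1 := hN₀ N₀ le_rfl (tailRestrict N₀ μ) 1 zero_le_one fun k => by
    rw [mul_one, tailRestrict_apply]
  have h2 := lp_norm_apply_le (tailRestrict N₀ μ) ⟨k, hk⟩
  rw [tailRestrict_apply] at h2
  linarith

end LocalDiffeomorphism

end PerturbedFourier

open PerturbedFourier in
theorem mainTheorem4 (T : ℝ) (hT : 0 < T) (q : Potential T) :
    ∃ N : ℕ,
      (∃ lam : Potential T → ℤ → ℂ, IsZeroLabelling T q N lam) ∧
      ∀ lam : Potential T → ℤ → ℂ, IsZeroLabelling T q N lam →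
        ∃ Phi : Potential T → EllTwoTail N,
          (∀ q₁ k, Phi q₁ k = perturbedFourierCoeff T q₁ (lam q₁) k) ∧
          IsLocalDiffeomorphAt 𝓘(ℝ, vanishingFourierCoeffs T N) 𝓘(ℝ, EllTwoTail N) ∞
            (fun h : vanishingFourierCoeffs T N => Phi (q + h)) 0 := by
  have hpi : 0 < Real.pi / T := div_pos Real.pi_pos hT
  obtain ⟨A, Z, hA, hZ, hAk, hZk, hder⟩ := exists_sequenceMaps T hT
  obtain ⟨N₀, hN₀⟩ := exists_isZeroLabelling hT q
  obtain ⟨lam₀, hlam₀⟩ := hN₀ N₀ le_rfl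
  have hzero₀ : ∀ k, diagDiff T q (lam₀ q k) = 0 := fun k => by
    refine apply_eq_zero_of_analyticOrderAt_ne_zero ?_
    rw [(hlam₀.enumeration q).1, Set.encard_ne_zero]
    exact ⟨k, rfl⟩
  set μ : lp (fun _ : ℤ => ℂ) 2 :=
    ⟨fun k => lam₀ q k - vacuumZero T k, (hlam₀.enumeration q).2⟩ with hμ
  have hAμ : A (q, μ) = 0 := by
    ext k
    rw [hAk]
    change (-1) ^ k * diagDiff T q (vacuumZero T k + (lam₀ q k - vacuumZero T k)) = 0
    rw [add_sub_cancel, hzero₀, mul_zero]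
  obtain ⟨c, hc0, hc, hcd⟩ := hder (q, μ)
  have hsqrt : 0 < √T := Real.sqrt_pos.mpr hT
  -- The smallness that makes the two derivatives invertible.
  set η := min (T / 2) (√T / 2) with hη
  have hη0 : 0 < η := lt_min (half_pos hT) (half_pos hsqrt)
  obtain ⟨N₁, hN₁⟩ := exists_norm_tail_le hc hη0
  obtain ⟨N₂, hN₂⟩ := exists_norm_apply_lt μ (half_pos hpi)
  set N := max N₀ (max N₁ N₂) with hN
  have hN₁N : N₁ ≤ N := (le_max_left _ _).trans (le_max_right _ _)
  have hN₂N : N₂ ≤ N := (le_max_right _ _).trans (le_max_right _ _)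
  refine ⟨N, hN₀ N (le_max_left _ _), fun lam hlam => ?_⟩
  set Phi : Potential T → EllTwoTail N := fun q₁ => tailRestrict N (Z (q₁,
    ⟨fun k => lam q₁ k - vacuumZero T k, (hlam.enumeration q₁).2⟩)) with hPhi
  have hPhik : ∀ q₁ k, Phi q₁ k = perturbedFourierCoeff T q₁ (lam q₁) k := by
    intro q₁ k
    rw [hPhi]
    simp only
    rw [tailRestrict_apply, hZk, perturbedFourierCoeff, add_sub_cancel]
  refine ⟨Phi, hPhik, ?_⟩
  obtain ⟨U, m, hU, h0U, hm0, hm, hmzero, f', hf'⟩ := exists_implicit_zeros hT hA hZ (q, μ) hAμ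
    hcd hc0 hη0 (by linarith [min_le_left (T / 2) (√T / 2)])
    (by linarith [min_le_right (T / 2) (√T / 2)]) (hN₁ N hN₁N)
  have hcomplete := completeSpace_vanishingFourierCoeffs T N hT
  have hadd : Continuous fun h : vanishingFourierCoeffs T N => q + (h : Potential T) :=
    continuous_const.add continuous_subtype_val
  have hlabel : ∀ᶠ h : vanishingFourierCoeffs T N in 𝓝 0, ∀ k : ℤ, (N : ℤ) < |k| →
      ∀ w ∈ Metric.ball (vacuumZero T k) (Real.pi / T), diagDiff T (q + h) w = 0 →
        w = lam (q + h) k := by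
    have h1 := hadd.tendsto 0
    rw [ZeroMemClass.coe_zero, add_zero] at h1
    filter_upwards [h1.eventually hlam.label] with h hh k hk using (hh k hk).2
  have hmsmall : ∀ᶠ h : vanishingFourierCoeffs T N in 𝓝 0, ‖m h‖ < Real.pi / T / 2 := by
    have h1 := ((hm.contDiffAt (hU.mem_nhds h0U)).continuousAt).norm
    refine h1.eventually (gt_mem_nhds ?_)
    change ‖m 0‖ < Real.pi / T / 2
    rw [hm0, norm_zero]
    exact half_pos hpi
  obtain ⟨W, hWsub, hW, h0W⟩ := mem_nhds_iff.mp
    (inter_mem (hU.mem_nhds h0U) (inter_mem hlabel hmsmall))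
  -- Near `q`, the zeros with the labels `|k| > N` are the ones given by the implicit function.
  have heq : ∀ h ∈ W, Phi (q + h)
      = tailRestrict N (Z ((q, μ) + tailInclusion T N (h, m h))) := by
    intro h hh
    obtain ⟨hhU, hhl, hhm⟩ := hWsub hh
    ext k
    have hx : (q, μ) + tailInclusion T N (h, m h) = (q + h, μ + tailExtend N (m h)) := rfl
    have hk2 : ‖μ k.1‖ < Real.pi / T / 2 :=
      hN₂ k.1 (lt_of_le_of_lt (by exact_mod_cast hN₂N) k.2)
    have hmk : (μ + tailExtend N (m h)) k.1 = μ k.1 + m h k := by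
      rw [lp.coeFn_add, Pi.add_apply, tailExtend_apply_of_lt]
    have hball : vacuumZero T k.1 + (μ + tailExtend N (m h)) k.1
        ∈ Metric.ball (vacuumZero T k.1) (Real.pi / T) := by
      rw [mem_ball_iff_norm, add_sub_cancel_left, hmk]
      have h1 : ‖m h k‖ < Real.pi / T / 2 := (lp_norm_apply_le (m h) k).trans_lt hhm
      exact (norm_add_le _ _).trans_lt (by linarith)
    have hz : diagDiff T (q + h) (vacuumZero T k.1 + (μ + tailExtend N (m h)) k.1) = 0 := by
      have h1 := congrArg (fun f : EllTwoTail N => f k) (hmzero h hhU)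
      simp only at h1
      rw [hx, tailRestrict_apply, hAk] at h1
      exact (mul_eq_zero.mp h1).resolve_left (zpow_ne_zero _ (by norm_num))
    rw [hPhik, hx, tailRestrict_apply, hZk, hhl k.1 k.2 _ hball hz, perturbedFourierCoeff]
  have hsmooth : ContDiffOn ℝ ∞
      (fun h => tailRestrict N (Z ((q, μ) + tailInclusion T N (h, m h)))) W := by
    refine (tailRestrict N).contDiff.comp_contDiffOn (hZ.comp_contDiffOn ?_)
    refine contDiffOn_const.add ((tailInclusion T N).contDiff.comp_contDiffOn ?_)
    exact contDiffOn_id.prodMk (hm.mono fun h hh => (hWsub hh).1)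
  obtain ⟨e, he, he0, heW, hes⟩ := exists_openPartialHomeomorph hW hsmooth h0W hf'
  refine ⟨⟨e.toPartialEquiv, e.open_source, e.open_target, ?_, ?_⟩, he0, fun h hh => ?_⟩
  · refine ContDiffOn.contMDiffOn ((hsmooth.mono heW).congr fun h hh => ?_)
    exact he h
  · exact hes.contMDiffOn
  · exact (heq h (heW hh)).trans (he h).symm
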